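/- **Setting.** Let $1\le d_K<d_A$ and let $H$ be even. A linear latent contextual bandit has a feature map $\phi:\mathcal X\times\mathcal A\to\mathbb R^{d_A}$, a matrix $U_\star\in\mathbb R^{d_A\times d_K}$ with orthonormal columns, a law of the latent state $\theta\in\mathbb R^{d_K}$ and a law of centered sub-Gaussian noise $\varepsilon$; the reward of $(x,a)$ is $\phi(x,a)^\top\beta+\varepsilon$ with $\beta=U_\star\theta$. The offline data are $N$ i.i.d. trajectories of $H$ steps. In each of them $\theta_n$, the contexts $x_{n,h}$ and the noises are independent, the action $a_{n,h}$ is drawn from a behavior policy $\pi_b(\cdot\mid x_{n,h})$, and the contexts have the same distribution in the two halves $\tau_{n,1},\tau_{n,2}$ (odd and even steps, with matching laws step by step). For $\mu>0$ put $$V_{n,i}=\mu I+\sum_{(x,a,r)\in\tau_{n,i}}\phi(x,a)\phi(x,a)^\top,\quad \hat\beta_{n,i}=V_{n,i}^{-1}\sum_{(x,a,r)\in\tau_{n,i}}\phi(x,a)r,\quad D_{n,i}=I-\mu V_{n,i}^{-1},$$ $M_n=\frac12(\hat\beta_{n,1}\hat\beta_{n,2}^\top+\hat\beta_{n,2}\hat\beta_{n,1}^\top)$,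 $\bar M_N=\frac1N\sum_nM_n$, $\bar D_{N,i}=\frac1N\sum_nD_{n,i}$ and $\hat\Sigma=\bar D_{N,1}^{-1}\bar M_N\bar D_{N,2}^{-1}$. Eigenvalues $\lambda_1\ge\lambda_2\ge\dots$ are counted with multiplicity and, for the possibly non-symmetric $\hat\Sigma$, ordered by (and identified with) their real parts. The columns of $\hat U\in\mathbb R^{d_A\times d_K}$ are an orthonormal basis of the span of the (generalized) eigenvectors of $\hat\Sigma$ for its $d_K$ largest eigenvalues. Norms of matrices are operator norms. **Assumptions.** For some $R>0$: $|r_{n,h}|\le R$ and $\|\beta\|_2\le R$ almost surely, $\|\phi(x,a)\|_2\le1$; $\lambda_A:=\min_{i=1,2}\lambda_{\min}(\mathbb E[D_{n,i}])>0$ and $\lambda_\theta:=\frac1{R^2}\lambda_{\min}(\operatorname{Cov}(\theta))>0$. Let $0<\delta<1$. With $B_D=\max_{i}\|\bar D_{N,i}^{-1}\|$ and an eigengap $\hat\lambda$ let $$\Delta_{\rm off}(\hat\lambda)=\frac{2\sqrt{2d_K}}{\hat\lambda}\left(\frac{B_D^3(2-B_D\Delta_D)}{(1-B_D\Delta_D)^2}(R^2+\Delta_M)\Delta_D+\Big(\frac{B_D}{1-B_D\Delta_D}\Big)^2\Delta_M\right),$$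 which is well defined if both $\bar D_{N,i}$ are invertible, $\hat\lambda>0$ and $B_D\Delta_D<1$. **(1)** Let $\Delta_M,\Delta_D$ be (possibly data-dependent) numbers such that each of $\|\bar M_N-\mathbb E[M_1]\|\le\Delta_M$, $\|\bar D_{N,1}-\mathbb E[D_{1,1}]\|\le\Delta_D$ and $\|\bar D_{N,2}-\mathbb E[D_{1,2}]\|\le\Delta_D$ holds with probability at least $1-\delta/3$. Then, with probability at least $1-\delta$, $$\|\hat U\hat U^\top-U_\star U_\star^\top\|\le\Delta_{\rm off}(\hat\lambda)$$ whenever the right-hand side is well defined, both for $\hat\lambda=\lambda_{d_K}(\bar M_N)-\lambda_{d_K+1}(\bar M_N)$ and for $\hat\lambda=\lambda_{d_K}(\hat\Sigma)-\lambda_{d_K+1}(\hat\Sigma)$. **(2)** Take $\hat\lambda=\lambda_{d_K}(\hat\Sigma)-\lambda_{d_K+1}(\hat\Sigma)$, $\Delta_D=\sqrt{8\log(4d_A/\delta)/N}$ and $$\Delta_M=\sqrt{2\Big\|\frac1N\sum_{n=1}^NM_n^2\Big\|\frac{\log(4d_A/\delta)}N}+2R^2\Big(2+\frac H{2\mu}\Big)\Big(\frac{2\log(4d_A/\delta)}N\Big)^{3/4}+4R^2\Big(2+\frac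 H{2\mu}\Big)\frac{\log(4d_A/\delta)}{3N}.$$ There is a constant $C$ that depends only on $\mu$ such that, for all $N\ge N_0$, with probability at least $1-\delta$, $\Delta_{\rm off}(\hat\lambda)$ is well defined and $$\Delta_{\rm off}(\hat\lambda)\le\frac{C}{\lambda_\theta\lambda_A^3}\sqrt{\frac{d_Kd_A\log(d_A/\delta)}N}.$$ Here $N_0$ depends only on $\mu,d_A,d_K,H,R,\delta$ and positive lower bounds on $\lambda_A$ and $\lambda_\theta$. -/

import Mathlib

open MeasureTheory ProbabilityTheory
open scoped Matrix Matrix.Norms.L2Operator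

namespace LatentBandit

noncomputable section

/-! ### Eigenvalues of real square matrices

Throughout, `‖A‖` is the operator norm of a matrix with respect to the Euclidean norms. -/

/-- The real parts of the complex eigenvalues of a real matrix, with algebraic multiplicity, in
decreasing order. For a symmetric matrix these are its eigenvalues. -/
def eigList {n : ℕ} (A : Matrix (Fin n) (Fin n) ℝ) : List ℝ :=
  ((A.map (algebraMap ℝ ℂ)).charpoly.roots.map Complex.re).sort (· ≥ ·)

/-- `lam k A` is the `k`-th largest eigenvalue `λ_k(A)`, where `1 ≤ k ≤ n`. -/
def lam {n : ℕ} (k : ℕ) (A : Matrix (Fin n) (Fin n) ℝ) : ℝ :=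
  (eigList A).getD (k - 1) 0

/-- The smallest eigenvalue. -/
def lamMin {n : ℕ} (A : Matrix (Fin n) (Fin n) ℝ) : ℝ := lam n A

/-- The eigengap `λ_k(A) - λ_{k+1}(A)`. -/
def eigGap {n : ℕ} (k : ℕ) (A : Matrix (Fin n) (Fin n) ℝ) : ℝ := lam k A - lam (k + 1) A

/-- The columns of `U` are an orthonormal basis of a space spanned by (generalized) eigenvectors
of `A` for its `k` largest eigenvalues: that space is invariant under `A`, and the eigenvalues of
the compression `Uᵀ A U` of `A` to it are the `k` largest ones of `A`. If `A` is symmetric, these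
are exactly the `U` with `U Uᵀ` the projection onto the span of `k` top eigenvectors. -/
def IsTopEigenbasis {n k : ℕ} (A : Matrix (Fin n) (Fin n) ℝ) (U : Matrix (Fin n) (Fin k) ℝ) :
    Prop :=
  Uᵀ * U = 1 ∧ A * U = U * (Uᵀ * A * U) ∧ eigList (Uᵀ * A * U) = (eigList A).take k

/-- Entrywise expectation of a random matrix. -/
def matExp {T : Type*} [MeasurableSpace T] {m n : ℕ} (P : Measure T)
    (F : T → Matrix (Fin m) (Fin n) ℝ) : Matrix (Fin m) (Fin n) ℝ :=
  Matrix.of fun i j => ∫ τ, F τ i j ∂P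

/-! ### The model -/

/-- A linear latent contextual bandit: the reward of the context-action pair `z` is
`⟨feature z, Ustar θ⟩ + ε` with `θ` drawn from `latentLaw` and `ε` drawn from `noiseLaw`. -/
structure Bandit (X A : Type*) [MeasurableSpace X] [MeasurableSpace A] (dA dK : ℕ) where
  feature : X × A → EuclideanSpace ℝ (Fin dA)
  measurable_feature : Measurable feature
  Ustar : Matrix (Fin dA) (Fin dK) ℝ
  Ustar_orthonormal : Ustarᵀ * Ustar = 1
  latentLaw : Measure (EuclideanSpace ℝ (Fin dK))
  prob_latentLaw : IsProbabilityMeasure latentLaw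
  noiseLaw : Measure ℝ
  prob_noiseLaw : IsProbabilityMeasure noiseLaw
  noise_centered : ∫ e, e ∂noiseLaw = 0
  noise_subgaussian : ∃ c, HasSubgaussianMGF (fun e : ℝ => e) c noiseLaw

/-- The step `2 j + i` of a trajectory of `2 * L` steps (numbered from `0`), which is the `j`-th
step of the trajectory half `i`. -/
def step {L : ℕ} (i : Fin 2) (j : Fin L) : Fin (2 * L) := ⟨2 * j + i, by omega⟩

/-- How contexts and actions of an offline trajectory of `2 * L` steps are generated: independent
contexts, with the same distribution in both trajectory halves, and a behavior policy that sees
the current context only. -/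
structure Design (X A : Type*) [MeasurableSpace X] [MeasurableSpace A] (L : ℕ) where
  contextLaw : Fin (2 * L) → Measure X
  prob_contextLaw : ∀ h, IsProbabilityMeasure (contextLaw h)
  halves : ∀ j : Fin L, contextLaw (step 0 j) = contextLaw (step 1 j)
  policy : Kernel X A
  markov_policy : IsMarkovKernel policy

attribute [instance] Bandit.prob_latentLaw Bandit.prob_noiseLaw Design.prob_contextLaw
  Design.markov_policy

/-- A trajectory: the latent state, the context-action pairs, and the reward noises. -/
abbrev Traj (X A : Type*) (dK L : ℕ) : Type _ :=
  EuclideanSpace ℝ (Fin dK) × (Fin (2 * L) → X × A) × (Fin (2 * L) → ℝ)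

section Model

variable {X A : Type*} [MeasurableSpace X] [MeasurableSpace A] {dA dK L : ℕ}

/-- The law of one trajectory: latent state, context-action pairs and noises are independent. -/
def trajLaw (𝔅 : Bandit X A dA dK) (𝔇 : Design X A L) : Measure (Traj X A dK L) :=
  𝔅.latentLaw.prod
    ((Measure.pi fun h => 𝔇.contextLaw h ⊗ₘ 𝔇.policy).prod (Measure.pi fun _ => 𝔅.noiseLaw))

/-- The law of a dataset of `N` independent trajectories. -/
def dataLaw (𝔅 : Bandit X A dA dK) (𝔇 : Design X A L) (N : ℕ) :
    Measure (Fin N → Traj X A dK L) :=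
  Measure.pi fun _ => trajLaw 𝔅 𝔇

/-- The reward parameter `β = Ustar θ`. -/
def beta (𝔅 : Bandit X A dA dK) (θ : EuclideanSpace ℝ (Fin dK)) : EuclideanSpace ℝ (Fin dA) :=
  WithLp.toLp 2 (𝔅.Ustar *ᵥ WithLp.ofLp θ)

/-- The reward at step `h`. -/
def reward (𝔅 : Bandit X A dA dK) (τ : Traj X A dK L) (h : Fin (2 * L)) : ℝ :=
  inner ℝ (𝔅.feature (τ.2.1 h)) (beta 𝔅 τ.1) + τ.2.2 h

/-! ### The statistics computed by SOLD, with regularization parameter `μ` -/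

/-- The feature vector at step `h`. -/
def feat (𝔅 : Bandit X A dA dK) (τ : Traj X A dK L) (h : Fin (2 * L)) : Fin dA → ℝ :=
  WithLp.ofLp (𝔅.feature (τ.2.1 h))

/-- The regularized design matrix `V_i` of the trajectory half `i`. -/
def designV (𝔅 : Bandit X A dA dK) (μ : ℝ) (i : Fin 2) (τ : Traj X A dK L) :
    Matrix (Fin dA) (Fin dA) ℝ :=
  μ • 1 + ∑ j : Fin L, Matrix.vecMulVec (feat 𝔅 τ (step i j)) (feat 𝔅 τ (step i j))

/-- The ridge estimate of the reward parameter from the trajectory half `i`. -/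
def betaHat (𝔅 : Bandit X A dA dK) (μ : ℝ) (i : Fin 2) (τ : Traj X A dK L) : Fin dA → ℝ :=
  (designV 𝔅 μ i τ)⁻¹ *ᵥ ∑ j : Fin L, reward 𝔅 τ (step i j) • feat 𝔅 τ (step i j)

/-- The symmetrized outer product `M` of the two ridge estimates. -/
def outerM (𝔅 : Bandit X A dA dK) (μ : ℝ) (τ : Traj X A dK L) : Matrix (Fin dA) (Fin dA) ℝ :=
  (1 / 2 : ℝ) • (Matrix.vecMulVec (betaHat 𝔅 μ 0 τ) (betaHat 𝔅 μ 1 τ)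
    + Matrix.vecMulVec (betaHat 𝔅 μ 1 τ) (betaHat 𝔅 μ 0 τ))

/-- The correction matrix `D_i = I - μ V_i⁻¹`. -/
def corrD (𝔅 : Bandit X A dA dK) (μ : ℝ) (i : Fin 2) (τ : Traj X A dK L) :
    Matrix (Fin dA) (Fin dA) ℝ :=
  1 - μ • (designV 𝔅 μ i τ)⁻¹

/-- The average of a matrix statistic over the dataset. -/
def avg {N : ℕ} (F : Traj X A dK L → Matrix (Fin dA) (Fin dA) ℝ)
    (ω : Fin N → Traj X A dK L) : Matrix (Fin dA) (Fin dA) ℝ :=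
  (1 / (N : ℝ)) • ∑ n, F (ω n)

/-- The averaged outer product matrix. -/
def barM (𝔅 : Bandit X A dA dK) (μ : ℝ) {N : ℕ} (ω : Fin N → Traj X A dK L) :
    Matrix (Fin dA) (Fin dA) ℝ :=
  avg (outerM 𝔅 μ) ω

/-- The averaged correction matrix of the trajectory halves `i`. -/
def barD (𝔅 : Bandit X A dA dK) (μ : ℝ) (i : Fin 2) {N : ℕ} (ω : Fin N → Traj X A dK L) :
    Matrix (Fin dA) (Fin dA) ℝ :=
  avg (corrD 𝔅 μ i) ω

/-- The corrected matrix `D̄₁⁻¹ M̄ D̄₂⁻¹`, whose top eigenvectors SOLD returns. -/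
def corrected (𝔅 : Bandit X A dA dK) (μ : ℝ) {N : ℕ} (ω : Fin N → Traj X A dK L) :
    Matrix (Fin dA) (Fin dA) ℝ :=
  (barD 𝔅 μ 0 ω)⁻¹ * barM 𝔅 μ ω * (barD 𝔅 μ 1 ω)⁻¹

/-- `B_D`, the larger of the norms of the inverses of the two averaged correction matrices. -/
def normB (𝔅 : Bandit X A dA dK) (μ : ℝ) {N : ℕ} (ω : Fin N → Traj X A dK L) : ℝ :=
  max ‖(barD 𝔅 μ 0 ω)⁻¹‖ ‖(barD 𝔅 μ 1 ω)⁻¹‖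

/-! ### Coverage and boundedness -/

/-- The covariance matrix of the latent state. -/
def latentCov (𝔅 : Bandit X A dA dK) : Matrix (Fin dK) (Fin dK) ℝ :=
  Matrix.of fun i j => covariance (fun θ => θ i) (fun θ => θ j) 𝔅.latentLaw

/-- Coverage of the actions. -/
def lamA (𝔅 : Bandit X A dA dK) (𝔇 : Design X A L) (μ : ℝ) : ℝ :=
  min (lamMin (matExp (trajLaw 𝔅 𝔇) (corrD 𝔅 μ 0)))
    (lamMin (matExp (trajLaw 𝔅 𝔇) (corrD 𝔅 μ 1)))

/-- Coverage of the latent states. -/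
def lamTheta (𝔅 : Bandit X A dA dK) (R : ℝ) : ℝ := lamMin (latentCov 𝔅) / R ^ 2

/-- Rewards, features and reward parameters are bounded. -/
structure Bounded (𝔅 : Bandit X A dA dK) (𝔇 : Design X A L) (R : ℝ) : Prop where
  feature_le : ∀ z, ‖𝔅.feature z‖ ≤ 1
  beta_le : ∀ᵐ θ ∂𝔅.latentLaw, ‖beta 𝔅 θ‖ ≤ R
  reward_le : ∀ᵐ τ ∂(trajLaw 𝔅 𝔇), ∀ h, |reward 𝔅 τ h| ≤ R

end Model

/-! ### The error bound -/

/-- The bound `Δ_off`, as a function of the dimension `dK`, the eigengap `g`, the norm `B`, the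
bound `R` on the rewards and the radii `dM`, `dD`. -/
def deltaOff (dK : ℕ) (g B R dM dD : ℝ) : ℝ :=
  2 * √(2 * dK) / g
    * (B ^ 3 * (2 - B * dD) / (1 - B * dD) ^ 2 * (R ^ 2 + dM) * dD
      + (B / (1 - B * dD)) ^ 2 * dM)

/-- `Δ_off` is well defined: the averaged correction matrices are invertible, the eigengap `g` is
positive and `B_D Δ_D < 1`. -/
def OffDefined {X A : Type*} [MeasurableSpace X] [MeasurableSpace A] {dA dK L N : ℕ}
    (𝔅 : Bandit X A dA dK) (μ g dD : ℝ) (ω : Fin N → Traj X A dK L) : Prop :=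
  (∀ i, IsUnit (barD 𝔅 μ i ω)) ∧ 0 < g ∧ normB 𝔅 μ ω * dD < 1

/-- The data-dependent matrix Bernstein radius for the averaged outer products of `N` trajectories
of `2 * L` steps. -/
def radiusM {X A : Type*} [MeasurableSpace X] [MeasurableSpace A] {dA dK L N : ℕ}
    (𝔅 : Bandit X A dA dK) (μ R δ : ℝ) (ω : Fin N → Traj X A dK L) : ℝ :=
  √(2 * ‖avg (fun τ => outerM 𝔅 μ τ ^ 2) ω‖ * (Real.log (4 * dA / δ) / N))
    + 2 * R ^ 2 * (2 + ((2 * L : ℕ) : ℝ) / (2 * μ))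
      * (2 * Real.log (4 * dA / δ) / N) ^ (3 / 4 : ℝ)
    + 4 * R ^ 2 * (2 + ((2 * L : ℕ) : ℝ) / (2 * μ)) * (Real.log (4 * dA / δ) / (3 * N))

/-- The matrix Hoeffding radius for the averaged correction matrices. -/
def radiusD (dA N : ℕ) (δ : ℝ) : ℝ := √(8 * Real.log (4 * dA / δ) / N)

end

end LatentBandit

namespace LatentBandit

/-! ### Schur triangulation -/

/-! Let S be the second moment matrix of β and D the common mean of the correction matrices of the
two halves. Given θ, the halves are independent with the same law, and each ridge estimate is its
correction matrix applied to β plus a centered noise term, so E[M] = D S D. The range of S lies in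
that of `Ustar`. Hence A = D₀⁻¹ M̄ D₁⁻¹, with D₀, D₁ the averaged correction matrices, estimates S,
and telescoping bounds ‖A − S‖ by F = `errorSum`, the bracket of `deltaOff`.

The subspace bound must cope with a non-symmetric A. If A V = V Λ with Λ = VᵀAV invertible, then V =
A V Λ⁻¹. Since I − UUᵀ kills the range of S, (I − UUᵀ)V = (I − UUᵀ)(A − S)VΛ⁻¹ has norm at most F
‖Λ⁻¹‖. Eigenvalues alone do not control Λ⁻¹, but as S is symmetric the skew part of Λ is at most F.
By Schur triangulation (`form_ge_of_roots`) the numerical range of Λ extends to the left of its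
eigenvalues by at most the Frobenius norm of that skew part. This is the source of the dimension
factor √(2 d_K).

What is left is λ_{d_K}(A) ≥ g − F for the eigengap g. If g is the gap of A, a trace argument
suffices (`neg_norm_le_lam_succ`). If g is the gap of M̄, then A is compared with the symmetric
matrix D₀⁻¹ M̄ D₀⁻¹, and its eigenvalues are located by an inertia theorem: if J is symmetric and
x·J(A − c)x > 0 for x ≠ 0, then a subspace on which J is nonnegative forces eigenvalues with real
part at least c (`le_lam_of_form`, `le_lam_of_gap`).

For the rate, Chebyshev's inequality puts the averages within a fixed tolerance of their means once
N is large. Then the gap of A is at least half of R²λ_θ (`half_le_eigGap`, inertia with J = 2UUᵀ −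
I) and ‖Dᵢ⁻¹‖ ≤ 2/λ_A, so the radii alone determine the order in N. The leading term of `radiusM` is
free of H because the noise weights of a ridge estimate in direction x have squared sum at most
|x|²/μ, whatever the number of steps (`norm_matExp_outerM_sq_le`). -/

theorem exists_unit_eigenvector {n : ℕ} (A : Matrix (Fin n) (Fin n) ℂ) {μ : ℂ}
    (h : A.charpoly.IsRoot μ) :
    ∃ v : EuclideanSpace ℂ (Fin n), ‖v‖ = 1 ∧ A *ᵥ WithLp.ofLp v = μ • WithLp.ofLp v := by
  have h1 : (Matrix.scalar (Fin n) μ - A).det = 0 := by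
    rw [← Matrix.eval_charpoly]; exact h
  obtain ⟨w, hw0, hw⟩ := Matrix.exists_mulVec_eq_zero_iff.mpr h1
  have hw' : A *ᵥ w = μ • w := by
    rw [Matrix.sub_mulVec, sub_eq_zero] at hw
    rw [← hw, Matrix.scalar_apply, ← Matrix.smul_one_eq_diagonal, Matrix.smul_mulVec,
      Matrix.one_mulVec]
  have hn : ‖(WithLp.toLp 2 w : EuclideanSpace ℂ (Fin n))‖ ≠ 0 := by
    rw [norm_ne_zero_iff]
    intro h
    exact hw0 (by simpa using congrArg WithLp.ofLp h)
  refine ⟨((‖(WithLp.toLp 2 w : EuclideanSpace ℂ (Fin n))‖⁻¹ : ℝ) : ℂ) • WithLp.toLp 2 w, ?_, ?_⟩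
  · rw [norm_smul, Complex.norm_real, norm_inv, norm_norm, inv_mul_cancel₀ hn]
  · simp only [WithLp.ofLp_smul, Matrix.mulVec_smul, hw']
    rw [smul_comm]

theorem exists_unitary_first_column {n : ℕ} (v : EuclideanSpace ℂ (Fin (n + 1))) (hv : ‖v‖ = 1) :
    ∃ Q : Matrix (Fin (n + 1)) (Fin (n + 1)) ℂ, Qᴴ * Q = 1 ∧ ∀ i, Q i 0 = v i := by
  have ho : Orthonormal ℂ (({0} : Set (Fin (n + 1))).domRestrict fun _ => v) :=
    ⟨fun _ => hv, fun i j hij => absurd (Subsingleton.elim i j) hij⟩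
  obtain ⟨b, hb⟩ := ho.exists_orthonormalBasis_extension_of_card_eq (ι := Fin (n + 1)) (by simp)
  refine ⟨Matrix.of fun i j => b j i, ?_, fun i => by simp [hb 0]⟩
  ext i j
  have := orthonormal_iff_ite.mp b.orthonormal i j
  rw [PiLp.inner_apply] at this
  simp only [Matrix.mul_apply, Matrix.conjTranspose_apply, Matrix.of_apply, Matrix.one_apply]
  rw [← this]
  refine Finset.sum_congr rfl fun x _ => ?_
  simp [mul_comm]

theorem charpoly_of_first_column {n : ℕ} (B : Matrix (Fin (n + 1)) (Fin (n + 1)) ℂ) (μ : ℂ)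
    (h0 : B 0 0 = μ) (h : ∀ i : Fin n, B i.succ 0 = 0) :
    B.charpoly
      = (Polynomial.X - Polynomial.C μ) * (B.submatrix Fin.succ Fin.succ).charpoly := by
  rw [Matrix.charpoly, Matrix.det_succ_column_zero, Fin.sum_univ_succ]
  have h2 : ∀ i : Fin n, B.charmatrix i.succ 0 = 0 := fun i => by
    rw [Matrix.charmatrix_apply_ne _ _ _ (Fin.succ_ne_zero i), h, map_zero, neg_zero]
  simp only [h2, mul_zero, zero_mul, Finset.sum_const_zero, add_zero, Fin.val_zero, pow_zero,
    one_mul, Matrix.charmatrix_apply_eq, h0]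
  congr 1
  rw [Matrix.charpoly]
  congr 1
  ext i j
  simp [Matrix.charmatrix_apply, Matrix.diagonal_apply, Fin.succAbove_zero]

/-- Schur triangulation, with the eigenvalues on the diagonal in any prescribed order. -/
theorem exists_schur : ∀ (n : ℕ) (A : Matrix (Fin n) (Fin n) ℂ) (l : List ℂ),
    (l : Multiset ℂ) = A.charpoly.roots →
    ∃ Q T : Matrix (Fin n) (Fin n) ℂ, Qᴴ * Q = 1 ∧ A * Q = Q * T ∧
      (∀ i j, j < i → T i j = 0) ∧ ∀ i : Fin n, T i i = l.getD i 0 := by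
  intro n
  induction n with
  | zero =>
    intro A l _
    exact ⟨1, A, by ext i; exact i.elim0, by ext i; exact i.elim0, fun i => i.elim0,
      fun i => i.elim0⟩
  | succ n ih =>
    intro A l hl
    have hcard : l.length = n + 1 := by
      have h1 := congrArg Multiset.card hl
      rw [Multiset.coe_card, ← (IsAlgClosed.splits A.charpoly).natDegree_eq_card_roots,
        Matrix.charpoly_natDegree_eq_dim, Fintype.card_fin] at h1
      exact h1
    obtain ⟨μ, l', rfl⟩ := List.exists_cons_of_length_eq_add_one hcard
    have hroot : A.charpoly.IsRoot μ := by
      have : μ ∈ A.charpoly.roots := by rw [← hl]; simp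
      exact Polynomial.isRoot_of_mem_roots this
    obtain ⟨v, hv, hAv⟩ := exists_unit_eigenvector A hroot
    obtain ⟨Q, hQ, hQv⟩ := exists_unitary_first_column v hv
    have hQ' : Q * Qᴴ = 1 := mul_eq_one_comm.mp hQ
    -- Deflation: in an orthonormal basis starting with an eigenvector for the first prescribed
    -- root, A becomes block triangular, and its lower block has the remaining roots.
    set B := Qᴴ * A * Q with hB
    have hAQ : A * Q = Q * B := by
      rw [hB, ← Matrix.mul_assoc, ← Matrix.mul_assoc, hQ', Matrix.one_mul]
    have hcol : ∀ i, B i 0 = if i = 0 then μ else 0 := by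
      intro i
      have h1 : B i 0 = (Qᴴ *ᵥ (A *ᵥ fun k => Q k 0)) i := by
        rw [hB, Matrix.mul_assoc, Matrix.mul_apply_eq_vecMul]
        rfl
      have h2 : (fun k => Q k 0) = WithLp.ofLp v := funext hQv
      have h3 : (Qᴴ *ᵥ WithLp.ofLp v) i = (Qᴴ * Q) i 0 := by
        rw [← h2]; rfl
      rw [h1, h2, hAv, Matrix.mulVec_smul, Pi.smul_apply, h3, hQ, Matrix.one_apply, smul_eq_mul,
        mul_ite, mul_one, mul_zero]
    have hchar : B.charpoly = A.charpoly := by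
      rw [hB, Matrix.mul_assoc, Matrix.charpoly_mul_comm, Matrix.mul_assoc, hQ', Matrix.mul_one]
    have hfac := charpoly_of_first_column B μ (by simp [hcol]) (fun i => by simp [hcol])
    have hl' : (l' : Multiset ℂ) = (B.submatrix Fin.succ Fin.succ).charpoly.roots := by
      rw [← hchar, hfac, Polynomial.roots_mul, Polynomial.roots_X_sub_C, ← Multiset.cons_coe,
        Multiset.singleton_add] at hl
      · exact (Multiset.cons_inj_right μ).mp hl
      · exact mul_ne_zero (Polynomial.X_sub_C_ne_zero μ) (Matrix.charpoly_monic _).ne_zero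
    obtain ⟨P, T, hP, hBP, hT, hTd⟩ := ih _ l' hl'
    -- P₂ is the block matrix diag(1, P). The first row of T₂ is μ followed by the tail of the first
    -- row of B times P.
    let P₂ : Matrix (Fin (n + 1)) (Fin (n + 1)) ℂ := Matrix.of fun i j =>
      Fin.cases (Fin.cases (1 : ℂ) (fun _ => 0) j) (fun i' => Fin.cases 0 (fun j' => P i' j') j) i
    let T₂ : Matrix (Fin (n + 1)) (Fin (n + 1)) ℂ := Matrix.of fun i j =>
      Fin.cases (Fin.cases μ (fun j' => ∑ k : Fin n, B 0 k.succ * P k j') j)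
        (fun i' => Fin.cases 0 (fun j' => T i' j') j) i
    have hP₂ : P₂ᴴ * P₂ = 1 := by
      ext i j
      have h1 := fun i j => congrFun (congrFun hP i) j
      simp only [Matrix.mul_apply, Matrix.conjTranspose_apply, Matrix.one_apply] at h1 ⊢
      rw [Fin.sum_univ_succ]
      refine Fin.cases (Fin.cases ?_ (fun j => ?_) j) (fun i => Fin.cases ?_ (fun j => ?_) j) i
      · simp [P₂]
      · simp [P₂, (Fin.succ_ne_zero _).symm]
      · simp [P₂, Fin.succ_ne_zero]
      · simpa [P₂] using h1 i j
    have hBP₂ : B * P₂ = P₂ * T₂ := by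
      ext i j
      have h1 := fun i j => congrFun (congrFun hBP i) j
      simp only [Matrix.mul_apply, Matrix.submatrix_apply] at h1 ⊢
      rw [Fin.sum_univ_succ, Fin.sum_univ_succ]
      refine Fin.cases (Fin.cases ?_ (fun j => ?_) j) (fun i => Fin.cases ?_ (fun j => ?_) j) i
      · simp [P₂, T₂, hcol]
      · simp [P₂, T₂]
      · simp [P₂, T₂, hcol]
      · simpa [P₂, T₂] using h1 i j
    refine ⟨Q * P₂, T₂, ?_, ?_, ?_, ?_⟩
    · rw [Matrix.conjTranspose_mul, Matrix.mul_assoc, ← Matrix.mul_assoc Qᴴ, hQ, Matrix.one_mul,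
        hP₂]
    · rw [← Matrix.mul_assoc, hAQ, Matrix.mul_assoc, hBP₂, Matrix.mul_assoc]
    · intro i j
      refine Fin.cases (fun h => absurd h (by simp)) (fun i => ?_) i
      refine Fin.cases (fun _ => by simp [T₂]) (fun j h => ?_) j
      simpa [T₂] using hT i j (by simpa using h)
    · intro i
      refine Fin.cases (by simp [T₂]) (fun i => ?_) i
      simpa [T₂] using hTd i

/-! ### An inertia theorem -/

theorem star_dotProduct_mulVec_comm {n : ℕ} {H : Matrix (Fin n) (Fin n) ℂ} (hH : Hᴴ = H)
    (y z : Fin n → ℂ) : star y ⬝ᵥ H *ᵥ z = star (H *ᵥ y) ⬝ᵥ z := by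
  rw [Matrix.star_mulVec, hH, Matrix.dotProduct_mulVec]

/-- Lyapunov's theorem for a triangular matrix. -/
theorem re_form_neg_of_lyapunov : ∀ (m : ℕ) (T H : Matrix (Fin m) (Fin m) ℂ),
    (∀ i j, j < i → T i j = 0) → (∀ i, (T i i).re < 0) → Hᴴ = H →
    (∀ x, x ≠ 0 → 0 < (star x ⬝ᵥ H *ᵥ (T *ᵥ x)).re) →
    ∀ x, x ≠ 0 → (star x ⬝ᵥ H *ᵥ x).re < 0 := by
  intro m
  induction m with
  | zero => exact fun _ _ _ _ _ _ x hx => absurd (Subsingleton.elim x 0) hx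
  | succ m ih =>
    intro T H hT hd hH hpos
    have hHij : ∀ i j, star (H i j) = H j i := fun i j => by
      rw [← Matrix.conjTranspose_apply, hH]
    have him : (H 0 0).im = 0 := by
      have := congrArg Complex.im (hHij 0 0)
      simp only [Complex.star_def, Complex.conj_im] at this
      linarith
    have h00 : (H 0 0).re < 0 := by
      -- The first basis vector is an eigenvector of the triangular T, so positivity there reads H₀₀
      -- · Re T₀₀ > 0.
      have h1 := hpos (Pi.single 0 1) (by simp)
      have h2 : T *ᵥ Pi.single 0 1 = T 0 0 • Pi.single 0 1 := by
        ext i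
        refine Fin.cases (by simp) (fun i => ?_) i
        simp [hT i.succ 0 (Fin.succ_pos i), Fin.succ_ne_zero]
      rw [h2, Matrix.mulVec_smul, ← Pi.single_star, star_one, single_one_dotProduct,
        Pi.smul_apply, Matrix.mulVec_single_one, Matrix.col_apply, smul_eq_mul, Complex.mul_re,
        him, mul_zero, sub_zero] at h1
      nlinarith [hd 0]
    have hH0 : H 0 0 ≠ 0 := fun h => by rw [h] at h00; simp at h00
    -- Completing the square: H' is the Schur complement of H₀₀, and α x is the first coordinate for
    -- which y = (α x, x) satisfies (H y)₀ = 0.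
    let H' : Matrix (Fin m) (Fin m) ℂ := Matrix.of fun i j =>
      H i.succ j.succ - H i.succ 0 * H 0 j.succ / H 0 0
    let α : (Fin m → ℂ) → ℂ := fun x => -(∑ j : Fin m, H 0 j.succ * x j) / H 0 0
    have hα : ∀ x, ∑ j : Fin m, H 0 j.succ * x j = -(H 0 0 * α x) := fun x => by
      simp only [α]; field_simp
    have hH0y : ∀ y : Fin (m + 1) → ℂ, (H *ᵥ y) 0 = H 0 0 * (y 0 - α (fun i => y i.succ)) := by
      intro y
      have := hα (fun i => y i.succ)
      rw [Matrix.mulVec, dotProduct, Fin.sum_univ_succ, this]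
      ring
    have hHy : ∀ (y : Fin (m + 1) → ℂ) (i : Fin m), (H *ᵥ y) i.succ
        = (H' *ᵥ fun i => y i.succ) i + H i.succ 0 * (y 0 - α (fun i => y i.succ)) := by
      intro y i
      simp only [Matrix.mulVec, dotProduct, Fin.sum_univ_succ, H', Matrix.of_apply, α, sub_mul,
        Finset.sum_sub_distrib]
      have : ∑ x : Fin m, H i.succ 0 * H 0 x.succ / H 0 0 * y x.succ
          = H i.succ 0 * (∑ j : Fin m, H 0 j.succ * y j.succ) / H 0 0 := by
        rw [Finset.mul_sum, Finset.sum_div]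
        exact Finset.sum_congr rfl fun _ _ => by ring
      rw [this]
      ring
    have hTy : ∀ (y : Fin (m + 1) → ℂ) (i : Fin m), (T *ᵥ y) i.succ
        = (T.submatrix Fin.succ Fin.succ *ᵥ fun i => y i.succ) i := by
      intro y i
      simp [Matrix.mulVec, dotProduct, Fin.sum_univ_succ, hT i.succ 0 (Fin.succ_pos i)]
    have hH' : H'ᴴ = H' := by
      ext i j
      have e1 := hHij j.succ i.succ
      have e2 := hHij j.succ 0
      have e3 := hHij 0 i.succ
      have e4 := hHij 0 0
      simp only [H', Matrix.conjTranspose_apply, Matrix.of_apply, star_sub, star_div₀, star_mul',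
        e1, e2, e3, e4]
      ring
    have hneg := ih (T.submatrix Fin.succ Fin.succ) H'
      (fun i j hij => hT _ _ (by simpa using hij)) (fun i => hd _) hH' (by
        intro x hx
        -- On vectors (α x, x) the 0-th coordinate of H y vanishes, so the first row of T drops out
        -- and the hypothesis passes to H' and the trailing block of T.
        have h1 := hpos (Fin.cons (α x) x) (fun h => hx (by
          ext i
          simpa using congrFun h i.succ))
        rw [star_dotProduct_mulVec_comm hH, dotProduct, Fin.sum_univ_succ] at h1
        simp only [Pi.star_apply, hH0y, hHy, hTy, Fin.cons_zero, Fin.cons_succ, sub_self, mul_zero,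
          star_zero, zero_mul, zero_add, add_zero] at h1
        rw [star_dotProduct_mulVec_comm hH']
        exact h1)
    intro y hy
    set x : Fin m → ℂ := fun i => y i.succ with hx
    have hform : star y ⬝ᵥ H *ᵥ y = H 0 0 * ((star (y 0 - α x)) * (y 0 - α x))
        + star x ⬝ᵥ H' *ᵥ x := by
      have h1 : ∑ i : Fin m, star (x i) * H i.succ 0 = -(H 0 0 * star (α x)) := by
        have := congrArg star (hα x)
        rw [star_sum, star_neg, star_mul', hHij 0 0] at this
        rw [← this]
        refine Finset.sum_congr rfl fun i _ => ?_
        rw [star_mul', hHij 0 i.succ, mul_comm]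
      rw [dotProduct, Fin.sum_univ_succ]
      simp only [Pi.star_apply, hH0y, hHy, mul_add, Finset.sum_add_distrib]
      have h2 : ∑ i : Fin m, star (y i.succ) * (H i.succ 0 * (y 0 - α x))
          = (∑ i : Fin m, star (x i) * H i.succ 0) * (y 0 - α x) := by
        rw [Finset.sum_mul]
        exact Finset.sum_congr rfl fun _ _ => by rw [hx]; ring
      rw [h2, h1, star_sub, dotProduct]
      simp only [Pi.star_apply, hx]
      ring
    have h1 : (H 0 0 * ((star (y 0 - α x)) * (y 0 - α x))).re
        = (H 0 0).re * Complex.normSq (y 0 - α x) := by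
      rw [Complex.star_def, mul_comm (starRingEnd ℂ _), Complex.mul_conj, Complex.re_mul_ofReal]
    rw [hform, Complex.add_re, h1]
    by_cases hx0 : x = 0
    · have hy0 : y 0 ≠ 0 := fun h => hy (by
        ext i
        exact Fin.cases h (fun i => congrFun hx0 i) i)
      have : 0 < Complex.normSq (y 0 - α x) := by
        rw [Complex.normSq_pos, hx0]
        simpa [α] using hy0
      rw [hx0]
      simp only [star_zero, zero_dotProduct, Complex.zero_re, add_zero]
      rw [← hx0]
      exact mul_neg_of_neg_of_pos h00 this
    · have := hneg x hx0
      have h3 := Complex.normSq_nonneg (y 0 - α x)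
      nlinarith

theorem card_roots_charpoly {n : ℕ} (A : Matrix (Fin n) (Fin n) ℂ) :
    A.charpoly.roots.card = n := by
  rw [← (IsAlgClosed.splits A.charpoly).natDegree_eq_card_roots,
    Matrix.charpoly_natDegree_eq_dim, Fintype.card_fin]

/-- A subspace on which a Hermitian form is nonnegative has dimension at most the number of
eigenvalues to the right of `c` (`s = 1`) or to the left of `c` (`s = -1`), if the form increases
along the flow of `s (A - c)`. -/
theorem countP_add_le_of_form {n p : ℕ} (A J : Matrix (Fin n) (Fin n) ℂ) (c s : ℝ)
    (hJ : Jᴴ = J)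
    (hpos : ∀ x, x ≠ 0 → 0 < (star x ⬝ᵥ J *ᵥ ((s : ℂ) • (A *ᵥ x - (c : ℂ) • x))).re)
    (W : Matrix (Fin n) (Fin p) ℂ) (hW : ∀ y, W *ᵥ y = 0 → y = 0)
    (hWJ : ∀ y, 0 ≤ (star (W *ᵥ y) ⬝ᵥ J *ᵥ (W *ᵥ y)).re) :
    A.charpoly.roots.countP (fun z => s * (z.re - c) < 0) + p ≤ n := by
  classical
  set q : ℂ → Prop := fun z => s * (z.re - c) < 0
  -- With the roots satisfying q listed first, the first m Schur vectors span an A-invariant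
  -- subspace that carries exactly these roots.
  set l₁ := (A.charpoly.roots.filter q).toList with hl₁
  set l₂ := (A.charpoly.roots.filter fun z => ¬ q z).toList with hl₂
  have hl : ((l₁ ++ l₂ : List ℂ) : Multiset ℂ) = A.charpoly.roots := by
    rw [← Multiset.coe_add, hl₁, hl₂, Multiset.coe_toList, Multiset.coe_toList,
      Multiset.filter_add_not]
  set m := l₁.length with hm
  have hcount : A.charpoly.roots.countP q = m := by
    rw [Multiset.countP_eq_card_filter, hm, hl₁, Multiset.length_toList]
  have hmn : m ≤ n := by
    rw [← hcount]
    exact (Multiset.countP_le_card _ _).trans (card_roots_charpoly A).le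
  rw [hcount]
  obtain ⟨Q, T, hQ, hAQ, hT, hd⟩ := exists_schur n A _ hl
  let ι : Fin m → Fin n := Fin.castLE hmn
  set Qm := Q.submatrix id ι
  set Tm : Matrix (Fin m) (Fin m) ℂ := (s : ℂ) • (T.submatrix ι ι - (c : ℂ) • 1)
  have hAQm : ∀ y, A *ᵥ (Qm *ᵥ y) = Qm *ᵥ (T.submatrix ι ι *ᵥ y) := by
    intro y
    rw [Matrix.mulVec_mulVec, Matrix.mulVec_mulVec]
    congr 1
    ext i j
    have h1 := congrFun (congrFun hAQ i) (ι j)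
    have h2 : (A * Qm) i j = (A * Q) i (ι j) := rfl
    rw [h2, h1, Matrix.mul_apply, Matrix.mul_apply]
    refine (Finset.sum_of_injOn ι ((Fin.castLE_injective hmn).injOn) (by simp) ?_ ?_).symm
    · intro k _ hk
      have : ι j < k := by
        by_contra h
        refine hk ⟨⟨k, ?_⟩, by simp, ?_⟩
        · have : (k : ℕ) ≤ j := by simpa [ι, Fin.le_def] using h
          omega
        · ext; simp [ι]
      rw [hT _ _ this, mul_zero]
    · intro k _
      rfl
  have hQm : ∀ y, Qm *ᵥ y = 0 → y = 0 := by
    intro y hy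
    have h1 : Qmᴴ * Qm = 1 := by
      ext i j
      have h1 := congrFun (congrFun hQ (ι i)) (ι j)
      have h2 : (Qmᴴ * Qm) i j = (Qᴴ * Q) (ι i) (ι j) := rfl
      rw [h2, h1, Matrix.one_apply, Matrix.one_apply]
      simp [(Fin.castLE_injective hmn).eq_iff, ι]
    rw [← Matrix.one_mulVec y, ← h1, ← Matrix.mulVec_mulVec, hy, Matrix.mulVec_zero]
  have hHform : ∀ y z, star y ⬝ᵥ (Qmᴴ * J * Qm) *ᵥ z = star (Qm *ᵥ y) ⬝ᵥ J *ᵥ (Qm *ᵥ z) := by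
    intro y z
    rw [Matrix.star_mulVec, ← Matrix.dotProduct_mulVec, Matrix.mulVec_mulVec, Matrix.mulVec_mulVec,
      Matrix.mul_assoc]
  have hTm : ∀ y, Qm *ᵥ (Tm *ᵥ y) = (s : ℂ) • (A *ᵥ (Qm *ᵥ y) - (c : ℂ) • (Qm *ᵥ y)) := by
    intro y
    rw [hAQm, Matrix.smul_mulVec, Matrix.sub_mulVec, Matrix.smul_mulVec, Matrix.one_mulVec,
      Matrix.mulVec_smul, Matrix.mulVec_sub, Matrix.mulVec_smul]
  have hneg := re_form_neg_of_lyapunov m Tm (Qmᴴ * J * Qm)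
    (by
      intro i j hij
      have h1 : T (ι i) (ι j) = 0 := hT _ _ (by simpa [ι] using hij)
      simp [Tm, h1, Matrix.one_apply_ne hij.ne'])
    (by
      intro i
      have h1 : T (ι i) (ι i) = l₁[i] := by
        rw [hd, List.getD_append _ _ _ _ (by simp [ι, ← hm]),
          List.getD_eq_getElem _ _ (by simp [ι, ← hm])]
        simp [ι]
      have h2 : q l₁[i] := by
        have : l₁[i] ∈ A.charpoly.roots.filter q := by
          rw [← Multiset.mem_toList]
          exact List.getElem_mem _
        exact (Multiset.mem_filter.mp this).2
      simp only [Tm, Matrix.smul_apply, Matrix.sub_apply, Matrix.submatrix_apply, h1,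
        Matrix.one_apply_eq, smul_eq_mul, mul_one, Complex.re_ofReal_mul, Complex.sub_re,
        Complex.ofReal_re]
      exact h2)
    (by
      rw [Matrix.conjTranspose_mul, Matrix.conjTranspose_mul, hJ, Matrix.conjTranspose_conjTranspose,
        Matrix.mul_assoc])
    (by
      intro y hy
      rw [hHform, hTm]
      exact hpos _ fun h => hy (hQm y h))
  -- J is negative definite on the invariant subspace by Lyapunov's theorem and nonnegative on the
  -- range of W, so the two meet only in 0.
  have hdisj : Disjoint (LinearMap.range Qm.mulVecLin) (LinearMap.range W.mulVecLin) := by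
    rw [Submodule.disjoint_def]
    rintro _ ⟨y, rfl⟩ ⟨z, hz⟩
    rw [Matrix.mulVecLin_apply, Matrix.mulVecLin_apply] at hz
    rw [Matrix.mulVecLin_apply]
    by_contra hne
    have h1 := hneg y (fun h => hne (by rw [h, Matrix.mulVec_zero]))
    have h2 := hWJ z
    rw [hHform, ← hz] at h1
    exact absurd h2 (not_le.mpr h1)
  have h3 := Submodule.finrank_add_finrank_le_of_disjoint hdisj
  rw [LinearMap.finrank_range_of_inj, LinearMap.finrank_range_of_inj] at h3
  · simpa using h3
  · exact (injective_iff_map_eq_zero _).mpr hW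
  · exact (injective_iff_map_eq_zero _).mpr hQm

/-! ### Real parts of eigenvalues -/

theorem length_eigList {n : ℕ} (A : Matrix (Fin n) (Fin n) ℝ) : (eigList A).length = n := by
  rw [eigList, Multiset.length_sort, Multiset.card_map, card_roots_charpoly]

theorem coe_eigList {n : ℕ} (A : Matrix (Fin n) (Fin n) ℝ) :
    (eigList A : Multiset ℝ) = (A.map (algebraMap ℝ ℂ)).charpoly.roots.map Complex.re :=
  Multiset.sort_eq _ _

theorem pairwise_eigList {n : ℕ} (A : Matrix (Fin n) (Fin n) ℝ) : (eigList A).Pairwise (· ≥ ·) :=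
  Multiset.pairwise_sort _ _

/-- Translates ordered eigenvalues into counts, the form in which inertia arguments deliver them.
Positions start at 0, hence k + 1. -/
theorem le_getD_iff_of_pairwise {l : List ℝ} (hl : l.Pairwise (· ≥ ·)) {k : ℕ} (hk : k < l.length)
    (c : ℝ) : c ≤ l.getD k 0 ↔ k + 1 ≤ l.countP (fun x => c ≤ x) := by
  have hmono : ∀ i j (hi : i < l.length) (hj : j < l.length), i ≤ j → l[j] ≤ l[i] := by
    intro i j hi hj hij
    rcases hij.eq_or_lt with rfl | h
    · exact le_rfl
    · exact List.pairwise_iff_getElem.mp hl i j hi hj h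
  rw [List.getD_eq_getElem _ _ hk]
  constructor
  · intro h
    have h1 : (l.take (k + 1)).countP (fun x => c ≤ x) = (l.take (k + 1)).length := by
      rw [List.countP_eq_length]
      intro a ha
      obtain ⟨i, hi, rfl⟩ := List.mem_iff_getElem.mp ha
      rw [List.length_take] at hi
      simp only [List.getElem_take, decide_eq_true_eq]
      exact h.trans (hmono i k (by omega) hk (by omega))
    have h2 := (List.take_sublist (k + 1) l).countP_le (p := fun x => decide (c ≤ x))
    rw [h1, List.length_take] at h2
    omega
  · intro h
    by_contra hc
    have h1 : (l.drop k).countP (fun x => c ≤ x) = 0 := by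
      rw [List.countP_eq_zero]
      intro a ha
      obtain ⟨i, hi, rfl⟩ := List.mem_iff_getElem.mp ha
      rw [List.length_drop] at hi
      simp only [List.getElem_drop, decide_eq_true_eq, not_le]
      exact lt_of_le_of_lt (hmono k (k + i) hk (by omega) (by omega)) (not_le.mp hc)
    have h2 : l.countP (fun x => c ≤ x) ≤ k := by
      rw [← List.take_append_drop k l, List.countP_append, h1, add_zero]
      exact List.countP_le_length.trans (by simp)
    omega

theorem le_lam_iff {n : ℕ} (A : Matrix (Fin n) (Fin n) ℝ) {k : ℕ} (h1 : 1 ≤ k) (hk : k ≤ n)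
    (c : ℝ) :
    c ≤ lam k A ↔ k ≤ (A.map (algebraMap ℝ ℂ)).charpoly.roots.countP (fun z => c ≤ z.re) := by
  rw [lam, le_getD_iff_of_pairwise (pairwise_eigList A) (by rw [length_eigList]; omega),
    Nat.sub_add_cancel h1, ← Multiset.coe_countP (p := fun x : ℝ => c ≤ x), coe_eigList,
    Multiset.countP_map, ← Multiset.countP_eq_card_filter]

theorem trace_eq_sum_eigList {n : ℕ} (A : Matrix (Fin n) (Fin n) ℝ) :
    A.trace = (eigList A).sum := by
  rw [← Multiset.sum_coe, coe_eigList]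
  have h1 := Matrix.trace_eq_sum_roots_charpoly (A.map (algebraMap ℝ ℂ))
  have h2 : (A.map (algebraMap ℝ ℂ)).trace = ((A.trace : ℝ) : ℂ) := by
    simp [Matrix.trace]
  rw [h2] at h1
  have h3 := congrArg Complex.reAddGroupHom h1
  rw [map_multiset_sum] at h3
  exact h3

theorem le_re_of_mem_roots {n : ℕ} {A : Matrix (Fin n) (Fin n) ℝ} {m : ℝ}
    (h : ∀ x ∈ eigList A, m ≤ x) :
    ∀ z ∈ (A.map (algebraMap ℝ ℂ)).charpoly.roots, m ≤ z.re := by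
  intro z hz
  apply h
  rw [← Multiset.mem_coe, coe_eigList]
  exact Multiset.mem_map_of_mem _ hz

theorem lam_le_of_mem_take {n : ℕ} {A : Matrix (Fin n) (Fin n) ℝ} {k : ℕ} (hk : k ≤ n) :
    ∀ x ∈ (eigList A).take k, lam k A ≤ x := by
  intro x hx
  obtain ⟨i, hi, rfl⟩ := List.mem_iff_getElem.mp hx
  rw [List.length_take, length_eigList] at hi
  have hk' : k - 1 < (eigList A).length := by rw [length_eigList]; omega
  rw [lam, List.getD_eq_getElem _ _ hk', List.getElem_take]
  rcases (show i ≤ k - 1 by omega).eq_or_lt with h | h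
  · simp [h]
  · exact List.pairwise_iff_getElem.mp (pairwise_eigList A) i (k - 1) _ hk' h

theorem le_lam_of_mem_drop {n : ℕ} {A : Matrix (Fin n) (Fin n) ℝ} {k : ℕ} (hk : k < n) :
    ∀ x ∈ (eigList A).drop k, x ≤ lam (k + 1) A := by
  intro x hx
  obtain ⟨i, hi, rfl⟩ := List.mem_iff_getElem.mp hx
  rw [List.length_drop, length_eigList] at hi
  have hk' : k < (eigList A).length := by rw [length_eigList]; omega
  rw [lam, Nat.add_sub_cancel, List.getD_eq_getElem _ _ hk', List.getElem_drop]
  rcases Nat.eq_zero_or_pos i with h | h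
  · simp [h]
  · exact List.pairwise_iff_getElem.mp (pairwise_eigList A) k (k + i) hk' _ (by omega)

/-! ### Quadratic forms -/

theorem map_mulVec_ofReal {m n : ℕ} (B : Matrix (Fin m) (Fin n) ℝ) (x : Fin n → ℂ) :
    B.map (algebraMap ℝ ℂ) *ᵥ x = fun i =>
      (((B *ᵥ fun j => (x j).re) i : ℝ) : ℂ) + ((B *ᵥ fun j => (x j).im) i : ℝ) * Complex.I := by
  ext i
  simp only [Matrix.mulVec, dotProduct, Matrix.map_apply, Complex.ofReal_sum, Finset.sum_mul,
    ← Finset.sum_add_distrib]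
  refine Finset.sum_congr rfl fun j _ => ?_
  conv_lhs => rw [← Complex.re_add_im (x j)]
  simp only [Complex.coe_algebraMap, Complex.ofReal_mul]
  ring

theorem re_star_dotProduct_map_mulVec {n : ℕ} (B : Matrix (Fin n) (Fin n) ℝ) (x : Fin n → ℂ) :
    (star x ⬝ᵥ B.map (algebraMap ℝ ℂ) *ᵥ x).re
      = (fun j => (x j).re) ⬝ᵥ B *ᵥ (fun j => (x j).re)
        + (fun j => (x j).im) ⬝ᵥ B *ᵥ (fun j => (x j).im) := by
  rw [map_mulVec_ofReal]
  simp only [dotProduct, Complex.re_sum, ← Finset.sum_add_distrib]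
  refine Finset.sum_congr rfl fun j _ => ?_
  simp [Complex.mul_re]

/-- Complexification: the real part of a real form at u + iv is the sum of its values at u and v, so
positivity passes to complex vectors. -/
theorem countP_add_le_of_real_form {n p : ℕ} (A J : Matrix (Fin n) (Fin n) ℝ) (c s : ℝ)
    (hJ : Jᵀ = J) (hpos : ∀ x, x ≠ 0 → 0 < x ⬝ᵥ J *ᵥ (s • (A *ᵥ x - c • x)))
    (W : Matrix (Fin n) (Fin p) ℝ) (hW : ∀ y, W *ᵥ y = 0 → y = 0)
    (hWJ : ∀ y, 0 ≤ W *ᵥ y ⬝ᵥ J *ᵥ (W *ᵥ y)) :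
    (A.map (algebraMap ℝ ℂ)).charpoly.roots.countP (fun z => s * (z.re - c) < 0) + p ≤ n := by
  have hsplit : ∀ {k : ℕ} (x : Fin k → ℂ), (fun j => (x j).re) = 0 → (fun j => (x j).im) = 0 →
      x = 0 := by
    intro k x h1 h2
    ext j
    exact Complex.ext (congrFun h1 j) (congrFun h2 j)
  refine countP_add_le_of_form (A.map (algebraMap ℝ ℂ)) (J.map (algebraMap ℝ ℂ)) c s ?_ ?_
    (W.map (algebraMap ℝ ℂ)) ?_ ?_
  · ext i j
    simp [← congrFun (congrFun hJ j) i]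
  · intro x hx
    have h0 : ∀ y, y ⬝ᵥ J *ᵥ (s • (A *ᵥ y - c • y)) = y ⬝ᵥ (J * (s • (A - c • 1))) *ᵥ y := by
      intro y
      rw [← Matrix.mulVec_mulVec, Matrix.smul_mulVec, Matrix.sub_mulVec, Matrix.smul_mulVec,
        Matrix.one_mulVec]
    have h1 : J.map (algebraMap ℝ ℂ) *ᵥ ((s : ℂ) • (A.map (algebraMap ℝ ℂ) *ᵥ x - (c : ℂ) • x))
        = (J * (s • (A - c • 1))).map (algebraMap ℝ ℂ) *ᵥ x := by
      have h2 : (s • (A - c • 1)).map (algebraMap ℝ ℂ)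
          = (s : ℂ) • (A.map (algebraMap ℝ ℂ) - (c : ℂ) • 1) := by
        ext i j
        simp only [Matrix.map_apply, Matrix.smul_apply, Matrix.sub_apply, Matrix.one_apply,
          smul_eq_mul, Complex.coe_algebraMap]
        split_ifs <;> simp
      rw [Matrix.map_mul, h2, ← Matrix.mulVec_mulVec, Matrix.smul_mulVec, Matrix.sub_mulVec,
        Matrix.smul_mulVec, Matrix.one_mulVec]
    rw [h1, re_star_dotProduct_map_mulVec]
    have hnn : ∀ y, 0 ≤ y ⬝ᵥ (J * (s • (A - c • 1))) *ᵥ y := by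
      intro y
      by_cases hy : y = 0
      · simp [hy]
      · rw [← h0]; exact (hpos y hy).le
    by_cases hre : (fun j => (x j).re) = 0
    · have him : (fun j => (x j).im) ≠ 0 := fun h => hx (hsplit x hre h)
      have := hpos _ him
      rw [h0] at this
      linarith [hnn fun j => (x j).re]
    · have := hpos _ hre
      rw [h0] at this
      linarith [hnn fun j => (x j).im]
  · intro y hy
    rw [map_mulVec_ofReal] at hy
    apply hsplit y
    · apply hW
      ext i
      simpa using congrArg Complex.re (congrFun hy i)
    · apply hW
      ext i
      simpa using congrArg Complex.im (congrFun hy i)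
  · intro y
    rw [re_star_dotProduct_map_mulVec, map_mulVec_ofReal]
    simpa using add_nonneg (hWJ fun j => (y j).re) (hWJ fun j => (y j).im)

/-- At most n − p eigenvalues lie strictly left of c, so at least p do not. -/
theorem le_lam_of_form {n p : ℕ} (A J : Matrix (Fin n) (Fin n) ℝ) (c : ℝ) (hp : 1 ≤ p)
    (hJ : Jᵀ = J) (hpos : ∀ x, x ≠ 0 → 0 < x ⬝ᵥ J *ᵥ (A *ᵥ x - c • x))
    (W : Matrix (Fin n) (Fin p) ℝ) (hW : ∀ y, W *ᵥ y = 0 → y = 0)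
    (hWJ : ∀ y, 0 ≤ W *ᵥ y ⬝ᵥ J *ᵥ (W *ᵥ y)) : c ≤ lam p A := by
  have h := countP_add_le_of_real_form A J c 1 hJ (by simpa using hpos) W hW hWJ
  rw [le_lam_iff A hp (by omega)]
  have h1 := Multiset.card_eq_countP_add_countP (fun z : ℂ => c ≤ z.re)
    (A.map (algebraMap ℝ ℂ)).charpoly.roots
  rw [card_roots_charpoly] at h1
  have h2 : (A.map (algebraMap ℝ ℂ)).charpoly.roots.countP (fun z => ¬ c ≤ z.re)
      = (A.map (algebraMap ℝ ℂ)).charpoly.roots.countP (fun z => 1 * (z.re - c) < 0) :=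
    Multiset.countP_congr rfl fun z _ => by rw [one_mul, sub_neg, not_le]
  omega

/-- The same count for −J and the reversed flow: at most n − p = k eigenvalues lie strictly right of
c. -/
theorem lam_le_of_form {n p k : ℕ} (A J : Matrix (Fin n) (Fin n) ℝ) (c : ℝ) (hp : 1 ≤ p)
    (hk : k + p = n) (hJ : Jᵀ = J) (hpos : ∀ x, x ≠ 0 → 0 < x ⬝ᵥ J *ᵥ (A *ᵥ x - c • x))
    (W : Matrix (Fin n) (Fin p) ℝ) (hW : ∀ y, W *ᵥ y = 0 → y = 0)
    (hWJ : ∀ y, W *ᵥ y ⬝ᵥ J *ᵥ (W *ᵥ y) ≤ 0) : lam (k + 1) A ≤ c := by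
  have h := countP_add_le_of_real_form A (-J) c (-1) (by rw [Matrix.transpose_neg, hJ])
    (by
      intro x hx
      have := hpos x hx
      rwa [neg_smul, one_smul, Matrix.neg_mulVec, Matrix.mulVec_neg, neg_neg])
    W hW (by
      intro y
      rw [Matrix.neg_mulVec, dotProduct_neg]
      linarith [hWJ y])
  by_contra hc
  push Not at hc
  have h1 := (le_lam_iff A (by omega : 1 ≤ k + 1) (by omega) _).mp le_rfl
  have h2 : (A.map (algebraMap ℝ ℂ)).charpoly.roots.countP (fun z => lam (k + 1) A ≤ z.re)
      ≤ (A.map (algebraMap ℝ ℂ)).charpoly.roots.countP (fun z => -1 * (z.re - c) < 0) := by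
    rw [Multiset.countP_eq_card_filter, Multiset.countP_eq_card_filter]
    refine Multiset.card_le_card (Multiset.monotone_filter_right _ fun z hz => ?_)
    linarith
  omega

/-- If the eigenvalues of `A` have real parts at least `m`, and the skew part of `A` has Frobenius
norm at most `κ`, then the numerical range of `A` lies to the right of `m - κ`. -/
theorem form_ge_of_roots {n : ℕ} (A : Matrix (Fin n) (Fin n) ℝ) (m κ : ℝ)
    (hm : ∀ z ∈ (A.map (algebraMap ℝ ℂ)).charpoly.roots, m ≤ z.re) (hκ : 0 ≤ κ)
    (hK : ∑ i, ∑ j, ((A i j - A j i) / 2) ^ 2 ≤ κ ^ 2) (x : Fin n → ℝ) :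
    (m - κ) * (x ⬝ᵥ x) ≤ x ⬝ᵥ A *ᵥ x := by
  set B := A.map (algebraMap ℝ ℂ) with hB
  obtain ⟨Q, T, hQ, hBQ, hT, hd⟩ := exists_schur n B B.charpoly.roots.toList (by simp)
  have hQ' : Q * Qᴴ = 1 := mul_eq_one_comm.mp hQ
  have hTB : T = Qᴴ * B * Q := by rw [Matrix.mul_assoc, hBQ, ← Matrix.mul_assoc, hQ, Matrix.one_mul]
  have hTd : ∀ i, m ≤ (T i i).re := by
    intro i
    apply hm
    have hi : (i : ℕ) < B.charpoly.roots.toList.length := by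
      rw [Multiset.length_toList, card_roots_charpoly]; exact i.2
    rw [hd, List.getD_eq_getElem _ _ hi, ← Multiset.mem_toList]
    exact List.getElem_mem _
  set K := T - Tᴴ with hKdef
  -- The Frobenius norm is unitarily invariant, and K is unitarily similar to twice the skew part of
  -- A.
  have hKnorm : ∑ i, ∑ j, ‖K i j‖ ^ 2 ≤ (2 * κ) ^ 2 := by
    have hfrob : ∀ M : Matrix (Fin n) (Fin n) ℂ, ((∑ i, ∑ j, ‖M i j‖ ^ 2 : ℝ) : ℂ)
        = (M * Mᴴ).trace := by
      intro M
      simp only [Matrix.trace, Matrix.diag, Matrix.mul_apply, Matrix.conjTranspose_apply,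
        Complex.ofReal_sum]
      refine Finset.sum_congr rfl fun i _ => Finset.sum_congr rfl fun j _ => ?_
      rw [Complex.star_def, Complex.mul_conj, Complex.normSq_eq_norm_sq]
    have h1 : K = Qᴴ * (B - Bᴴ) * Q := by
      rw [hKdef, hTB]
      simp only [Matrix.conjTranspose_mul, Matrix.conjTranspose_conjTranspose, Matrix.mul_sub,
        Matrix.sub_mul, Matrix.mul_assoc]
    have h2 : (K * Kᴴ).trace = ((B - Bᴴ) * (B - Bᴴ)ᴴ).trace := by
      rw [h1]
      simp only [Matrix.conjTranspose_mul (Qᴴ * (B - Bᴴ)) Q, Matrix.conjTranspose_mul Qᴴ,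
        Matrix.conjTranspose_conjTranspose]
      rw [Matrix.trace_mul_comm]
      calc (Qᴴ * ((B - Bᴴ)ᴴ * Q) * (Qᴴ * (B - Bᴴ) * Q)).trace
          = (Qᴴ * ((B - Bᴴ)ᴴ * (Q * Qᴴ) * (B - Bᴴ) * Q)).trace := by
            simp only [Matrix.mul_assoc]
        _ = ((B - Bᴴ)ᴴ * (B - Bᴴ) * (Q * Qᴴ)).trace := by
            rw [hQ', Matrix.mul_one, Matrix.trace_mul_comm, Matrix.mul_assoc, hQ']
        _ = ((B - Bᴴ) * (B - Bᴴ)ᴴ).trace := by rw [hQ', Matrix.mul_one, Matrix.trace_mul_comm]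
    rw [← hfrob, ← hfrob] at h2
    have h3 := Complex.ofReal_injective h2
    rw [h3]
    have h4 : ∀ i j, ‖(B - Bᴴ) i j‖ ^ 2 = 4 * ((A i j - A j i) / 2) ^ 2 := by
      intro i j
      have : (B - Bᴴ) i j = ((A i j - A j i : ℝ) : ℂ) := by simp [hB]
      rw [this, Complex.norm_real, Real.norm_eq_abs, sq_abs]
      ring
    simp only [h4, ← Finset.mul_sum]
    nlinarith
  set y : Fin n → ℂ := Qᴴ *ᵥ fun i => (x i : ℂ) with hy
  have hform : ∀ M : Matrix (Fin n) (Fin n) ℂ,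
      star y ⬝ᵥ (Qᴴ * M * Q) *ᵥ y = star (fun i => (x i : ℂ)) ⬝ᵥ M *ᵥ fun i => (x i : ℂ) := by
    intro M
    rw [hy, Matrix.star_mulVec, Matrix.conjTranspose_conjTranspose, ← Matrix.dotProduct_mulVec,
      Matrix.mulVec_mulVec, Matrix.mulVec_mulVec]
    congr 2
    calc Q * (Qᴴ * M * Q) * Qᴴ = (Q * Qᴴ) * M * (Q * Qᴴ) := by simp only [Matrix.mul_assoc]
      _ = M := by rw [hQ', Matrix.one_mul, Matrix.mul_one]
  have hynorm : ∑ i, ‖y i‖ ^ 2 = x ⬝ᵥ x := by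
    have h1 := hform 1
    rw [Matrix.mul_one, hQ, Matrix.one_mulVec, Matrix.one_mulVec] at h1
    have h2 := congrArg Complex.re h1
    simp only [dotProduct, Complex.re_sum, Pi.star_apply] at h2
    have h3 : ∀ i, (star (y i) * y i).re = ‖y i‖ ^ 2 := fun i => by
      rw [mul_comm, Complex.star_def, Complex.mul_conj, Complex.ofReal_re,
        Complex.normSq_eq_norm_sq]
    simp only [h3] at h2
    rw [h2, dotProduct]
    exact Finset.sum_congr rfl fun i _ => by simp
  have hxT : x ⬝ᵥ A *ᵥ x = (star y ⬝ᵥ T *ᵥ y).re := by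
    rw [hTB, hform, re_star_dotProduct_map_mulVec]
    simp [← Pi.zero_def]
  have hexp : 2 * (star y ⬝ᵥ T *ᵥ y).re
      = ∑ i, ∑ j, (star (y i) * ((T i j + star (T j i)) * y j)).re := by
    have h1 : (star y ⬝ᵥ T *ᵥ y).re = ∑ i, ∑ j, (star (y i) * (T i j * y j)).re := by
      simp only [dotProduct, Matrix.mulVec, Complex.re_sum, Finset.mul_sum, Pi.star_apply]
    have h2 : (star y ⬝ᵥ T *ᵥ y).re = ∑ i, ∑ j, (star (y i) * (star (T j i) * y j)).re := by
      rw [h1, Finset.sum_comm]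
      refine Finset.sum_congr rfl fun i _ => Finset.sum_congr rfl fun j _ => ?_
      rw [← Complex.conj_re (star (y j) * _)]
      congr 1
      simp only [map_mul, Complex.star_def, Complex.conj_conj]
      ring
    rw [two_mul]
    conv_lhs => rw [h2]
    conv_lhs => enter [2]; rw [← h2, h1]
    rw [← Finset.sum_add_distrib]
    refine Finset.sum_congr rfl fun i _ => ?_
    rw [← Finset.sum_add_distrib]
    refine Finset.sum_congr rfl fun j _ => ?_
    rw [← Complex.add_re]
    congr 1
    ring
  -- Triangularity enters here: off the diagonal one of T i j and T j i vanishes, so T + Tᴴ and T −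
  -- Tᴴ have entries of equal modulus. The Hermitian part is thus a diagonal at least m plus a
  -- remainder controlled by the skew part.
  have hterm : ∀ i j, (if i = j then 2 * m * ‖y i‖ ^ 2 else 0) - ‖K i j‖ * (‖y i‖ * ‖y j‖)
      ≤ (star (y i) * ((T i j + star (T j i)) * y j)).re := by
    intro i j
    by_cases hij : i = j
    · subst hij
      have h1 : star (y i) * ((T i i + star (T i i)) * y i)
          = ((2 * (T i i).re * ‖y i‖ ^ 2 : ℝ) : ℂ) := by
        rw [Complex.star_def, Complex.add_conj, mul_left_comm,
          mul_comm (starRingEnd ℂ (y i)), Complex.mul_conj, Complex.normSq_eq_norm_sq]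
        push_cast
        ring
      rw [h1, Complex.ofReal_re, if_pos rfl]
      have h2 := mul_le_mul_of_nonneg_right (hTd i) (sq_nonneg ‖y i‖)
      have h3 : 0 ≤ ‖K i i‖ * (‖y i‖ * ‖y i‖) := by positivity
      linarith
    · have h1 : ‖T i j + star (T j i)‖ = ‖K i j‖ := by
        rw [hKdef, Matrix.sub_apply, Matrix.conjTranspose_apply]
        rcases lt_or_gt_of_ne hij with h | h
        · rw [hT j i h, star_zero, add_zero, sub_zero]
        · rw [hT i j h, zero_add, zero_sub, norm_neg]
      rw [if_neg hij, zero_sub]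
      have h2 := (abs_le.mp (Complex.abs_re_le_norm (star (y i) * ((T i j + star (T j i)) * y j)))).1
      rw [norm_mul, norm_mul, h1, norm_star] at h2
      linarith
  have hsum := Finset.sum_le_sum fun i (_ : i ∈ Finset.univ) =>
    Finset.sum_le_sum fun j (_ : j ∈ Finset.univ) => hterm i j
  rw [← hexp] at hsum
  simp only [Finset.sum_sub_distrib, Finset.sum_ite_eq, Finset.mem_univ, if_true] at hsum
  rw [← Finset.mul_sum, hynorm] at hsum
  have hcs : ∑ i, ∑ j, ‖K i j‖ * (‖y i‖ * ‖y j‖) ≤ 2 * κ * (x ⬝ᵥ x) := by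
    have h1 := Finset.sum_mul_sq_le_sq_mul_sq Finset.univ
      (fun p : Fin n × Fin n => ‖K p.1 p.2‖) (fun p => ‖y p.1‖ * ‖y p.2‖)
    simp only [Fintype.sum_prod_type, mul_pow] at h1
    have h2 : ∑ i, ∑ j, ‖y i‖ ^ 2 * ‖y j‖ ^ 2 = (x ⬝ᵥ x) ^ 2 := by
      simp only [← Finset.mul_sum, ← Finset.sum_mul, hynorm]
      ring
    rw [h2] at h1
    have hx0 : 0 ≤ x ⬝ᵥ x := by rw [← hynorm]; positivity
    refine abs_le_of_sq_le_sq' ?_ (by positivity) |>.2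
    rw [mul_pow]
    exact h1.trans (mul_le_mul_of_nonneg_right hKnorm (sq_nonneg _))
  rw [hxT]
  linarith

/-! ### The operator norm in terms of quadratic forms -/

theorem dotProduct_self_eq_norm_sq {n : ℕ} (x : Fin n → ℝ) :
    x ⬝ᵥ x = ‖(WithLp.toLp 2 x : EuclideanSpace ℝ (Fin n))‖ ^ 2 := by
  rw [EuclideanSpace.norm_sq_eq, dotProduct]
  exact Finset.sum_congr rfl fun i _ => by simp [sq]

theorem dotProduct_self_nonneg' {n : ℕ} (x : Fin n → ℝ) : 0 ≤ x ⬝ᵥ x := by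
  rw [dotProduct_self_eq_norm_sq]; positivity

theorem dotProduct_self_pos {n : ℕ} {x : Fin n → ℝ} (hx : x ≠ 0) : 0 < x ⬝ᵥ x :=
  (dotProduct_self_nonneg' x).lt_of_ne fun h => hx (dotProduct_self_eq_zero.mp h.symm)

theorem mulVec_dotProduct_self_le {m n : ℕ} (A : Matrix (Fin m) (Fin n) ℝ) (x : Fin n → ℝ) :
    A *ᵥ x ⬝ᵥ A *ᵥ x ≤ ‖A‖ ^ 2 * (x ⬝ᵥ x) := by
  rw [dotProduct_self_eq_norm_sq, dotProduct_self_eq_norm_sq x, ← mul_pow]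
  gcongr
  exact Matrix.l2_opNorm_mulVec A (WithLp.toLp 2 x)

theorem norm_le_of_mulVec {m n : ℕ} {A : Matrix (Fin m) (Fin n) ℝ} {c : ℝ} (hc : 0 ≤ c)
    (h : ∀ x, A *ᵥ x ⬝ᵥ A *ᵥ x ≤ c ^ 2 * (x ⬝ᵥ x)) : ‖A‖ ≤ c := by
  rw [Matrix.l2_opNorm_def]
  refine ContinuousLinearMap.opNorm_le_bound _ hc fun x => ?_
  have h1 := h (WithLp.ofLp x)
  rw [dotProduct_self_eq_norm_sq, dotProduct_self_eq_norm_sq (WithLp.ofLp x), ← mul_pow] at h1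
  exact (pow_le_pow_iff_left₀ (norm_nonneg _) (by positivity) two_ne_zero).mp h1

theorem abs_dotProduct_le {n : ℕ} (u v : Fin n → ℝ) : |u ⬝ᵥ v| ≤ √(u ⬝ᵥ u) * √(v ⬝ᵥ v) := by
  have h := abs_real_inner_le_norm (WithLp.toLp 2 v : EuclideanSpace ℝ (Fin n)) (WithLp.toLp 2 u)
  rw [dotProduct_self_eq_norm_sq, dotProduct_self_eq_norm_sq v, Real.sqrt_sq (norm_nonneg _),
    Real.sqrt_sq (norm_nonneg _), mul_comm]
  simpa [EuclideanSpace.inner_eq_star_dotProduct] using h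

theorem abs_dotProduct_mulVec_le {n : ℕ} (A : Matrix (Fin n) (Fin n) ℝ) {u x : Fin n → ℝ}
    (h : u ⬝ᵥ u ≤ x ⬝ᵥ x) : |u ⬝ᵥ A *ᵥ x| ≤ ‖A‖ * (x ⬝ᵥ x) := by
  refine (abs_dotProduct_le _ _).trans ?_
  have h1 : √(A *ᵥ x ⬝ᵥ A *ᵥ x) ≤ ‖A‖ * √(x ⬝ᵥ x) := by
    rw [Real.sqrt_le_left (by positivity), mul_pow, Real.sq_sqrt (dotProduct_self_nonneg' x)]
    exact mulVec_dotProduct_self_le A x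
  calc √(u ⬝ᵥ u) * √(A *ᵥ x ⬝ᵥ A *ᵥ x) ≤ √(x ⬝ᵥ x) * (‖A‖ * √(x ⬝ᵥ x)) := by gcongr
    _ = ‖A‖ * (√(x ⬝ᵥ x) * √(x ⬝ᵥ x)) := by ring
    _ = _ := by rw [Real.mul_self_sqrt (dotProduct_self_nonneg' x)]

theorem dotProduct_mulVec_comm {n : ℕ} {A : Matrix (Fin n) (Fin n) ℝ} (hA : Aᵀ = A)
    (x y : Fin n → ℝ) : x ⬝ᵥ A *ᵥ y = A *ᵥ x ⬝ᵥ y := by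
  rw [Matrix.dotProduct_mulVec, ← Matrix.mulVec_transpose, hA]

theorem mulVec_dotProduct_mulVec {k m n : ℕ} (A : Matrix (Fin m) (Fin n) ℝ)
    (B : Matrix (Fin m) (Fin k) ℝ) (x : Fin n → ℝ) (y : Fin k → ℝ) :
    A *ᵥ x ⬝ᵥ B *ᵥ y = x ⬝ᵥ (Aᵀ * B) *ᵥ y := by
  rw [← Matrix.mulVec_mulVec, Matrix.dotProduct_mulVec x, Matrix.vecMul_transpose]

theorem norm_transpose {m n : ℕ} (A : Matrix (Fin m) (Fin n) ℝ) : ‖Aᵀ‖ = ‖A‖ := by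
  rw [← Matrix.conjTranspose_eq_transpose_of_trivial, Matrix.l2_opNorm_conjTranspose]

/-- Cauchy-Schwarz for the semidefinite form of A, read off the discriminant of t ↦ form at x + t A
x, bounds |Ax|⁴ by the product of the forms at x and at Ax. -/
theorem norm_le_of_form {n : ℕ} {A : Matrix (Fin n) (Fin n) ℝ} {c : ℝ} (hA : Aᵀ = A) (hc : 0 ≤ c)
    (h0 : ∀ x, 0 ≤ x ⬝ᵥ A *ᵥ x) (h : ∀ x, x ⬝ᵥ A *ᵥ x ≤ c * (x ⬝ᵥ x)) : ‖A‖ ≤ c := by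
  refine norm_le_of_mulVec hc fun x => ?_
  set y := A *ᵥ x with hy
  have hd : discrim (y ⬝ᵥ A *ᵥ y) (2 * (y ⬝ᵥ y)) (x ⬝ᵥ A *ᵥ x) ≤ 0 := by
    refine discrim_le_zero fun t => ?_
    have := h0 (x + t • y)
    have e : x ⬝ᵥ A *ᵥ y = y ⬝ᵥ y := by rw [dotProduct_mulVec_comm hA]
    rw [Matrix.mulVec_add, Matrix.mulVec_smul, add_dotProduct, dotProduct_add, dotProduct_add,
      smul_dotProduct, smul_dotProduct, dotProduct_smul, dotProduct_smul, e, ← hy] at this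
    simp only [smul_eq_mul] at this
    linarith
  rw [discrim] at hd
  have h1 := h x
  have h2 := h y
  have h3 := h0 x
  have h4 := dotProduct_self_nonneg' x
  have h5 := dotProduct_self_nonneg' y
  have h6 : (y ⬝ᵥ y) ^ 2 ≤ c * (x ⬝ᵥ x) * (c * (y ⬝ᵥ y)) := by
    have : (y ⬝ᵥ A *ᵥ y) * (x ⬝ᵥ A *ᵥ x) ≤ c * (y ⬝ᵥ y) * (c * (x ⬝ᵥ x)) :=
      mul_le_mul h2 h1 h3 (by positivity)
    nlinarith
  rcases h5.eq_or_lt with h7 | h7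
  · rw [← h7]; positivity
  · nlinarith

theorem isUnit_of_mulVec {n : ℕ} {A : Matrix (Fin n) (Fin n) ℝ} {c : ℝ} (hc : 0 < c)
    (h : ∀ x, c ^ 2 * (x ⬝ᵥ x) ≤ A *ᵥ x ⬝ᵥ A *ᵥ x) : IsUnit A ∧ ‖A⁻¹‖ ≤ 1 / c := by
  have hu : IsUnit A := by
    rw [← Matrix.mulVec_injective_iff_isUnit]
    refine (injective_iff_map_eq_zero A.mulVecLin).mpr fun x hx => ?_
    by_contra hx0
    have h1 := h x
    rw [Matrix.mulVecLin_apply] at hx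
    rw [hx, dotProduct_zero] at h1
    have := dotProduct_self_pos hx0
    have : 0 < c ^ 2 * (x ⬝ᵥ x) := by positivity
    linarith
  refine ⟨hu, norm_le_of_mulVec (by positivity) fun x => ?_⟩
  have h1 := h (A⁻¹ *ᵥ x)
  rw [Matrix.mulVec_mulVec, Matrix.mul_nonsing_inv _ ((Matrix.isUnit_iff_isUnit_det A).mp hu),
    Matrix.one_mulVec] at h1
  rw [div_pow, one_pow, div_mul_eq_mul_div, one_mul, le_div_iff₀ (by positivity)]
  linarith

theorem isUnit_of_form {n : ℕ} {A : Matrix (Fin n) (Fin n) ℝ} {c : ℝ} (hc : 0 < c)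
    (h : ∀ x, c * (x ⬝ᵥ x) ≤ x ⬝ᵥ A *ᵥ x) : IsUnit A ∧ ‖A⁻¹‖ ≤ 1 / c := by
  refine isUnit_of_mulVec hc fun x => ?_
  have h1 := (h x).trans ((le_abs_self _).trans (abs_dotProduct_le _ _))
  have h2 := dotProduct_self_nonneg' x
  have h3 := dotProduct_self_nonneg' (A *ᵥ x)
  have h4 := pow_le_pow_left₀ (by positivity) h1 2
  rw [mul_pow, mul_pow, Real.sq_sqrt h2, Real.sq_sqrt h3] at h4
  rcases h2.eq_or_lt with h7 | h7
  · rw [← h7, mul_zero]; exact h3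
  · nlinarith

/-! ### Orthogonal projections -/

section Projections

variable {n d : ℕ} {U : Matrix (Fin n) (Fin d) ℝ}

theorem mulVec_dotProduct_self_of_orthonormal (hU : Uᵀ * U = 1) (y : Fin d → ℝ) :
    U *ᵥ y ⬝ᵥ U *ᵥ y = y ⬝ᵥ y := by
  rw [mulVec_dotProduct_mulVec, hU, Matrix.one_mulVec]

theorem norm_le_one_of_orthonormal (hU : Uᵀ * U = 1) : ‖U‖ ≤ 1 :=
  norm_le_of_mulVec zero_le_one fun x => by
    rw [mulVec_dotProduct_self_of_orthonormal hU, one_pow, one_mul]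

theorem residual_dotProduct_self (hU : Uᵀ * U = 1) (x : Fin n → ℝ) :
    (x - U *ᵥ (Uᵀ *ᵥ x)) ⬝ᵥ (x - U *ᵥ (Uᵀ *ᵥ x)) = x ⬝ᵥ x - Uᵀ *ᵥ x ⬝ᵥ Uᵀ *ᵥ x := by
  have h1 : x ⬝ᵥ U *ᵥ (Uᵀ *ᵥ x) = Uᵀ *ᵥ x ⬝ᵥ Uᵀ *ᵥ x := by
    rw [Matrix.dotProduct_mulVec, ← Matrix.mulVec_transpose]
  rw [dotProduct_sub, sub_dotProduct, sub_dotProduct, mulVec_dotProduct_self_of_orthonormal hU,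
    dotProduct_comm (U *ᵥ (Uᵀ *ᵥ x)) x, h1]
  ring

theorem residual_dotProduct_self_le (hU : Uᵀ * U = 1) (x : Fin n → ℝ) :
    (x - U *ᵥ (Uᵀ *ᵥ x)) ⬝ᵥ (x - U *ᵥ (Uᵀ *ᵥ x)) ≤ x ⬝ᵥ x := by
  rw [residual_dotProduct_self hU]
  linarith [dotProduct_self_nonneg' (Uᵀ *ᵥ x)]

/-- For spaces of equal dimension a one-sided residual bound is two-sided: UᵀV is square, so it and
its transpose have the same least singular value. The difference of the projections then sends x to
the sum of two orthogonal vectors, one for each residual, with the norms controlled by the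
components of x along V and orthogonal to V. -/
theorem norm_projection_sub_le {V : Matrix (Fin n) (Fin d) ℝ} (hU : Uᵀ * U = 1)
    (hV : Vᵀ * V = 1) {t : ℝ} (ht : 0 ≤ t)
    (h : ∀ y, (V *ᵥ y - U *ᵥ (Uᵀ *ᵥ (V *ᵥ y))) ⬝ᵥ (V *ᵥ y - U *ᵥ (Uᵀ *ᵥ (V *ᵥ y)))
      ≤ t ^ 2 * (y ⬝ᵥ y)) : ‖V * Vᵀ - U * Uᵀ‖ ≤ t := by
  have hN : ‖U - V * (Vᵀ * U)‖ ≤ t := by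
    refine norm_le_of_mulVec ht fun y => ?_
    have e : (U - V * (Vᵀ * U)) *ᵥ y = U *ᵥ y - V *ᵥ (Vᵀ *ᵥ (U *ᵥ y)) := by
      rw [Matrix.sub_mulVec, ← Matrix.mulVec_mulVec, ← Matrix.mulVec_mulVec]
    rw [e]
    rcases le_or_gt 1 t with h1 | h1
    · refine (residual_dotProduct_self_le hV _).trans ?_
      rw [mulVec_dotProduct_self_of_orthonormal hU]
      exact le_mul_of_one_le_left (dotProduct_self_nonneg' y) (one_le_pow₀ h1)
    · rw [residual_dotProduct_self hV, mulVec_dotProduct_self_of_orthonormal hU]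
      have hc : 0 < √(1 - t ^ 2) := Real.sqrt_pos.mpr (by nlinarith)
      have hc2 : √(1 - t ^ 2) ^ 2 = 1 - t ^ 2 := Real.sq_sqrt (by nlinarith)
      obtain ⟨hu, hinv⟩ := isUnit_of_mulVec (A := Uᵀ * V) hc (by
        intro y
        have h2 := h y
        rw [residual_dotProduct_self hU, mulVec_dotProduct_self_of_orthonormal hV] at h2
        rw [hc2, ← Matrix.mulVec_mulVec]
        linarith)
      have hu' : IsUnit (Uᵀ * V)ᵀ.det := by
        rw [Matrix.det_transpose]; exact (Matrix.isUnit_iff_isUnit_det _).mp hu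
      have h3 : ‖((Uᵀ * V)ᵀ)⁻¹‖ ≤ 1 / √(1 - t ^ 2) := by
        rw [← Matrix.transpose_nonsing_inv, norm_transpose]; exact hinv
      have h4 := mulVec_dotProduct_self_le ((Uᵀ * V)ᵀ)⁻¹ ((Uᵀ * V)ᵀ *ᵥ y)
      rw [Matrix.mulVec_mulVec, Matrix.nonsing_inv_mul _ hu', Matrix.one_mulVec,
        Matrix.transpose_mul, Matrix.transpose_transpose, ← Matrix.mulVec_mulVec] at h4
      have h5 : ‖(Vᵀ * U)⁻¹‖ ^ 2 ≤ 1 / (1 - t ^ 2) := by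
        rw [← hc2, ← one_div_pow]
        refine pow_le_pow_left₀ (norm_nonneg _) ?_ 2
        rwa [Matrix.transpose_mul, Matrix.transpose_transpose] at h3
      have h6 := h4.trans (mul_le_mul_of_nonneg_right h5 (dotProduct_self_nonneg' _))
      rw [div_mul_eq_mul_div, one_mul, le_div_iff₀ (by nlinarith)] at h6
      linarith
  refine norm_le_of_mulVec ht fun x => ?_
  set z := x - V *ᵥ (Vᵀ *ᵥ x) with hz
  set w := V *ᵥ (Vᵀ *ᵥ x) - U *ᵥ (Uᵀ *ᵥ (V *ᵥ (Vᵀ *ᵥ x))) with hw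
  have e : (V * Vᵀ - U * Uᵀ) *ᵥ x = w - U *ᵥ (Uᵀ *ᵥ z) := by
    rw [Matrix.sub_mulVec, ← Matrix.mulVec_mulVec, ← Matrix.mulVec_mulVec, hw, hz,
      Matrix.mulVec_sub, Matrix.mulVec_sub]
    abel
  have hUw : Uᵀ *ᵥ w = 0 := by
    rw [hw, Matrix.mulVec_sub, Matrix.mulVec_mulVec (M := Uᵀ) (N := U), hU, Matrix.one_mulVec,
      sub_self]
  have hVz : Vᵀ *ᵥ z = 0 := by
    rw [hz, Matrix.mulVec_sub, Matrix.mulVec_mulVec (M := Vᵀ) (N := V), hV, Matrix.one_mulVec,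
      sub_self]
  have horth : w ⬝ᵥ U *ᵥ (Uᵀ *ᵥ z) = 0 := by
    rw [Matrix.dotProduct_mulVec, ← Matrix.mulVec_transpose, hUw, zero_dotProduct]
  have h1 : w ⬝ᵥ w ≤ t ^ 2 * (Vᵀ *ᵥ x ⬝ᵥ Vᵀ *ᵥ x) := h _
  have h2 : Uᵀ *ᵥ z ⬝ᵥ Uᵀ *ᵥ z ≤ t ^ 2 * (z ⬝ᵥ z) := by
    have h3 : Uᵀ *ᵥ z = (U - V * (Vᵀ * U))ᵀ *ᵥ z := by
      rw [Matrix.transpose_sub, Matrix.transpose_mul V, Matrix.sub_mulVec, ← Matrix.mulVec_mulVec,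
        hVz, Matrix.mulVec_zero, sub_zero]
    rw [h3]
    refine (mulVec_dotProduct_self_le _ z).trans ?_
    rw [norm_transpose]
    have := dotProduct_self_nonneg' z
    gcongr
  have h3 := residual_dotProduct_self hV x
  rw [← hz] at h3
  clear_value w z
  rw [e, dotProduct_sub, sub_dotProduct, sub_dotProduct, dotProduct_comm (U *ᵥ (Uᵀ *ᵥ z)) w, horth,
    mulVec_dotProduct_self_of_orthonormal hU]
  have h4 : x ⬝ᵥ x = z ⬝ᵥ z + Vᵀ *ᵥ x ⬝ᵥ Vᵀ *ᵥ x := by linarith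
  rw [h4]
  linarith

end Projections

/-! ### Perturbation of invariant subspaces -/

theorem sum_sq_entries_le {n : ℕ} (K : Matrix (Fin n) (Fin n) ℝ) :
    ∑ i, ∑ j, K i j ^ 2 ≤ n * ‖K‖ ^ 2 := by
  rw [Finset.sum_comm]
  have h : ∀ j, ∑ i, K i j ^ 2 ≤ ‖K‖ ^ 2 := by
    intro j
    have h1 := mulVec_dotProduct_self_le K (Pi.single j 1)
    rw [Matrix.mulVec_single_one, single_one_dotProduct, Pi.single_eq_same, mul_one] at h1
    refine le_trans (le_of_eq ?_) h1
    exact Finset.sum_congr rfl fun i _ => by simp [sq]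
  exact (Finset.sum_le_sum fun j _ => h j).trans (by simp)

theorem two_add_sqrt_le {d : ℝ} (hd : 1 ≤ d) : 2 + √(2 * (d - 1)) ≤ 2 * √(2 * d) := by
  have h1 : √(2 * d) ^ 2 = 2 * d := Real.sq_sqrt (by linarith)
  have h2 : 1 ≤ √(2 * d) := by
    rw [Real.one_le_sqrt]; linarith
  have h3 : √(2 * (d - 1)) ≤ 2 * √(2 * d) - 2 := by
    rw [Real.sqrt_le_left (by linarith)]
    -- With t = √(2d) the claim is 3t² − 8t + 6 ≥ 0, and three times the left side is (3t − 4)² + 2.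
    nlinarith [sq_nonneg (3 * √(2 * d) - 4)]
  linarith

/-- A variant of the Davis-Kahan theorem for a possibly non-symmetric perturbation `A` of a symmetric
matrix `S` whose range is spanned by the columns of `U`. -/
theorem norm_projection_sub_le_of_gap {n d : ℕ} (hd : 1 ≤ d) (A S : Matrix (Fin n) (Fin n) ℝ)
    (U V : Matrix (Fin n) (Fin d) ℝ) (hU : Uᵀ * U = 1) (hV : Vᵀ * V = 1) (hS : Sᵀ = S)
    (hSU : U * (Uᵀ * S) = S) (hA : A * V = V * (Vᵀ * A * V)) {m F g : ℝ}
    (hm : ∀ z ∈ ((Vᵀ * A * V).map (algebraMap ℝ ℂ)).charpoly.roots, m ≤ z.re)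
    (hF : ‖A - S‖ ≤ F) (hg : 0 < g) (hmg : 2 * √(2 * d) * F < g → g - F ≤ m) :
    ‖V * Vᵀ - U * Uᵀ‖ ≤ 2 * √(2 * d) / g * F := by
  have hF0 : 0 ≤ F := (norm_nonneg _).trans hF
  have hd' : (1 : ℝ) ≤ d := by exact_mod_cast hd
  have hs : 0 < √(2 * (d : ℝ)) := Real.sqrt_pos.mpr (by linarith)
  -- Two orthogonal projections of equal rank differ by at most 1 in norm, so only a bound below 1
  -- has content.
  rcases le_or_gt 1 (2 * √(2 * d) / g * F) with hq | hq
  · refine le_trans ?_ hq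
    refine norm_projection_sub_le hU hV zero_le_one fun y => ?_
    refine (residual_dotProduct_self_le hU _).trans ?_
    rw [mulVec_dotProduct_self_of_orthonormal hV, one_pow, one_mul]
  have hq' : 2 * √(2 * d) * F < g := by
    rwa [div_mul_eq_mul_div, div_lt_one hg] at hq
  replace hmg := hmg hq'
  set Λ := Vᵀ * A * V with hΛ
  -- A bound for the Frobenius norm of the skew part of Λ, which is at most √d F. For d ≥ 2 one has
  -- d ≤ 2(d − 1), and a 1 × 1 matrix has no skew part.
  set κ := √(2 * ((d : ℝ) - 1)) * F with hκ
  have hκ0 : 0 ≤ κ := by positivity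
  set E := Vᵀ * (A - S) * V with hE
  have hEnorm : ‖E‖ ≤ F := by
    calc ‖E‖ ≤ ‖Vᵀ * (A - S)‖ * ‖V‖ := Matrix.l2_opNorm_mul _ _
      _ ≤ ‖Vᵀ‖ * ‖A - S‖ * ‖V‖ := by gcongr; exact Matrix.l2_opNorm_mul _ _
      _ ≤ 1 * F * 1 := by
        have := norm_le_one_of_orthonormal hV
        gcongr
        rwa [norm_transpose]
      _ = F := by ring
  have hskew : ∀ i j, (Λ i j - Λ j i) / 2 = ((1 / 2 : ℝ) • (E - Eᵀ)) i j := by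
    intro i j
    have h1 : Λ - Λᵀ = E - Eᵀ := by
      rw [hΛ, hE]
      simp only [Matrix.transpose_mul, Matrix.transpose_transpose, Matrix.transpose_sub, hS,
        Matrix.mul_sub, Matrix.sub_mul, Matrix.mul_assoc]
      abel
    have h2 := congrFun (congrFun h1 i) j
    simp only [Matrix.sub_apply, Matrix.transpose_apply] at h2
    simp only [Matrix.smul_apply, Matrix.sub_apply, Matrix.transpose_apply, smul_eq_mul]
    linarith
  have hK : ∑ i, ∑ j, ((Λ i j - Λ j i) / 2) ^ 2 ≤ κ ^ 2 := by
    rcases hd.eq_or_lt with h1 | h1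
    · have : ∀ i j : Fin d, Λ i j - Λ j i = 0 := fun i j => by
        have : i = j := by ext; omega
        rw [this, sub_self]
      simp only [this]
      simp only [zero_div, ne_eq, OfNat.ofNat_ne_zero, not_false_eq_true, zero_pow,
        Finset.sum_const_zero]
      positivity
    · simp only [hskew]
      refine (sum_sq_entries_le _).trans ?_
      have h2 : ‖(1 / 2 : ℝ) • (E - Eᵀ)‖ ≤ F := by
        rw [norm_smul]
        have h3 := norm_sub_le E Eᵀ
        rw [norm_transpose] at h3
        rw [Real.norm_of_nonneg (by norm_num)]
        linarith
      have h3 : (2 : ℝ) ≤ d := by exact_mod_cast h1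
      rw [hκ, mul_pow, Real.sq_sqrt (by linarith)]
      have h4 := pow_le_pow_left₀ (norm_nonneg _) h2 2
      exact mul_le_mul (by linarith) h4 (by positivity) (by linarith)
  have hform := form_ge_of_roots Λ m κ hm hκ0 hK
  -- The claimed bound is F/σ, so the numerical range of Λ has to stay right of σ. As F ≤ σ and g =
  -- 2√(2d) σ, what remains after subtracting F and κ from g is at least σ by `two_add_sqrt_le`.
  set σ := g / (2 * √(2 * d)) with hσ
  have hσ0 : 0 < σ := by positivity
  have hσm : σ ≤ m - κ := by
    have h1 := two_add_sqrt_le hd'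
    have h2 : F ≤ σ := by
      rw [hσ, le_div_iff₀ (by positivity)]
      linarith
    have h3 : g = 2 * √(2 * d) * σ := by rw [hσ]; field_simp
    have h4 : κ ≤ √(2 * ((d : ℝ) - 1)) * σ := by rw [hκ]; gcongr
    nlinarith
  obtain ⟨hu, hinv⟩ := isUnit_of_form hσ0 fun y =>
    (mul_le_mul_of_nonneg_right hσm (dotProduct_self_nonneg' y)).trans (hform y)
  have ht : 2 * √(2 * d) / g * F = F / σ := by
    rw [hσ]; field_simp
  rw [ht]
  refine norm_projection_sub_le hU hV (by positivity) fun y => ?_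
  -- V y = A V Λ⁻¹ y, and the part S V Λ⁻¹ y lies in the range of U.
  have hres : V *ᵥ y - U *ᵥ (Uᵀ *ᵥ (V *ᵥ y))
      = (A - S) *ᵥ (V *ᵥ (Λ⁻¹ *ᵥ y)) - U *ᵥ (Uᵀ *ᵥ ((A - S) *ᵥ (V *ᵥ (Λ⁻¹ *ᵥ y)))) := by
    have h1 : V *ᵥ y = (A - S) *ᵥ (V *ᵥ (Λ⁻¹ *ᵥ y)) + S *ᵥ (V *ᵥ (Λ⁻¹ *ᵥ y)) := by
      rw [← Matrix.add_mulVec, sub_add_cancel, Matrix.mulVec_mulVec (M := A), hA,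
        Matrix.mulVec_mulVec, Matrix.mul_assoc,
        Matrix.mul_nonsing_inv _ ((Matrix.isUnit_iff_isUnit_det _).mp hu), Matrix.mul_one]
    have h2 : ∀ z, U *ᵥ (Uᵀ *ᵥ (S *ᵥ z)) = S *ᵥ z := fun z => by
      rw [Matrix.mulVec_mulVec, Matrix.mulVec_mulVec, Matrix.mul_assoc, hSU]
    rw [h1, Matrix.mulVec_add, Matrix.mulVec_add, h2]
    abel
  rw [hres]
  refine (residual_dotProduct_self_le hU _).trans ((mulVec_dotProduct_self_le _ _).trans ?_)
  rw [mulVec_dotProduct_self_of_orthonormal hV]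
  have h1 := mulVec_dotProduct_self_le Λ⁻¹ y
  have h2 := dotProduct_self_nonneg' y
  have h3 := dotProduct_self_nonneg' (Λ⁻¹ *ᵥ y)
  calc ‖A - S‖ ^ 2 * (Λ⁻¹ *ᵥ y ⬝ᵥ Λ⁻¹ *ᵥ y) ≤ F ^ 2 * ((1 / σ) ^ 2 * (y ⬝ᵥ y)) := by
        gcongr
        refine h1.trans ?_
        gcongr
    _ = (F / σ) ^ 2 * (y ⬝ᵥ y) := by ring

/-- The compression of A to the complement of V has trace equal to the sum of the remaining n − d
eigenvalues, at most (n − d) λ_{d+1}(A). Since S is positive semidefinite, that trace is also at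
least −(n − d) ‖A − S‖. -/
theorem neg_norm_le_lam_succ {n d : ℕ} (hd : d < n) (A S : Matrix (Fin n) (Fin n) ℝ)
    (V : Matrix (Fin n) (Fin d) ℝ) (hV : IsTopEigenbasis A V) (hS : ∀ x, 0 ≤ x ⬝ᵥ S *ᵥ x) :
    -‖A - S‖ ≤ lam (d + 1) A := by
  obtain ⟨hV1, hAV, hlist⟩ := hV
  have hnd : (0 : ℝ) < (n : ℝ) - d := by
    rw [sub_pos]; exact_mod_cast hd
  set Q : Matrix (Fin n) (Fin n) ℝ := 1 - V * Vᵀ with hQ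
  have hQt : Qᵀ = Q := by
    rw [hQ, Matrix.transpose_sub, Matrix.transpose_one, Matrix.transpose_mul,
      Matrix.transpose_transpose]
  have hQQ : Q * Q = Q := by
    have : V * Vᵀ * (V * Vᵀ) = V * Vᵀ := by
      rw [Matrix.mul_assoc, ← Matrix.mul_assoc Vᵀ, hV1, Matrix.one_mul]
    rw [hQ, Matrix.mul_sub, Matrix.mul_one, Matrix.sub_mul, Matrix.one_mul, this, sub_self,
      sub_zero]
  have htrQ : Q.trace = n - d := by
    rw [hQ, Matrix.trace_sub, Matrix.trace_mul_comm, hV1, Matrix.trace_one, Matrix.trace_one]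
    simp
  have htr : (Q * A * Q).trace = ((eigList A).drop d).sum := by
    have h1 : (Q * A * Q).trace = A.trace - (Vᵀ * A * V).trace := by
      rw [Matrix.trace_mul_comm, ← Matrix.mul_assoc, hQQ, hQ, Matrix.sub_mul, Matrix.one_mul,
        Matrix.trace_sub, Matrix.mul_assoc, Matrix.trace_mul_comm V]
    rw [h1, trace_eq_sum_eigList, trace_eq_sum_eigList, hlist]
    have := List.sum_take_add_sum_drop (eigList A) d
    linarith
  have hup : ((eigList A).drop d).sum ≤ (n - d) * lam (d + 1) A := by
    have h1 := List.sum_le_card_nsmul _ _ (le_lam_of_mem_drop (A := A) hd)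
    rw [List.length_drop, length_eigList, nsmul_eq_mul, Nat.cast_sub hd.le] at h1
    exact h1
  have hlow : -‖A - S‖ * (n - d) ≤ (Q * A * Q).trace := by
    rw [← htrQ]
    have h1 : ∀ M : Matrix (Fin n) (Fin n) ℝ,
        (Q * M * Q).trace = ∑ i, Q *ᵥ Pi.single i 1 ⬝ᵥ M *ᵥ (Q *ᵥ Pi.single i 1) := by
      intro M
      refine Finset.sum_congr rfl fun i _ => ?_
      rw [Matrix.mulVec_mulVec, mulVec_dotProduct_mulVec, single_one_dotProduct,
        Matrix.mulVec_single_one, hQt, Matrix.mul_assoc]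
      rfl
    have h2 := h1 1
    rw [Matrix.mul_one, hQQ] at h2
    rw [h2, h1 A, Finset.mul_sum]
    refine Finset.sum_le_sum fun i _ => ?_
    set q := Q *ᵥ Pi.single i 1
    have h3 := (abs_le.mp (abs_dotProduct_mulVec_le (A - S) (le_refl (q ⬝ᵥ q)))).1
    rw [Matrix.sub_mulVec, dotProduct_sub] at h3
    rw [Matrix.one_mulVec]
    linarith [hS q]
  have h := hlow.trans (htr.le.trans hup)
  rw [mul_comm ((n : ℝ) - d)] at h
  exact le_of_mul_le_mul_right h hnd

/-! ### Symmetric matrices -/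

theorem lamMin_mul_le_form {n : ℕ} {A : Matrix (Fin n) (Fin n) ℝ} (hA : Aᵀ = A)
    (x : Fin n → ℝ) : lamMin A * (x ⬝ᵥ x) ≤ x ⬝ᵥ A *ᵥ x := by
  have h := form_ge_of_roots A (lamMin A) 0 (le_re_of_mem_roots fun y hy =>
    lam_le_of_mem_take le_rfl y (by rwa [List.take_of_length_le (length_eigList A).le])) le_rfl
    (by
      have h1 : ∀ i j, A i j - A j i = 0 := fun i j => by
        rw [← Matrix.transpose_apply A, hA, sub_self]
      simp [h1]) x
  rwa [sub_zero] at h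

theorem exists_spectral {n : ℕ} {A : Matrix (Fin n) (Fin n) ℝ} (hA : Aᵀ = A) :
    ∃ (O : Matrix (Fin n) (Fin n) ℝ) (e : Fin n → ℝ), Oᵀ * O = 1 ∧
      A = O * Matrix.diagonal e * Oᵀ ∧
      ∀ c : ℝ, (A.map (algebraMap ℝ ℂ)).charpoly.roots.countP (fun z => c ≤ z.re)
        = (Finset.univ.filter fun i => c ≤ e i).card := by
  have hH : A.IsHermitian := by
    rw [Matrix.IsHermitian, Matrix.conjTranspose_eq_transpose_of_trivial, hA]
  refine ⟨hH.eigenvectorUnitary, hH.eigenvalues, ?_, ?_, fun c => ?_⟩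
  · have := Unitary.coe_star_mul_self hH.eigenvectorUnitary
    rwa [Matrix.star_eq_conjTranspose, Matrix.conjTranspose_eq_transpose_of_trivial] at this
  · have := hH.spectral_theorem
    rw [Unitary.conjStarAlgAut_apply, Matrix.star_eq_conjTranspose,
      Matrix.conjTranspose_eq_transpose_of_trivial] at this
    exact this
  · have h1 : (A.map (algebraMap ℝ ℂ)).charpoly.roots
        = (Finset.univ.val.map fun i => ((hH.eigenvalues i : ℝ) : ℂ)) := by
      rw [← Polynomial.roots_multiset_prod_X_sub_C
        (Finset.univ.val.map fun i => ((hH.eigenvalues i : ℝ) : ℂ)), Multiset.map_map]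
      congr 1
      rw [Matrix.charpoly_map, hH.charpoly_eq, Polynomial.map_prod]
      simp [Finset.prod]
    rw [h1, Multiset.countP_map]
    rfl

theorem form_diagonal {n : ℕ} (O : Matrix (Fin n) (Fin n) ℝ) (e : Fin n → ℝ) (x y : Fin n → ℝ) :
    x ⬝ᵥ (O * Matrix.diagonal e * Oᵀ) *ᵥ y = ∑ i, e i * ((Oᵀ *ᵥ x) i * (Oᵀ *ᵥ y) i) := by
  rw [← Matrix.mulVec_mulVec, ← Matrix.mulVec_mulVec, Matrix.dotProduct_mulVec,
    ← Matrix.mulVec_transpose, dotProduct]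
  refine Finset.sum_congr rfl fun i _ => ?_
  rw [Matrix.mulVec_diagonal]
  ring

theorem dotProduct_self_eq_sum_orthogonal {n : ℕ} {O : Matrix (Fin n) (Fin n) ℝ}
    (hO : Oᵀ * O = 1) (x : Fin n → ℝ) : x ⬝ᵥ x = ∑ i, (Oᵀ *ᵥ x) i ^ 2 := by
  have h := mul_eq_one_comm.mp hO
  have h1 : Oᵀ *ᵥ x ⬝ᵥ Oᵀ *ᵥ x = x ⬝ᵥ x := by
    rw [mulVec_dotProduct_mulVec, Matrix.transpose_transpose, h, Matrix.one_mulVec]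
  rw [← h1, dotProduct]
  exact Finset.sum_congr rfl fun i _ => by rw [sq]

/-- The eigenvectors selected by an injective family of indices. -/
theorem exists_columns {n k : ℕ} (s : Finset (Fin n)) (h : k ≤ s.card) :
    ∃ f : Fin k → Fin n, Function.Injective f ∧ ∀ i, f i ∈ s :=
  ⟨fun i => s.orderEmbOfFin rfl (Fin.castLE h i),
    fun _ _ hij => Fin.castLE_injective h ((s.orderEmbOfFin rfl).injective hij),
    fun _ => s.orderEmbOfFin_mem rfl _⟩

theorem submatrix_columns_orthonormal {n k : ℕ} {O : Matrix (Fin n) (Fin n) ℝ} (hO : Oᵀ * O = 1)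
    {f : Fin k → Fin n} (hf : Function.Injective f) :
    (O.submatrix id f)ᵀ * O.submatrix id f = 1 := by
  ext i j
  have h1 := congrFun (congrFun hO (f i)) (f j)
  have h2 : ((O.submatrix id f)ᵀ * O.submatrix id f) i j = (Oᵀ * O) (f i) (f j) := rfl
  rw [h2, h1, Matrix.one_apply, Matrix.one_apply]
  simp [hf.eq_iff]

theorem orthogonal_mulVec_columns {n k : ℕ} {O : Matrix (Fin n) (Fin n) ℝ} (hO : Oᵀ * O = 1)
    (f : Fin k → Fin n) (y : Fin k → ℝ) {i : Fin n}
    (h : (Oᵀ *ᵥ (O.submatrix id f *ᵥ y)) i ≠ 0) : ∃ j, f j = i := by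
  by_contra hne
  push Not at hne
  apply h
  rw [Matrix.mulVec_mulVec, Matrix.mulVec, dotProduct]
  refine Finset.sum_eq_zero fun j _ => ?_
  have h2 : (Oᵀ * O.submatrix id f) i j = (Oᵀ * O) i (f j) := rfl
  rw [h2, hO, Matrix.one_apply_ne (hne j).symm, zero_mul]

theorem exists_top_columns {n k : ℕ} {A : Matrix (Fin n) (Fin n) ℝ} (hA : Aᵀ = A) {c : ℝ}
    (h1 : 1 ≤ k) (hk : k ≤ n) (h : c ≤ lam k A) :
    ∃ W : Matrix (Fin n) (Fin k) ℝ, Wᵀ * W = 1 ∧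
      ∀ y, c * (y ⬝ᵥ y) ≤ W *ᵥ y ⬝ᵥ A *ᵥ (W *ᵥ y) := by
  obtain ⟨O, e, hO, hAe, hcount⟩ := exists_spectral hA
  rw [le_lam_iff A h1 hk, hcount] at h
  obtain ⟨f, hf, hfs⟩ := exists_columns _ h
  refine ⟨O.submatrix id f, submatrix_columns_orthonormal hO hf, fun y => ?_⟩
  rw [← mulVec_dotProduct_self_of_orthonormal (submatrix_columns_orthonormal hO hf) y,
    dotProduct_self_eq_sum_orthogonal hO, hAe, form_diagonal, Finset.mul_sum]
  refine Finset.sum_le_sum fun i _ => ?_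
  by_cases h0 : (Oᵀ *ᵥ (O.submatrix id f *ᵥ y)) i = 0
  · simp [h0]
  · obtain ⟨j, rfl⟩ := orthogonal_mulVec_columns hO f y h0
    rw [← sq]
    exact mul_le_mul_of_nonneg_right (Finset.mem_filter.mp (hfs j)).2 (sq_nonneg _)

/-- Courant-Fischer: on the span of the eigenvectors with eigenvalue above b the form exceeds b |x|²
unless x = 0, so Zᵀ is injective there. -/
theorem card_le_of_form_le {n d : ℕ} {O : Matrix (Fin n) (Fin n) ℝ} {e : Fin n → ℝ}
    (hO : Oᵀ * O = 1) {b : ℝ} (Z : Matrix (Fin n) (Fin d) ℝ)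
    (h : ∀ x, Zᵀ *ᵥ x = 0 → x ⬝ᵥ (O * Matrix.diagonal e * Oᵀ) *ᵥ x ≤ b * (x ⬝ᵥ x)) :
    (Finset.univ.filter fun i => b < e i).card ≤ d := by
  obtain ⟨f, hf, hfs⟩ := exists_columns (Finset.univ.filter fun i => b < e i) le_rfl
  have hinj : Function.Injective (Zᵀ * O.submatrix id f).mulVecLin := by
    refine (injective_iff_map_eq_zero _).mpr fun y hy => ?_
    rw [Matrix.mulVecLin_apply, ← Matrix.mulVec_mulVec] at hy
    have h1 := h _ hy
    rw [form_diagonal, dotProduct_self_eq_sum_orthogonal hO, Finset.mul_sum] at h1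
    have hle : ∀ i ∈ Finset.univ, b * (Oᵀ *ᵥ (O.submatrix id f *ᵥ y)) i ^ 2
        ≤ e i * ((Oᵀ *ᵥ (O.submatrix id f *ᵥ y)) i * (Oᵀ *ᵥ (O.submatrix id f *ᵥ y)) i) := by
      intro i _
      by_cases h0 : (Oᵀ *ᵥ (O.submatrix id f *ᵥ y)) i = 0
      · simp [h0]
      · obtain ⟨j, rfl⟩ := orthogonal_mulVec_columns hO f y h0
        rw [← sq]
        exact mul_le_mul_of_nonneg_right (Finset.mem_filter.mp (hfs j)).2.le (sq_nonneg _)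
    have heq := (Finset.sum_eq_sum_iff_of_le hle).mp (le_antisymm (Finset.sum_le_sum hle) h1)
    have hz : ∀ i, (Oᵀ *ᵥ (O.submatrix id f *ᵥ y)) i = 0 := by
      intro i
      by_contra h0
      obtain ⟨j, rfl⟩ := orthogonal_mulVec_columns hO f y h0
      have h2 := heq (f j) (Finset.mem_univ _)
      rw [← sq] at h2
      exact absurd (mul_right_cancel₀ (pow_ne_zero 2 h0) h2)
        (Finset.mem_filter.mp (hfs j)).2.ne
    have h3 := dotProduct_self_eq_sum_orthogonal hO (O.submatrix id f *ᵥ y)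
    rw [mulVec_dotProduct_self_of_orthonormal (submatrix_columns_orthonormal hO hf)] at h3
    simp only [hz] at h3
    exact dotProduct_self_eq_zero.mp (by simpa using h3)
  simpa using LinearMap.finrank_le_finrank_of_injective hinj

/-- The companion bound: a vector of the range of V without components along eigenvalues ≥ m has
form below m |x|² unless it is 0. -/
theorem le_card_of_le_form {n d : ℕ} {O : Matrix (Fin n) (Fin n) ℝ} {e : Fin n → ℝ}
    (hO : Oᵀ * O = 1) {m : ℝ} (V : Matrix (Fin n) (Fin d) ℝ) (hV : ∀ y, V *ᵥ y = 0 → y = 0)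
    (h : ∀ y, m * (V *ᵥ y ⬝ᵥ V *ᵥ y)
      ≤ V *ᵥ y ⬝ᵥ (O * Matrix.diagonal e * Oᵀ) *ᵥ (V *ᵥ y)) :
    d ≤ (Finset.univ.filter fun i => m ≤ e i).card := by
  set s := Finset.univ.filter fun i => m ≤ e i with hs
  let f : s → Fin n := Subtype.val
  have hinj : Function.Injective ((Oᵀ * V).submatrix f id).mulVecLin := by
    refine (injective_iff_map_eq_zero _).mpr fun y hy => hV y ?_
    have hy' : ∀ i, m ≤ e i → (Oᵀ *ᵥ (V *ᵥ y)) i = 0 := by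
      intro i hi
      have := congrFun hy ⟨i, by simp [hs, hi]⟩
      rw [Matrix.mulVec_mulVec]
      exact this
    have h1 := h y
    rw [form_diagonal, dotProduct_self_eq_sum_orthogonal hO, Finset.mul_sum] at h1
    have hle : ∀ i ∈ Finset.univ, e i * ((Oᵀ *ᵥ (V *ᵥ y)) i * (Oᵀ *ᵥ (V *ᵥ y)) i)
        ≤ m * (Oᵀ *ᵥ (V *ᵥ y)) i ^ 2 := by
      intro i _
      rw [← sq]
      rcases le_or_gt m (e i) with hi | hi
      · simp [hy' i hi]
      · exact mul_le_mul_of_nonneg_right hi.le (sq_nonneg _)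
    have heq := (Finset.sum_eq_sum_iff_of_le hle).mp (le_antisymm (Finset.sum_le_sum hle) h1)
    have hz : ∀ i, (Oᵀ *ᵥ (V *ᵥ y)) i = 0 := by
      intro i
      by_contra h0
      have h2 := heq i (Finset.mem_univ _)
      rw [← sq] at h2
      exact h0 (hy' i (mul_right_cancel₀ (pow_ne_zero 2 h0) h2).ge)
    have h3 := dotProduct_self_eq_sum_orthogonal hO (V *ᵥ y)
    simp only [hz] at h3
    exact dotProduct_self_eq_zero.mp (by simpa using h3)
  simpa using LinearMap.finrank_le_finrank_of_injective hinj

/-- If a symmetric matrix `S` has `d` eigenvalues above `m` and the others below `b`, then the `d`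
eigenvalues of largest real part of a possibly non-symmetric `A` close to `S` lie to the right of
any `c` well inside the gap. -/
theorem le_lam_of_gap {n d : ℕ} (hd : 1 ≤ d) (A S : Matrix (Fin n) (Fin n) ℝ) (hS : Sᵀ = S)
    (V Z : Matrix (Fin n) (Fin d) ℝ) (hV : ∀ y, V *ᵥ y = 0 → y = 0) {m b c w : ℝ}
    (hm : ∀ y, m * (V *ᵥ y ⬝ᵥ V *ᵥ y) ≤ V *ᵥ y ⬝ᵥ S *ᵥ (V *ᵥ y))
    (hb : ∀ x, Zᵀ *ᵥ x = 0 → x ⬝ᵥ S *ᵥ x ≤ b * (x ⬝ᵥ x))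
    (hw : ‖A - S‖ ≤ w) (hbc : b + w < c) (hcm : c < m - w) : c ≤ lam d A := by
  have hw0 : 0 ≤ w := (norm_nonneg _).trans hw
  obtain ⟨O, e, hO, hSe, -⟩ := exists_spectral hS
  have hcard1 := le_card_of_le_form hO (e := e) V hV (by rwa [← hSe])
  have hcard2 := card_le_of_form_le hO (e := e) Z (by rwa [← hSe])
  have hsub : (Finset.univ.filter fun i => m ≤ e i) ⊆ Finset.univ.filter fun i => b < e i := by
    intro i hi
    simp only [Finset.mem_filter, Finset.mem_univ, true_and] at hi ⊢
    linarith
  -- At least d eigenvalues are ≥ m and at most d are > b. The first index set lies in the second,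
  -- so they coincide and no eigenvalue lies strictly between b and m.
  have heq := Finset.eq_of_subset_of_card_le hsub (hcard2.trans hcard1)
  have hgap : ∀ i, e i ≤ b ∨ m ≤ e i := by
    intro i
    rcases le_or_gt (e i) b with h | h
    · exact Or.inl h
    · right
      have : i ∈ Finset.univ.filter fun i => m ≤ e i := by rw [heq]; simp [h]
      exact (Finset.mem_filter.mp this).2
  -- J is the reflection given by the sign of S relative to the gap. It is symmetric and orthogonal,
  -- so replacing S by A changes the form x·J(S − c)x by at most w |x|².
  set ε : Fin n → ℝ := fun i => if m ≤ e i then 1 else -1 with hε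
  set J := O * Matrix.diagonal ε * Oᵀ with hJ
  have hJt : Jᵀ = J := by
    rw [hJ, Matrix.transpose_mul, Matrix.transpose_mul, Matrix.transpose_transpose,
      Matrix.diagonal_transpose, Matrix.mul_assoc]
  have hJJ : Jᵀ * J = 1 := by
    have h2 : Matrix.diagonal ε * Matrix.diagonal ε = 1 := by
      rw [Matrix.diagonal_mul_diagonal, ← Matrix.diagonal_one]
      congr 1
      ext i
      simp only [hε]
      split_ifs <;> norm_num
    rw [hJt, hJ]
    calc O * Matrix.diagonal ε * Oᵀ * (O * Matrix.diagonal ε * Oᵀ)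
        = O * Matrix.diagonal ε * (Oᵀ * O) * (Matrix.diagonal ε * Oᵀ) := by
          simp only [Matrix.mul_assoc]
      _ = O * (Matrix.diagonal ε * Matrix.diagonal ε) * Oᵀ := by
          rw [hO, Matrix.mul_one]; simp only [Matrix.mul_assoc]
      _ = 1 := by rw [h2, Matrix.mul_one, mul_eq_one_comm.mp hO]
  obtain ⟨f, hf, hfs⟩ := exists_columns _ hcard1
  refine le_lam_of_form A J c hd hJt ?_ (O.submatrix id f) ?_ ?_
  · intro x hx
    have h1 : x ⬝ᵥ J *ᵥ (A *ᵥ x - c • x) = x ⬝ᵥ J *ᵥ (S *ᵥ x - c • x) + J *ᵥ x ⬝ᵥ (A - S) *ᵥ x := by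
      rw [← dotProduct_mulVec_comm hJt, ← dotProduct_add, ← Matrix.mulVec_add, Matrix.sub_mulVec]
      congr 2
      abel
    have h2 := (abs_le.mp (abs_dotProduct_mulVec_le (A - S) (u := J *ᵥ x) (x := x)
      (mulVec_dotProduct_self_of_orthonormal hJJ x).le)).1
    have hx0 := dotProduct_self_pos hx
    have h3 : min (m - c) (c - b) * (x ⬝ᵥ x) ≤ x ⬝ᵥ J *ᵥ (S *ᵥ x - c • x) := by
      have h4 : ∀ i, (Oᵀ *ᵥ (S *ᵥ x - c • x)) i = (e i - c) * (Oᵀ *ᵥ x) i := by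
        intro i
        have h5 : Oᵀ *ᵥ (S *ᵥ x) = Matrix.diagonal e *ᵥ (Oᵀ *ᵥ x) := by
          rw [hSe, Matrix.mulVec_mulVec, Matrix.mulVec_mulVec, ← Matrix.mul_assoc,
            ← Matrix.mul_assoc, hO, Matrix.one_mul]
        rw [Matrix.mulVec_sub, h5, Matrix.mulVec_smul, Pi.sub_apply, Matrix.mulVec_diagonal,
          Pi.smul_apply, smul_eq_mul, sub_mul]
      rw [hJ, form_diagonal, dotProduct_self_eq_sum_orthogonal hO x, Finset.mul_sum]
      refine Finset.sum_le_sum fun i _ => ?_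
      rw [h4]
      have h6 : ε i * ((Oᵀ *ᵥ x) i * ((e i - c) * (Oᵀ *ᵥ x) i))
          = (ε i * (e i - c)) * (Oᵀ *ᵥ x) i ^ 2 := by ring
      rw [h6]
      refine mul_le_mul_of_nonneg_right ?_ (sq_nonneg _)
      simp only [hε]
      split_ifs with hi
      · exact (min_le_left _ _).trans (by linarith)
      · exact (min_le_right _ _).trans (by linarith [(hgap i).resolve_right hi])
    have h4 : w < min (m - c) (c - b) := lt_min (by linarith) (by linarith)
    rw [h1]
    nlinarith
  · intro y hy
    rw [← dotProduct_self_eq_zero, ← mulVec_dotProduct_self_of_orthonormal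
      (submatrix_columns_orthonormal hO hf), hy, dotProduct_zero]
  · intro y
    rw [hJ, form_diagonal]
    refine Finset.sum_nonneg fun i _ => ?_
    by_cases h0 : (Oᵀ *ᵥ (O.submatrix id f *ᵥ y)) i = 0
    · simp [h0]
    · obtain ⟨j, rfl⟩ := orthogonal_mulVec_columns hO f y h0
      simp only [hε, if_pos (Finset.mem_filter.mp (hfs j)).2, one_mul]
      exact mul_self_nonneg _

/-! ### Validity of the error bound, deterministically -/

theorem le_lam_of_le_form {n k : ℕ} {A : Matrix (Fin n) (Fin n) ℝ} {c : ℝ} (h1 : 1 ≤ k)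
    (hk : k ≤ n) (h : ∀ x, c * (x ⬝ᵥ x) ≤ x ⬝ᵥ A *ᵥ x) : c ≤ lam k A := by
  -- The inertia criterion needs strict positivity, so it is used with J = I at levels a < c.
  refine le_of_forall_lt_imp_le_of_dense fun a ha => ?_
  refine le_lam_of_form A 1 a h1 Matrix.transpose_one (fun x hx => ?_)
    ((1 : Matrix (Fin n) (Fin n) ℝ).submatrix id (Fin.castLE hk)) (fun y hy => ?_) fun y => ?_
  · rw [Matrix.one_mulVec, dotProduct_sub, dotProduct_smul, smul_eq_mul]
    have := dotProduct_self_pos hx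
    nlinarith [h x]
  · have ho := submatrix_columns_orthonormal (O := (1 : Matrix (Fin n) (Fin n) ℝ)) (by simp)
      (Fin.castLE_injective hk)
    rw [← dotProduct_self_eq_zero, ← mulVec_dotProduct_self_of_orthonormal ho, hy,
      dotProduct_zero]
  · rw [Matrix.one_mulVec]
    exact dotProduct_self_nonneg' _

/-- The bracket in `deltaOff`. -/
noncomputable def errorSum (B R dM dD : ℝ) : ℝ :=
  B ^ 3 * (2 - B * dD) / (1 - B * dD) ^ 2 * (R ^ 2 + dM) * dD + (B / (1 - B * dD)) ^ 2 * dM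

section Deterministic

variable {n : ℕ} {M S D D₀ D₁ : Matrix (Fin n) (Fin n) ℝ} {B R dM dD : ℝ}

theorem inv_sub_inv_eq {X Y : Matrix (Fin n) (Fin n) ℝ} (hX : IsUnit X) (hY : IsUnit Y) :
    X⁻¹ - Y⁻¹ = X⁻¹ * (Y - X) * Y⁻¹ := by
  rw [Matrix.mul_sub, Matrix.sub_mul, Matrix.mul_assoc,
    Matrix.mul_nonsing_inv _ ((Matrix.isUnit_iff_isUnit_det _).mp hY), Matrix.mul_one,
    Matrix.nonsing_inv_mul _ ((Matrix.isUnit_iff_isUnit_det _).mp hX), Matrix.one_mul]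

/-- From |Xz| ≥ |z|/B one gets |Yz| ≥ (1/B − dD)|z|. With X an empirical matrix, this deduces
invertibility of the mean from observable quantities. -/
theorem isUnit_of_norm_sub_le {X Y : Matrix (Fin n) (Fin n) ℝ} (hX : IsUnit X) (hB0 : 0 < B)
    (hB : ‖X⁻¹‖ ≤ B) (hXY : ‖X - Y‖ ≤ dD) (hx : B * dD < 1) :
    IsUnit Y ∧ ‖Y⁻¹‖ ≤ B / (1 - B * dD) := by
  have hd0 : 0 ≤ dD := (norm_nonneg _).trans hXY
  have hc : 0 < (1 - B * dD) / B := div_pos (by linarith) hB0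
  have key := isUnit_of_mulVec (A := Y) hc (by
    intro z
    have h0 := Real.sqrt_nonneg (Y *ᵥ z ⬝ᵥ Y *ᵥ z)
    have hz0 := Real.sqrt_nonneg (z ⬝ᵥ z)
    have tri : √(X *ᵥ z ⬝ᵥ X *ᵥ z) ≤ √(Y *ᵥ z ⬝ᵥ Y *ᵥ z) + dD * √(z ⬝ᵥ z) := by
      have h1 : X *ᵥ z = Y *ᵥ z + (X - Y) *ᵥ z := by
        rw [← Matrix.add_mulVec, add_sub_cancel]
      have h2 := mulVec_dotProduct_self_le (X - Y) z
      have h2' : √((X - Y) *ᵥ z ⬝ᵥ (X - Y) *ᵥ z) ≤ dD * √(z ⬝ᵥ z) := by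
        rw [Real.sqrt_le_left (by positivity), mul_pow, Real.sq_sqrt (dotProduct_self_nonneg' z)]
        refine h2.trans ?_
        have := dotProduct_self_nonneg' z
        gcongr
      refine le_trans ?_ (add_le_add_right h2' _)
      rw [h1, Real.sqrt_le_left (by positivity), add_sq,
        Real.sq_sqrt (dotProduct_self_nonneg' _), Real.sq_sqrt (dotProduct_self_nonneg' _),
        dotProduct_add, add_dotProduct, add_dotProduct, dotProduct_comm ((X - Y) *ᵥ z) (Y *ᵥ z)]
      have h3 := (le_abs_self _).trans (abs_dotProduct_le (Y *ᵥ z) ((X - Y) *ᵥ z))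
      linarith
    have hlow : √(z ⬝ᵥ z) ≤ B * √(X *ᵥ z ⬝ᵥ X *ᵥ z) := by
      rw [Real.sqrt_le_left (by positivity), mul_pow, Real.sq_sqrt (dotProduct_self_nonneg' _)]
      have h1 := mulVec_dotProduct_self_le X⁻¹ (X *ᵥ z)
      rw [Matrix.mulVec_mulVec, Matrix.nonsing_inv_mul _ ((Matrix.isUnit_iff_isUnit_det _).mp hX),
        Matrix.one_mulVec] at h1
      refine h1.trans ?_
      have := dotProduct_self_nonneg' (X *ᵥ z)
      gcongr
    have h1 : (1 - B * dD) / B * √(z ⬝ᵥ z) ≤ √(Y *ᵥ z ⬝ᵥ Y *ᵥ z) := by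
      rw [div_mul_eq_mul_div, div_le_iff₀ hB0]
      nlinarith
    have h2 := pow_le_pow_left₀ (by positivity) h1 2
    rwa [mul_pow, Real.sq_sqrt (dotProduct_self_nonneg' _),
      Real.sq_sqrt (dotProduct_self_nonneg' _)] at h2)
  rwa [one_div_div] at key

theorem norm_mul_mul_le (X Y Z : Matrix (Fin n) (Fin n) ℝ) {a b c : ℝ} (hX : ‖X‖ ≤ a)
    (hY : ‖Y‖ ≤ b) (hZ : ‖Z‖ ≤ c) : ‖X * Y * Z‖ ≤ a * b * c := by
  have ha := (norm_nonneg _).trans hX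
  have hb := (norm_nonneg _).trans hY
  calc ‖X * Y * Z‖ ≤ ‖X‖ * ‖Y‖ * ‖Z‖ :=
        (norm_mul_le _ _).trans (mul_le_mul_of_nonneg_right (norm_mul_le _ _) (norm_nonneg _))
    _ ≤ a * b * c := by gcongr

theorem norm_le_add_of_norm_sub_le (hD : ‖D‖ ≤ 1) (hS : ‖S‖ ≤ R ^ 2) (hM : ‖M - D * S * D‖ ≤ dM) :
    ‖M‖ ≤ R ^ 2 + dM := by
  have e : M = D * S * D + (M - D * S * D) := by abel
  rw [e]
  refine (norm_add_le _ _).trans (add_le_add ?_ hM)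
  simpa using norm_mul_mul_le D S D hD hS hD

theorem norm_corrected_sub_le (h0 : IsUnit D₀) (h1 : IsUnit D₁) (hB0 : 0 < B)
    (hB₀ : ‖D₀⁻¹‖ ≤ B) (hB₁ : ‖D₁⁻¹‖ ≤ B) (hD₀ : ‖D₀ - D‖ ≤ dD) (hD₁ : ‖D₁ - D‖ ≤ dD)
    (hx : B * dD < 1) (hD : ‖D‖ ≤ 1) (hS : ‖S‖ ≤ R ^ 2) (hM : ‖M - D * S * D‖ ≤ dM) :
    ‖D₀⁻¹ * M * D₁⁻¹ - S‖ ≤ errorSum B R dM dD := by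
  obtain ⟨hDu, hDinv⟩ := isUnit_of_norm_sub_le h0 hB0 hB₀ hD₀ hx
  have hd0 : 0 ≤ dD := (norm_nonneg _).trans hD₀
  have hMn := norm_le_add_of_norm_sub_le hD hS hM
  have hdet := (Matrix.isUnit_iff_isUnit_det _).mp hDu
  have hSe : S = D⁻¹ * (D * S * D) * D⁻¹ := by
    rw [← Matrix.mul_assoc, ← Matrix.mul_assoc, Matrix.nonsing_inv_mul _ hdet, Matrix.one_mul,
      Matrix.mul_assoc, Matrix.mul_nonsing_inv _ hdet, Matrix.mul_one]
  -- With q = B dD, the first two terms are bounded by B³(R² + dM) dD /(1 − q) times 1 and 1/(1 −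
  -- q). Their sum yields the numerator 2 − q of `errorSum`.
  have e : D₀⁻¹ * M * D₁⁻¹ - S = D₀⁻¹ * M * (D₁⁻¹ - D⁻¹) + (D₀⁻¹ - D⁻¹) * M * D⁻¹
      + D⁻¹ * (M - D * S * D) * D⁻¹ := by
    conv_lhs => rw [hSe]
    simp only [Matrix.mul_sub, Matrix.sub_mul]
    abel
  have hdiff : ∀ {X : Matrix (Fin n) (Fin n) ℝ}, IsUnit X → ‖X⁻¹‖ ≤ B → ‖X - D‖ ≤ dD →
      ‖X⁻¹ - D⁻¹‖ ≤ B * dD * (B / (1 - B * dD)) := by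
    intro X hX hXB hXD
    rw [inv_sub_inv_eq hX hDu]
    exact norm_mul_mul_le _ _ _ hXB (by rwa [norm_sub_rev]) hDinv
  have hx1 : 0 < 1 - B * dD := by linarith
  rw [e]
  refine (norm_add_le _ _).trans ((add_le_add ((norm_add_le _ _).trans (add_le_add
    (norm_mul_mul_le _ _ _ hB₀ hMn (hdiff h1 hB₁ hD₁))
    (norm_mul_mul_le _ _ _ (hdiff h0 hB₀ hD₀) hMn hDinv)))
    (norm_mul_mul_le _ _ _ hDinv hM hDinv)).trans (le_of_eq ?_))
  rw [errorSum]
  field_simp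
  ring

/-- The left side is the cost of replacing D₁⁻¹ by D₀⁻¹ plus the bound on the small eigenvalues of
D₀⁻¹MD₀⁻¹; both must fit into F when the gap of M is used. -/
theorem le_errorSum (hB1 : 1 ≤ B) (hd0 : 0 ≤ dD) (hdM : 0 ≤ dM) (hx : B * dD < 1) :
    2 * B ^ 3 * (R ^ 2 + dM) * dD + B ^ 2 * dM ≤ errorSum B R dM dD := by
  have hB0 : 0 < B := by linarith
  have hx1 : 0 < 1 - B * dD := by linarith
  have hxn : 0 ≤ B * dD := mul_nonneg hB0.le hd0
  have hF2 : B ^ 2 * dM ≤ (B / (1 - B * dD)) ^ 2 * dM := by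
    have : B ≤ B / (1 - B * dD) := by
      rw [le_div_iff₀ hx1]
      exact mul_le_of_le_one_right hB0.le (by linarith)
    gcongr
  have h2 : (2 : ℝ) ≤ (2 - B * dD) / (1 - B * dD) ^ 2 := by
    rw [le_div_iff₀ (by positivity)]
    nlinarith
  have hF1 : B ^ 3 * 2 * (R ^ 2 + dM) * dD
      ≤ B ^ 3 * (2 - B * dD) / (1 - B * dD) ^ 2 * (R ^ 2 + dM) * dD := by
    rw [mul_div_assoc]
    gcongr
  rw [errorSum]
  linarith

theorem form_conj (hDt : Dᵀ = D) (S : Matrix (Fin n) (Fin n) ℝ) (x : Fin n → ℝ) :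
    x ⬝ᵥ (D * S * D) *ᵥ x = D *ᵥ x ⬝ᵥ S *ᵥ (D *ᵥ x) := by
  rw [← Matrix.mulVec_mulVec, ← Matrix.mulVec_mulVec, dotProduct_mulVec_comm hDt]

theorem one_le_of_norm_inv_le (hn : 0 < n) (hD₀n : ‖D₀‖ ≤ 1) (h0 : IsUnit D₀) (hB₀ : ‖D₀⁻¹‖ ≤ B) :
    1 ≤ B := by
  have : Nonempty (Fin n) := ⟨⟨0, hn⟩⟩
  have h2 : (1 : ℝ) = ‖D₀ * D₀⁻¹‖ := by
    rw [Matrix.mul_nonsing_inv _ ((Matrix.isUnit_iff_isUnit_det _).mp h0), CStarRing.norm_one]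
  have h3 := norm_mul_le D₀ D₀⁻¹
  have h4 := norm_nonneg D₀⁻¹
  nlinarith

theorem neg_le_lam_of_norm_sub_le {k : ℕ} (h1 : 1 ≤ k) (hk : k ≤ n) (hDt : Dᵀ = D)
    (hSpos : ∀ x, 0 ≤ x ⬝ᵥ S *ᵥ x) (hM : ‖M - D * S * D‖ ≤ dM) : -dM ≤ lam k M := by
  refine le_lam_of_le_form h1 hk fun x => ?_
  have h2 := (abs_le.mp (abs_dotProduct_mulVec_le (M - D * S * D) (le_refl (x ⬝ᵥ x)))).1
  rw [Matrix.sub_mulVec, dotProduct_sub, form_conj hDt] at h2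
  have h4 := mul_le_mul_of_nonneg_right hM (dotProduct_self_nonneg' x)
  linarith [hSpos (D *ᵥ x)]

/-- The symmetric matrix D₀⁻¹MD₀⁻¹ has d eigenvalues at least λ_d(M), tested on D₀ times top
eigenvectors of M, because ‖D₀‖ ≤ 1. Its other eigenvalues are at most B² dM: if D D₀⁻¹x is
orthogonal to the range of U, then the form of DSD at D₀⁻¹x vanishes and only M − DSD contributes.
The possibly non-symmetric A is then within w of a matrix with a spectral gap. -/
theorem lam_sub_le_lam_corrected {d : ℕ} {U : Matrix (Fin n) (Fin d) ℝ} (hd : 1 ≤ d)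
    (hdn : d < n) (hMt : Mᵀ = M) (hDt : Dᵀ = D) (hD₀t : D₀ᵀ = D₀)
    (hD₀n : ‖D₀‖ ≤ 1) (h0 : IsUnit D₀) (hB₀ : ‖D₀⁻¹‖ ≤ B)
    (hSU : U * (Uᵀ * S) = S) (hM : ‖M - D * S * D‖ ≤ dM) (hlampos : 0 ≤ lam d M)
    {A : Matrix (Fin n) (Fin n) ℝ} {w : ℝ} (hAS : ‖A - D₀⁻¹ * M * D₀⁻¹‖ ≤ w)
    (hgap : B ^ 2 * dM + w < lam d M - w) : lam d M - w ≤ lam d A := by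
  have hdM : 0 ≤ dM := (norm_nonneg _).trans hM
  have hdet0 := (Matrix.isUnit_iff_isUnit_det _).mp h0
  obtain ⟨W, hW, hWform⟩ := exists_top_columns hMt hd hdn.le (le_refl (lam d M))
  have hinv0 : ∀ x, D₀⁻¹ *ᵥ (D₀ *ᵥ x) = x := fun x => by
    rw [Matrix.mulVec_mulVec, Matrix.nonsing_inv_mul _ hdet0, Matrix.one_mulVec]
  have hD₀it : (D₀⁻¹)ᵀ = D₀⁻¹ := by rw [Matrix.transpose_nonsing_inv, hD₀t]
  have hSt' : (D₀⁻¹ * M * D₀⁻¹)ᵀ = D₀⁻¹ * M * D₀⁻¹ := by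
    rw [Matrix.transpose_mul, Matrix.transpose_mul, hMt, hD₀it, Matrix.mul_assoc]
  have hinj : ∀ y, (D₀ * W) *ᵥ y = 0 → y = 0 := by
    intro y hy
    rw [← Matrix.mulVec_mulVec] at hy
    have h2 := hinv0 (W *ᵥ y)
    rw [hy, Matrix.mulVec_zero] at h2
    rw [← dotProduct_self_eq_zero, ← mulVec_dotProduct_self_of_orthonormal hW, ← h2,
      dotProduct_zero]
  have htop : ∀ y, lam d M * ((D₀ * W) *ᵥ y ⬝ᵥ (D₀ * W) *ᵥ y)
      ≤ (D₀ * W) *ᵥ y ⬝ᵥ (D₀⁻¹ * M * D₀⁻¹) *ᵥ ((D₀ * W) *ᵥ y) := by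
    intro y
    rw [form_conj hD₀it, ← Matrix.mulVec_mulVec, hinv0]
    refine le_trans ?_ (hWform y)
    refine mul_le_mul_of_nonneg_left ?_ hlampos
    refine (mulVec_dotProduct_self_le _ _).trans ?_
    rw [mulVec_dotProduct_self_of_orthonormal hW]
    exact mul_le_of_le_one_left (dotProduct_self_nonneg' y) (pow_le_one₀ (norm_nonneg _) hD₀n)
  have hbot : ∀ x, (D₀⁻¹ * D * U)ᵀ *ᵥ x = 0 →
      x ⬝ᵥ (D₀⁻¹ * M * D₀⁻¹) *ᵥ x ≤ B ^ 2 * dM * (x ⬝ᵥ x) := by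
    intro x hx
    rw [form_conj hD₀it]
    set u := D₀⁻¹ *ᵥ x with hu
    have hUDu : Uᵀ *ᵥ (D *ᵥ u) = 0 := by
      rw [← hx, Matrix.transpose_mul, Matrix.transpose_mul, hDt, hD₀it,
        ← Matrix.mulVec_mulVec, ← Matrix.mulVec_mulVec]
    have h2 := (abs_le.mp (abs_dotProduct_mulVec_le (M - D * S * D) (le_refl (u ⬝ᵥ u)))).2
    have h3 : u ⬝ᵥ (D * S * D) *ᵥ u = 0 := by
      rw [form_conj hDt, ← hSU, ← Matrix.mulVec_mulVec, Matrix.dotProduct_mulVec,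
        ← Matrix.mulVec_transpose, hUDu, zero_dotProduct]
    rw [Matrix.sub_mulVec, dotProduct_sub, h3, sub_zero] at h2
    have h4 := mulVec_dotProduct_self_le D₀⁻¹ x
    rw [← hu] at h4
    have h5 := dotProduct_self_nonneg' x
    have h6 := dotProduct_self_nonneg' u
    calc u ⬝ᵥ M *ᵥ u ≤ dM * (u ⬝ᵥ u) := h2.trans (by gcongr)
      _ ≤ dM * (B ^ 2 * (x ⬝ᵥ x)) := by
          gcongr
          exact h4.trans (by gcongr)
      _ = B ^ 2 * dM * (x ⬝ᵥ x) := by ring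
  -- A level c close to λ_d(M) − w may fall below the admissible window, so it is raised to a point
  -- a of the window.
  refine le_of_forall_lt_imp_le_of_dense fun c hc => ?_
  obtain ⟨a, ha1, ha2⟩ := exists_between hgap
  exact (le_max_left c a).trans (le_lam_of_gap hd A (D₀⁻¹ * M * D₀⁻¹) hSt' (D₀ * W)
    (D₀⁻¹ * D * U) hinj htop hbot hAS (lt_max_of_lt_right ha1) (max_lt hc ha2))

theorem norm_projection_sub_le_deltaOff {d : ℕ} {U : Matrix (Fin n) (Fin d) ℝ} (hd : 1 ≤ d)
    (hdn : d < n) (hMt : Mᵀ = M) (hDt : Dᵀ = D) (hD₀t : D₀ᵀ = D₀)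
    (hD₀n : ‖D₀‖ ≤ 1) (h0 : IsUnit D₀) (h1 : IsUnit D₁) (hB₀ : ‖D₀⁻¹‖ ≤ B) (hB₁ : ‖D₁⁻¹‖ ≤ B)
    (hD₀ : ‖D₀ - D‖ ≤ dD) (hD₁ : ‖D₁ - D‖ ≤ dD) (hx : B * dD < 1) (hD : ‖D‖ ≤ 1)
    (hS : ‖S‖ ≤ R ^ 2) (hSt : Sᵀ = S) (hSpos : ∀ x, 0 ≤ x ⬝ᵥ S *ᵥ x) (hU : Uᵀ * U = 1)
    (hSU : U * (Uᵀ * S) = S) (hM : ‖M - D * S * D‖ ≤ dM) {V : Matrix (Fin n) (Fin d) ℝ}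
    (hV : IsTopEigenbasis (D₀⁻¹ * M * D₁⁻¹) V) {g : ℝ}
    (hg : g = eigGap d M ∨ g = eigGap d (D₀⁻¹ * M * D₁⁻¹)) (hg0 : 0 < g) :
    ‖V * Vᵀ - U * Uᵀ‖ ≤ deltaOff d g B R dM dD := by
  have hd0 : 0 ≤ dD := (norm_nonneg _).trans hD₀
  have hdM : 0 ≤ dM := (norm_nonneg _).trans hM
  have hB1 := one_le_of_norm_inv_le (by omega) hD₀n h0 hB₀
  have hB0 : 0 < B := by linarith
  have hF := norm_corrected_sub_le (R := R) h0 h1 hB0 hB₀ hB₁ hD₀ hD₁ hx hD hS hM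
  set A := D₀⁻¹ * M * D₁⁻¹ with hA
  set F := errorSum B R dM dD with hFdef
  have hF0 : 0 ≤ F := (norm_nonneg _).trans hF
  have hroots : ∀ z ∈ ((Vᵀ * A * V).map (algebraMap ℝ ℂ)).charpoly.roots, lam d A ≤ z.re :=
    le_re_of_mem_roots fun x hx => lam_le_of_mem_take hdn.le x (by rwa [hV.2.2] at hx)
  have hΔ : deltaOff d g B R dM dD = 2 * √(2 * d) / g * F := rfl
  rw [hΔ]
  refine norm_projection_sub_le_of_gap (F := F) hd A S U V hU hV.1 hSt hSU hV.2.1 hroots hF hg0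
    fun hq => ?_
  -- Both cases give λ_d(A) ≥ g − F. The gap of M loses dM from a possibly negative λ_{d+1}(M) and w
  -- from passing to A; that of A loses only ‖A − S‖.
  rcases hg with hg | hg
  · have hlamM := neg_le_lam_of_norm_sub_le (k := d + 1) (by omega) hdn hDt hSpos hM
    have hm : g - dM ≤ lam d M := by
      rw [eigGap] at hg; linarith
    have hAS : ‖A - D₀⁻¹ * M * D₀⁻¹‖ ≤ B * (R ^ 2 + dM) * (B * (2 * dD) * B) := by
      rw [hA, ← Matrix.mul_sub, inv_sub_inv_eq h1 h0]
      refine norm_mul_mul_le _ _ _ hB₀ (norm_le_add_of_norm_sub_le hD hS hM)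
        (norm_mul_mul_le _ _ _ hB₁ ?_ hB₀)
      have h2 := norm_sub_le (D₀ - D) (D₁ - D)
      rw [sub_sub_sub_cancel_right] at h2
      linarith
    have hFle := le_errorSum (R := R) hB1 hd0 hdM hx
    rw [← hFdef] at hFle
    have hF2 : dM ≤ B ^ 2 * dM := le_mul_of_one_le_left hdM (one_le_pow₀ hB1)
    have hw0 : 0 ≤ 2 * B ^ 3 * (R ^ 2 + dM) * dD := by positivity
    have hw : B * (R ^ 2 + dM) * (B * (2 * dD) * B) = 2 * B ^ 3 * (R ^ 2 + dM) * dD := by ring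
    rw [hw] at hAS
    have h2F : 2 * F < g := by
      refine lt_of_le_of_lt (mul_le_mul_of_nonneg_right ?_ hF0) hq
      have h2 : (1 : ℝ) ≤ √(2 * d) := by
        rw [Real.one_le_sqrt]
        have : (1 : ℝ) ≤ d := by exact_mod_cast hd
        linarith
      linarith
    have := lam_sub_le_lam_corrected hd hdn hMt hDt hD₀t hD₀n h0 hB₀ hSU hM (by linarith) hAS
      (by linarith)
    linarith
  · have h2 := neg_norm_le_lam_succ hdn A S V hV hSpos
    rw [eigGap] at hg
    linarith

end Deterministic

/-! ### The two halves of a trajectory -/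

/-- The context-action pairs and noises of a half of a trajectory of `2 * L` steps. -/
abbrev Half (X A : Type*) (L : ℕ) : Type _ := (Fin L → X × A) × (Fin L → ℝ)

section Halves

variable {X A : Type*} [MeasurableSpace X] [MeasurableSpace A] {dA dK L : ℕ}

/-- The law of the context-action pairs and noises of a half. -/
noncomputable def halfLaw (𝔅 : Bandit X A dA dK) (𝔇 : Design X A L) : Measure (Half X A L) :=
  (Measure.pi fun j => 𝔇.contextLaw (step 0 j) ⊗ₘ 𝔇.policy).prod
    (Measure.pi fun _ => 𝔅.noiseLaw)

instance (𝔅 : Bandit X A dA dK) (𝔇 : Design X A L) : IsProbabilityMeasure (halfLaw 𝔅 𝔇) := by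
  unfold halfLaw; infer_instance

instance (𝔅 : Bandit X A dA dK) (𝔇 : Design X A L) : IsProbabilityMeasure (trajLaw 𝔅 𝔇) := by
  unfold trajLaw; infer_instance

/-- The latent state and the two halves of a trajectory. -/
def splitTraj (τ : Traj X A dK L) :
    EuclideanSpace ℝ (Fin dK) × Half X A L × Half X A L :=
  (τ.1, (fun j => τ.2.1 (step 0 j), fun j => τ.2.2 (step 0 j)),
    (fun j => τ.2.1 (step 1 j), fun j => τ.2.2 (step 1 j)))

/-- The steps of a trajectory, sorted into its two halves. -/
noncomputable def stepEquiv (L : ℕ) : Fin L ⊕ Fin L ≃ Fin (2 * L) :=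
  Equiv.ofBijective (Sum.elim (step 0) (step 1)) (by
    constructor
    · rintro (a | a) (b | b) h <;> simp [step, Fin.ext_iff] at h ⊢ <;> omega
    · intro k
      rcases Nat.mod_two_eq_zero_or_one k with h | h
      · exact ⟨Sum.inl ⟨k / 2, by omega⟩, by simp [step, Fin.ext_iff]; omega⟩
      · exact ⟨Sum.inr ⟨k / 2, by omega⟩, by simp [step, Fin.ext_iff]; omega⟩)

theorem measurePreserving_split_steps {Z : Type*} [MeasurableSpace Z]
    (ρ : Fin (2 * L) → Measure Z) [∀ h, IsProbabilityMeasure (ρ h)] :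
    MeasurePreserving (fun w : Fin (2 * L) → Z => (fun j => w (step 0 j), fun j => w (step 1 j)))
      (Measure.pi ρ)
      ((Measure.pi fun j : Fin L => ρ (step 0 j)).prod
        (Measure.pi fun j : Fin L => ρ (step 1 j))) := by
  have h1 := (measurePreserving_piCongrLeft (α := fun _ => Z) ρ (stepEquiv L)).symm
  have h2 := measurePreserving_sumPiEquivProdPi (X := fun _ : Fin L ⊕ Fin L => Z)
    (fun s => ρ (stepEquiv L s))
  exact h2.comp h1

/-- Turns conditional independence of the halves given θ into a product measure. Pairing each action
step with its noise allows a split by parity; the matching context laws make the two factors equal.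
-/
theorem measurePreserving_splitTraj (𝔅 : Bandit X A dA dK) (𝔇 : Design X A L) :
    MeasurePreserving splitTraj (trajLaw 𝔅 𝔇)
      (𝔅.latentLaw.prod ((halfLaw 𝔅 𝔇).prod (halfLaw 𝔅 𝔇))) := by
  set ρ : Fin (2 * L) → Measure ((X × A) × ℝ) := fun h =>
    (𝔇.contextLaw h ⊗ₘ 𝔇.policy).prod 𝔅.noiseLaw with hρ
  have h1 := (measurePreserving_arrowProdEquivProdArrow (X × A) ℝ (Fin (2 * L))
    (fun h => 𝔇.contextLaw h ⊗ₘ 𝔇.policy) (fun _ => 𝔅.noiseLaw)).symm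
  have h2 := measurePreserving_split_steps ρ
  have h3 : ∀ i : Fin 2, (Measure.pi fun j : Fin L => ρ (step i j))
      = Measure.pi fun j : Fin L => ρ (step 0 j) := by
    intro i
    congr 1
    funext j
    fin_cases i
    · rfl
    · simp only [hρ, Fin.mk_one, ← 𝔇.halves j]
  rw [h3 1] at h2
  have h4 := measurePreserving_arrowProdEquivProdArrow (X × A) ℝ (Fin L)
    (fun j => 𝔇.contextLaw (step 0 j) ⊗ₘ 𝔇.policy) (fun _ => 𝔅.noiseLaw)
  have h5 : MeasurePreserving
      (fun p : (Fin (2 * L) → X × A) × (Fin (2 * L) → ℝ) =>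
        (((fun j => p.1 (step 0 j), fun j => p.2 (step 0 j)),
          (fun j => p.1 (step 1 j), fun j => p.2 (step 1 j))) : Half X A L × Half X A L))
      ((Measure.pi fun h => 𝔇.contextLaw h ⊗ₘ 𝔇.policy).prod (Measure.pi fun _ => 𝔅.noiseLaw))
      ((halfLaw 𝔅 𝔇).prod (halfLaw 𝔅 𝔇)) :=
    (h4.prod h4).comp (h2.comp h1)
  exact (MeasurePreserving.id 𝔅.latentLaw).prod h5

/-! ### The statistics of a half -/

/-- The feature vector at step `j` of a half. -/
def featH (𝔅 : Bandit X A dA dK) (w : Half X A L) (j : Fin L) : Fin dA → ℝ :=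
  WithLp.ofLp (𝔅.feature (w.1 j))

/-- The unregularized design matrix of a half. -/
def gramH (𝔅 : Bandit X A dA dK) (w : Half X A L) : Matrix (Fin dA) (Fin dA) ℝ :=
  ∑ j : Fin L, Matrix.vecMulVec (featH 𝔅 w j) (featH 𝔅 w j)

/-- The regularized design matrix of a half. -/
def designH (𝔅 : Bandit X A dA dK) (μ : ℝ) (w : Half X A L) : Matrix (Fin dA) (Fin dA) ℝ :=
  μ • 1 + gramH 𝔅 w

/-- The correction matrix of a half. -/
noncomputable def corrH (𝔅 : Bandit X A dA dK) (μ : ℝ) (w : Half X A L) :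
    Matrix (Fin dA) (Fin dA) ℝ :=
  1 - μ • (designH 𝔅 μ w)⁻¹

/-- The reward parameter, as a plain vector. -/
noncomputable def betaVec (𝔅 : Bandit X A dA dK) (θ : EuclideanSpace ℝ (Fin dK)) : Fin dA → ℝ :=
  𝔅.Ustar *ᵥ WithLp.ofLp θ

/-- The ridge estimate computed from a half. -/
noncomputable def ridgeH (𝔅 : Bandit X A dA dK) (μ : ℝ) (θ : EuclideanSpace ℝ (Fin dK))
    (w : Half X A L) : Fin dA → ℝ :=
  (designH 𝔅 μ w)⁻¹ *ᵥ
    ∑ j : Fin L, (featH 𝔅 w j ⬝ᵥ betaVec 𝔅 θ + w.2 j) • featH 𝔅 w j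

theorem reward_eq (𝔅 : Bandit X A dA dK) (τ : Traj X A dK L) (h : Fin (2 * L)) :
    reward 𝔅 τ h = feat 𝔅 τ h ⬝ᵥ betaVec 𝔅 τ.1 + τ.2.2 h := by
  rw [reward, EuclideanSpace.inner_eq_star_dotProduct, star_trivial, dotProduct_comm]
  rfl

theorem betaHat_zero (𝔅 : Bandit X A dA dK) (μ : ℝ) (τ : Traj X A dK L) :
    betaHat 𝔅 μ 0 τ = ridgeH 𝔅 μ τ.1 (splitTraj τ).2.1 := by
  simp only [betaHat, reward_eq]
  rfl

theorem betaHat_one (𝔅 : Bandit X A dA dK) (μ : ℝ) (τ : Traj X A dK L) :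
    betaHat 𝔅 μ 1 τ = ridgeH 𝔅 μ τ.1 (splitTraj τ).2.2 := by
  simp only [betaHat, reward_eq]
  rfl

/-! ### Pathwise algebra of the ridge estimate -/

section Deterministic

variable (𝔅 : Bandit X A dA dK) {μ : ℝ} (w : Half X A L)

theorem gramH_transpose : (gramH 𝔅 w)ᵀ = gramH 𝔅 w := by
  simp [gramH, Matrix.transpose_sum, Matrix.transpose_vecMulVec]

theorem designH_transpose : (designH 𝔅 μ w)ᵀ = designH 𝔅 μ w := by
  rw [designH, Matrix.transpose_add, gramH_transpose, Matrix.transpose_smul, Matrix.transpose_one]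

theorem gramH_mulVec (x : Fin dA → ℝ) :
    gramH 𝔅 w *ᵥ x = ∑ j, (featH 𝔅 w j ⬝ᵥ x) • featH 𝔅 w j := by
  rw [gramH, Matrix.sum_mulVec]
  refine Finset.sum_congr rfl fun j _ => ?_
  rw [Matrix.vecMulVec_mulVec]
  ext i
  simp [mul_comm]

theorem form_gramH (x : Fin dA → ℝ) :
    x ⬝ᵥ gramH 𝔅 w *ᵥ x = ∑ j, (featH 𝔅 w j ⬝ᵥ x) ^ 2 := by
  rw [gramH_mulVec, dotProduct_sum]
  refine Finset.sum_congr rfl fun j _ => ?_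
  rw [dotProduct_smul, smul_eq_mul, dotProduct_comm x, sq]

theorem form_gramH_nonneg (x : Fin dA → ℝ) : 0 ≤ x ⬝ᵥ gramH 𝔅 w *ᵥ x := by
  rw [form_gramH]; positivity

theorem designH_mulVec (x : Fin dA → ℝ) : designH 𝔅 μ w *ᵥ x = μ • x + gramH 𝔅 w *ᵥ x := by
  rw [designH, Matrix.add_mulVec, Matrix.smul_mulVec, Matrix.one_mulVec]

theorem isUnit_designH (hμ : 0 < μ) : IsUnit (designH 𝔅 μ w) := by
  refine (isUnit_of_form hμ fun x => ?_).1
  rw [designH_mulVec, dotProduct_add, dotProduct_smul, smul_eq_mul]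
  linarith [form_gramH_nonneg 𝔅 w x]

theorem designH_inv_transpose : ((designH 𝔅 μ w)⁻¹)ᵀ = (designH 𝔅 μ w)⁻¹ := by
  rw [Matrix.transpose_nonsing_inv, designH_transpose]

theorem corrH_transpose : (corrH 𝔅 μ w)ᵀ = corrH 𝔅 μ w := by
  rw [corrH, Matrix.transpose_sub, Matrix.transpose_smul, designH_inv_transpose,
    Matrix.transpose_one]

theorem designH_mulVec_inv (hμ : 0 < μ) (x : Fin dA → ℝ) :
    μ • ((designH 𝔅 μ w)⁻¹ *ᵥ x) + gramH 𝔅 w *ᵥ ((designH 𝔅 μ w)⁻¹ *ᵥ x) = x := by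
  rw [← designH_mulVec, Matrix.mulVec_mulVec,
    Matrix.mul_nonsing_inv _ ((Matrix.isUnit_iff_isUnit_det _).mp (isUnit_designH 𝔅 w hμ)),
    Matrix.one_mulVec]

theorem corrH_mulVec (x : Fin dA → ℝ) :
    corrH 𝔅 μ w *ᵥ x = x - μ • ((designH 𝔅 μ w)⁻¹ *ᵥ x) := by
  rw [corrH, Matrix.sub_mulVec, Matrix.one_mulVec, Matrix.smul_mulVec]

/-- Let G be the Gram matrix and y = (μ + G)⁻¹x. Then x = μy + Gy and the correction matrix sends x
to Gy, so its form is μ y·Gy + |Gy|², and also |x|² − μ x·y with x·y ≥ 0. -/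
theorem form_corrH_aux (hμ : 0 < μ) (x : Fin dA → ℝ) :
    μ * ((designH 𝔅 μ w)⁻¹ *ᵥ x ⬝ᵥ gramH 𝔅 w *ᵥ ((designH 𝔅 μ w)⁻¹ *ᵥ x))
      ≤ x ⬝ᵥ corrH 𝔅 μ w *ᵥ x ∧ x ⬝ᵥ corrH 𝔅 μ w *ᵥ x ≤ x ⬝ᵥ x := by
  rw [corrH_mulVec]
  have hx := designH_mulVec_inv 𝔅 w hμ x
  set y := (designH 𝔅 μ w)⁻¹ *ᵥ x with hy
  have h1 := form_gramH_nonneg 𝔅 w y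
  have h2 := dotProduct_self_nonneg' (gramH 𝔅 w *ᵥ y)
  have h3 := dotProduct_self_nonneg' y
  have h4 : x - μ • y = gramH 𝔅 w *ᵥ y := by
    rw [sub_eq_iff_eq_add, add_comm]
    exact hx.symm
  have h5 : x ⬝ᵥ gramH 𝔅 w *ᵥ y
      = μ * (y ⬝ᵥ gramH 𝔅 w *ᵥ y) + gramH 𝔅 w *ᵥ y ⬝ᵥ gramH 𝔅 w *ᵥ y := by
    conv_lhs => rw [← hx]
    rw [add_dotProduct, smul_dotProduct, smul_eq_mul]
  refine ⟨by rw [h4, h5]; linarith, ?_⟩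
  have h6 : x ⬝ᵥ y = μ * (y ⬝ᵥ y) + y ⬝ᵥ gramH 𝔅 w *ᵥ y := by
    conv_lhs => rw [← hx]
    rw [add_dotProduct, smul_dotProduct, smul_eq_mul, dotProduct_comm (gramH 𝔅 w *ᵥ y)]
  rw [dotProduct_sub, dotProduct_smul, smul_eq_mul, h6]
  have : 0 ≤ μ * (μ * (y ⬝ᵥ y) + y ⬝ᵥ gramH 𝔅 w *ᵥ y) := by positivity
  linarith

theorem form_corrH_nonneg (hμ : 0 < μ) (x : Fin dA → ℝ) : 0 ≤ x ⬝ᵥ corrH 𝔅 μ w *ᵥ x :=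
  (mul_nonneg hμ.le (form_gramH_nonneg 𝔅 w _)).trans (form_corrH_aux 𝔅 w hμ x).1

theorem norm_corrH_le (hμ : 0 < μ) : ‖corrH 𝔅 μ w‖ ≤ 1 :=
  norm_le_of_form (corrH_transpose 𝔅 w) zero_le_one (form_corrH_nonneg 𝔅 w hμ) fun x => by
    rw [one_mul]; exact (form_corrH_aux 𝔅 w hμ x).2

/-- The coefficient of the noise at step `j` in the ridge estimate in direction `x`. -/
noncomputable def noiseCoef (𝔅 : Bandit X A dA dK) (μ : ℝ) (w : Half X A L) (x : Fin dA → ℝ)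
    (j : Fin L) : ℝ :=
  featH 𝔅 w j ⬝ᵥ (designH 𝔅 μ w)⁻¹ *ᵥ x

/-- The sum equals y·Gy at y = (μ + G)⁻¹x. That it does not grow with the number of steps is what
keeps H out of the leading term of the rate. -/
theorem sum_sq_noiseCoef_le (hμ : 0 < μ) (x : Fin dA → ℝ) :
    ∑ j, noiseCoef 𝔅 μ w x j ^ 2 ≤ (x ⬝ᵥ x) / μ := by
  have h := form_corrH_aux 𝔅 w hμ x
  rw [form_gramH] at h
  rw [le_div_iff₀ hμ]
  simp only [noiseCoef]
  linarith [h.1, h.2]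

/-- Bias and noise: (μ + G)⁻¹G is the correction matrix, so the estimate is that matrix applied to β
plus a linear function of the noises. -/
theorem dotProduct_ridgeH (hμ : 0 < μ) (θ : EuclideanSpace ℝ (Fin dK)) (x : Fin dA → ℝ) :
    x ⬝ᵥ ridgeH 𝔅 μ θ w
      = x ⬝ᵥ corrH 𝔅 μ w *ᵥ betaVec 𝔅 θ + ∑ j, w.2 j * noiseCoef 𝔅 μ w x j := by
  rw [ridgeH, dotProduct_mulVec_comm (designH_inv_transpose 𝔅 w)]
  simp only [add_smul, Finset.sum_add_distrib, dotProduct_add]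
  congr 1
  · rw [← gramH_mulVec, dotProduct_mulVec_comm (corrH_transpose 𝔅 w), corrH_mulVec,
      dotProduct_mulVec_comm (gramH_transpose 𝔅 w)]
    congr 1
    rw [eq_sub_iff_add_eq, add_comm]
    exact designH_mulVec_inv 𝔅 w hμ x
  · rw [dotProduct_sum]
    refine Finset.sum_congr rfl fun j _ => ?_
    rw [dotProduct_smul, smul_eq_mul, noiseCoef, dotProduct_comm]

theorem sq_dotProduct_corrH_le (hμ : 0 < μ) {R : ℝ} (b : Fin dA → ℝ) (hb : b ⬝ᵥ b ≤ R ^ 2)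
    (x : Fin dA → ℝ) : (x ⬝ᵥ corrH 𝔅 μ w *ᵥ b) ^ 2 ≤ R ^ 2 * (x ⬝ᵥ x) := by
  have h1 := abs_dotProduct_le x (corrH 𝔅 μ w *ᵥ b)
  have h2 : corrH 𝔅 μ w *ᵥ b ⬝ᵥ corrH 𝔅 μ w *ᵥ b ≤ R ^ 2 := by
    refine (mulVec_dotProduct_self_le _ _).trans (le_trans ?_ hb)
    exact mul_le_of_le_one_left (dotProduct_self_nonneg' b)
      (pow_le_one₀ (norm_nonneg _) (norm_corrH_le 𝔅 w hμ))
  rw [← sq_abs]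
  refine (pow_le_pow_left₀ (abs_nonneg _) h1 2).trans ?_
  have h3 := dotProduct_self_nonneg' x
  rw [mul_pow, Real.sq_sqrt h3, Real.sq_sqrt (dotProduct_self_nonneg' _), mul_comm]
  gcongr

/-- A crude pathwise bound growing with L. It serves integrability and the sample size threshold,
never the final constant. -/
theorem sq_dotProduct_ridgeH_le (hμ : 0 < μ) {R : ℝ} (θ : EuclideanSpace ℝ (Fin dK))
    (hb : betaVec 𝔅 θ ⬝ᵥ betaVec 𝔅 θ ≤ R ^ 2) (hw : ∀ j, |w.2 j| ≤ 2 * R) (x : Fin dA → ℝ) :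
    (x ⬝ᵥ ridgeH 𝔅 μ θ w) ^ 2 ≤ 2 * (R ^ 2 + 4 * R ^ 2 * L / μ) * (x ⬝ᵥ x) := by
  rw [dotProduct_ridgeH 𝔅 w hμ]
  have h1 := sq_dotProduct_corrH_le 𝔅 w hμ _ hb x
  have h2 := Finset.sum_mul_sq_le_sq_mul_sq Finset.univ (fun j => w.2 j)
    (fun j => noiseCoef 𝔅 μ w x j)
  have h3 : ∑ j, w.2 j ^ 2 ≤ L * (4 * R ^ 2) := by
    have : ∀ j ∈ Finset.univ, w.2 j ^ 2 ≤ 4 * R ^ 2 := fun j _ => by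
      rw [← sq_abs]
      refine (pow_le_pow_left₀ (abs_nonneg _) (hw j) 2).trans (le_of_eq (by ring))
    simpa using Finset.sum_le_sum this
  have h4 := sum_sq_noiseCoef_le 𝔅 w hμ x
  have h5 : (∑ j, w.2 j * noiseCoef 𝔅 μ w x j) ^ 2 ≤ L * (4 * R ^ 2) * ((x ⬝ᵥ x) / μ) :=
    h2.trans (mul_le_mul h3 h4 (by positivity) (by positivity))
  have h6 : L * (4 * R ^ 2) * ((x ⬝ᵥ x) / μ) = 4 * R ^ 2 * L / μ * (x ⬝ᵥ x) := by ring
  rw [h6] at h5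
  set a := x ⬝ᵥ corrH 𝔅 μ w *ᵥ betaVec 𝔅 θ
  set b := ∑ j, w.2 j * noiseCoef 𝔅 μ w x j
  nlinarith [sq_nonneg (a - b)]

end Deterministic

/-! ### Measurability -/

/-- Adjugate over determinant; with the conventions at determinant zero the formula needs no
invertibility. -/
theorem measurable_inv_entry {Ω : Type*} [MeasurableSpace Ω] {n : ℕ}
    {F : Ω → Matrix (Fin n) (Fin n) ℝ} (hF : ∀ i j, Measurable fun ω => F ω i j) (i j : Fin n) :
    Measurable fun ω => (F ω)⁻¹ i j := by
  have hF' : Measurable fun ω => fun i j => F ω i j :=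
    measurable_pi_lambda _ fun i => measurable_pi_lambda _ fun j => hF i j
  have hc : Continuous fun G : Fin n → Fin n → ℝ => Matrix.of G := continuous_id
  have h1 : Measurable fun G : Fin n → Fin n → ℝ => (Matrix.of G).det :=
    hc.matrix_det.measurable
  have h2 : Measurable fun G : Fin n → Fin n → ℝ => (Matrix.of G).adjugate i j :=
    (hc.matrix_adjugate.matrix_elem i j).measurable
  have h3 : ∀ ω, (F ω)⁻¹ i j = ((F ω).det)⁻¹ * (F ω).adjugate i j := by
    intro ω
    rw [Matrix.inv_def, Matrix.smul_apply, Ring.inverse_eq_inv', smul_eq_mul]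
  simp only [h3]
  exact (h1.comp hF').inv.mul (h2.comp hF')

theorem measurable_featH (𝔅 : Bandit X A dA dK) (j : Fin L) (i : Fin dA) :
    Measurable fun w : Half X A L => featH 𝔅 w j i := by
  have h1 : Measurable fun w : Half X A L => 𝔅.feature (w.1 j) :=
    𝔅.measurable_feature.comp ((measurable_pi_apply j).comp measurable_fst)
  have h2 : Measurable fun v : EuclideanSpace ℝ (Fin dA) => v i := by fun_prop
  exact h2.comp h1

theorem measurable_designH (𝔅 : Bandit X A dA dK) (μ : ℝ) (i k : Fin dA) :
    Measurable fun w : Half X A L => designH 𝔅 μ w i k := by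
  simp only [designH, gramH, Matrix.add_apply, Matrix.sum_apply, Matrix.vecMulVec_apply]
  exact measurable_const.add (Finset.measurable_fun_sum _ fun j _ =>
    (measurable_featH 𝔅 j i).mul (measurable_featH 𝔅 j k))

theorem measurable_corrH (𝔅 : Bandit X A dA dK) (μ : ℝ) (i k : Fin dA) :
    Measurable fun w : Half X A L => corrH 𝔅 μ w i k := by
  simp only [corrH, Matrix.sub_apply, Matrix.smul_apply]
  exact measurable_const.sub ((measurable_inv_entry (measurable_designH 𝔅 μ) i k).const_smul μ)

theorem measurable_betaVec (𝔅 : Bandit X A dA dK) (i : Fin dA) :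
    Measurable fun θ => betaVec 𝔅 θ i := by
  simp only [betaVec, Matrix.mulVec, dotProduct]
  fun_prop

theorem measurable_ridgeH (𝔅 : Bandit X A dA dK) (μ : ℝ) (i : Fin dA) :
    Measurable fun p : EuclideanSpace ℝ (Fin dK) × Half X A L => ridgeH 𝔅 μ p.1 p.2 i := by
  simp only [ridgeH, Matrix.mulVec, dotProduct, Finset.sum_apply, Pi.smul_apply, smul_eq_mul]
  refine Finset.measurable_fun_sum _ fun k _ => Measurable.mul ?_ ?_
  · exact (measurable_inv_entry (measurable_designH 𝔅 μ) i k).comp measurable_snd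
  · refine Finset.measurable_fun_sum _ fun j _ => Measurable.mul (Measurable.add ?_ ?_) ?_
    · refine Finset.measurable_fun_sum _ fun l _ => Measurable.mul ?_ ?_
      · exact (measurable_featH 𝔅 j l).comp measurable_snd
      · exact (measurable_betaVec 𝔅 l).comp measurable_fst
    · exact (measurable_pi_apply j).comp (measurable_snd.comp measurable_snd)
    · exact (measurable_featH 𝔅 j k).comp measurable_snd

end Halves

section Moments

variable {X A : Type*} [MeasurableSpace X] [MeasurableSpace A] {dA dK L : ℕ}
  {𝔅 : Bandit X A dA dK} {𝔇 : Design X A L} {μ R : ℝ}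

/-! ### Almost sure bounds -/

theorem Bounded.betaVec_le (h : Bounded 𝔅 𝔇 R) :
    ∀ᵐ θ ∂𝔅.latentLaw, betaVec 𝔅 θ ⬝ᵥ betaVec 𝔅 θ ≤ R ^ 2 := by
  filter_upwards [h.beta_le] with θ hθ
  rw [dotProduct_self_eq_norm_sq]
  exact pow_le_pow_left₀ (norm_nonneg _) hθ 2

/-- The noise is the reward minus ⟨φ, β⟩, and both are at most R in absolute value. A step must
exist for rewards to say anything about the noise. -/
theorem Bounded.noise_le (h : Bounded 𝔅 𝔇 R) (hL : 0 < L) :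
    ∀ᵐ e ∂𝔅.noiseLaw, |e| ≤ 2 * R := by
  have hmp : MeasurePreserving (fun τ : Traj X A dK L => τ.2.2 ⟨0, by omega⟩)
      (trajLaw 𝔅 𝔇) 𝔅.noiseLaw :=
    (measurePreserving_eval (fun _ : Fin (2 * L) => 𝔅.noiseLaw) ⟨0, by omega⟩).comp
      ((measurePreserving_snd (μ := Measure.pi fun h => 𝔇.contextLaw h ⊗ₘ 𝔇.policy)).comp
        (measurePreserving_snd (μ := 𝔅.latentLaw)))
  have hβ : ∀ᵐ τ ∂(trajLaw 𝔅 𝔇), ‖beta 𝔅 τ.1‖ ≤ R :=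
    Measure.quasiMeasurePreserving_fst.ae h.beta_le
  rw [← hmp.map_eq, ae_map_iff hmp.measurable.aemeasurable
    (measurableSet_le (by fun_prop) (by fun_prop))]
  filter_upwards [h.reward_le, hβ] with τ h1 h2
  have h3 := h1 ⟨0, by omega⟩
  have h4 := abs_real_inner_le_norm (𝔅.feature (τ.2.1 ⟨0, by omega⟩)) (beta 𝔅 τ.1)
  have h5 := h.feature_le (τ.2.1 ⟨0, by omega⟩)
  have h6 : ‖𝔅.feature (τ.2.1 ⟨0, by omega⟩)‖ * ‖beta 𝔅 τ.1‖ ≤ 1 * R := by gcongr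
  rw [reward] at h3
  rw [abs_le] at *
  constructor <;> linarith

theorem ae_half_noise_le (hn : ∀ᵐ e ∂𝔅.noiseLaw, |e| ≤ 2 * R) :
    ∀ᵐ w ∂(halfLaw 𝔅 𝔇), ∀ j, |w.2 j| ≤ 2 * R := by
  have h : ∀ᵐ e ∂(Measure.pi fun _ : Fin L => 𝔅.noiseLaw), ∀ j, |e j| ≤ 2 * R :=
    ae_all_iff.mpr fun j =>
      (Measure.quasiMeasurePreserving_eval (fun _ : Fin L => 𝔅.noiseLaw) j).ae hn
  exact Measure.quasiMeasurePreserving_snd.ae h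

/-- The joint law of the latent state and of the two halves of a trajectory. -/
noncomputable def splitLaw (𝔅 : Bandit X A dA dK) (𝔇 : Design X A L) :
    Measure (EuclideanSpace ℝ (Fin dK) × Half X A L × Half X A L) :=
  𝔅.latentLaw.prod ((halfLaw 𝔅 𝔇).prod (halfLaw 𝔅 𝔇))

instance : IsProbabilityMeasure (splitLaw 𝔅 𝔇) := by
  unfold splitLaw; infer_instance

theorem ae_splitLaw (hβ : ∀ᵐ θ ∂𝔅.latentLaw, betaVec 𝔅 θ ⬝ᵥ betaVec 𝔅 θ ≤ R ^ 2)
    (hn : ∀ᵐ e ∂𝔅.noiseLaw, |e| ≤ 2 * R) :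
    ∀ᵐ p ∂(splitLaw 𝔅 𝔇), betaVec 𝔅 p.1 ⬝ᵥ betaVec 𝔅 p.1 ≤ R ^ 2 ∧
      (∀ j, |p.2.1.2 j| ≤ 2 * R) ∧ ∀ j, |p.2.2.2 j| ≤ 2 * R := by
  have h1 := ae_half_noise_le (𝔇 := 𝔇) hn
  have h2 : ∀ᵐ p ∂(splitLaw 𝔅 𝔇), betaVec 𝔅 p.1 ⬝ᵥ betaVec 𝔅 p.1 ≤ R ^ 2 :=
    Measure.quasiMeasurePreserving_fst.ae hβ
  have h3 : ∀ᵐ p ∂(splitLaw 𝔅 𝔇), ∀ j, |p.2.1.2 j| ≤ 2 * R :=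
    Measure.quasiMeasurePreserving_snd.ae (Measure.quasiMeasurePreserving_fst.ae h1)
  have h4 : ∀ᵐ p ∂(splitLaw 𝔅 𝔇), ∀ j, |p.2.2.2 j| ≤ 2 * R :=
    Measure.quasiMeasurePreserving_snd.ae (Measure.quasiMeasurePreserving_snd.ae h1)
  filter_upwards [h2, h3, h4] with p a b c using ⟨a, b, c⟩

theorem integral_splitTraj {f : EuclideanSpace ℝ (Fin dK) × Half X A L × Half X A L → ℝ}
    (hf : Measurable f) :
    ∫ τ, f (splitTraj τ) ∂(trajLaw 𝔅 𝔇) = ∫ p, f p ∂(splitLaw 𝔅 𝔇) := by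
  have h := measurePreserving_splitTraj 𝔅 𝔇
  rw [splitLaw, ← h.map_eq, integral_map h.measurable.aemeasurable hf.aestronglyMeasurable]

/-! ### Moments of the noise -/

theorem noise_memLp (𝔅 : Bandit X A dA dK) : MemLp (fun e : ℝ => e) 2 𝔅.noiseLaw := by
  obtain ⟨c, hc⟩ := 𝔅.noise_subgaussian
  exact_mod_cast hc.memLp 2

theorem noise_sum_memLp (𝔅 : Bandit X A dA dK) (c : Fin L → ℝ) :
    MemLp (fun e : Fin L → ℝ => ∑ j, e j * c j) 2 (Measure.pi fun _ => 𝔅.noiseLaw) := by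
  refine memLp_finsetSum _ fun j _ => ?_
  have h1 := (noise_memLp 𝔅).comp_measurePreserving
    (measurePreserving_eval (fun _ : Fin L => 𝔅.noiseLaw) j)
  exact h1.mul_const (c j)

theorem integral_noise_sum (𝔅 : Bandit X A dA dK) (c : Fin L → ℝ) :
    ∫ e : Fin L → ℝ, ∑ j, e j * c j ∂(Measure.pi fun _ => 𝔅.noiseLaw) = 0 := by
  rw [integral_finsetSum]
  · refine Finset.sum_eq_zero fun j _ => ?_
    rw [integral_mul_const, integral_comp_eval (μ := fun _ : Fin L => 𝔅.noiseLaw)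
      (f := fun e : ℝ => e) (by fun_prop), 𝔅.noise_centered, zero_mul]
  · intro j _
    exact (((noise_memLp 𝔅).comp_measurePreserving
      (measurePreserving_eval (fun _ : Fin L => 𝔅.noiseLaw) j)).integrable one_le_two).mul_const _

/-- The cross term is centered, the noises are independent, and a variable with values in [−2R, 2R]
has variance at most 4R². -/
theorem integral_noise_sum_sq_le (hn : ∀ᵐ e ∂𝔅.noiseLaw, |e| ≤ 2 * R) (c : Fin L → ℝ) (a : ℝ) :
    ∫ e : Fin L → ℝ, (a + ∑ j, e j * c j) ^ 2 ∂(Measure.pi fun _ => 𝔅.noiseLaw)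
      ≤ a ^ 2 + 4 * R ^ 2 * ∑ j, c j ^ 2 := by
  set P : Measure (Fin L → ℝ) := Measure.pi fun _ => 𝔅.noiseLaw
  set Y : (Fin L → ℝ) → ℝ := fun e => ∑ j, e j * c j with hY
  have hm : MemLp Y 2 P := noise_sum_memLp 𝔅 c
  have hmean : ∫ e, Y e ∂P = 0 := integral_noise_sum 𝔅 c
  have hvar : ∫ e, Y e ^ 2 ∂P ≤ 4 * R ^ 2 * ∑ j, c j ^ 2 := by
    have h1 : Var[Y; P] = ∫ e, Y e ^ 2 ∂P := by
      rw [variance_eq_integral hm.aestronglyMeasurable.aemeasurable, hmean]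
      simp
    have h2 : Y = ∑ j, fun e : Fin L → ℝ => (fun t : ℝ => t * c j) (e j) := by
      ext e
      simp [hY]
    rw [← h1, h2, variance_sum_pi (X := fun j t => t * c j)
      (fun j => (noise_memLp 𝔅).mul_const (c j)), Finset.mul_sum]
    refine Finset.sum_le_sum fun j _ => ?_
    have h3 : Var[fun t : ℝ => t; 𝔅.noiseLaw] ≤ 4 * R ^ 2 := by
      refine (variance_le_sq_of_bounded (a := -(2 * R)) (b := 2 * R) ?_ (by fun_prop)).trans
        (le_of_eq (by ring))
      filter_upwards [hn] with e he
      exact abs_le.mp he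
    have h4 : Var[fun t : ℝ => t * c j; 𝔅.noiseLaw]
        = c j ^ 2 * Var[fun t : ℝ => t; 𝔅.noiseLaw] := by
      simp only [mul_comm _ (c j)]
      exact variance_const_mul (c j) _ _
    rw [h4, mul_comm]
    gcongr
  have hexp : ∀ e, (a + Y e) ^ 2 = (a ^ 2 + 2 * a * Y e) + Y e ^ 2 := fun e => by ring
  have hint : Integrable Y P := hm.integrable one_le_two
  change ∫ e, (a + Y e) ^ 2 ∂P ≤ _
  simp only [hexp]
  have h1 : Integrable (fun e => a ^ 2 + 2 * a * Y e) P :=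
    (integrable_const _).add (hint.const_mul _)
  rw [integral_add h1 hm.integrable_sq, integral_add (integrable_const _) (hint.const_mul _),
    integral_const_mul, hmean]
  simpa using hvar

/-! ### Moments of the statistics of a half -/

theorem measurable_dotProduct_ridgeH (𝔅 : Bandit X A dA dK) (μ : ℝ) (x : Fin dA → ℝ) :
    Measurable fun p : EuclideanSpace ℝ (Fin dK) × Half X A L => x ⬝ᵥ ridgeH 𝔅 μ p.1 p.2 :=
  Finset.measurable_fun_sum _ fun i _ => measurable_const.mul (measurable_ridgeH 𝔅 μ i)

theorem measurable_dotProduct_ridgeH_right (𝔅 : Bandit X A dA dK) (μ : ℝ)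
    (θ : EuclideanSpace ℝ (Fin dK)) (x : Fin dA → ℝ) :
    Measurable fun w : Half X A L => x ⬝ᵥ ridgeH 𝔅 μ θ w := by
  have h : Measurable fun w : Half X A L => (θ, w) := measurable_prodMk_left
  have h2 := (measurable_dotProduct_ridgeH (L := L) 𝔅 μ x).comp h
  simp only [Function.comp_def] at h2
  exact h2

theorem integrable_dotProduct_ridgeH (hμ : 0 < μ) (hn : ∀ᵐ e ∂𝔅.noiseLaw, |e| ≤ 2 * R)
    {θ : EuclideanSpace ℝ (Fin dK)} (hθ : betaVec 𝔅 θ ⬝ᵥ betaVec 𝔅 θ ≤ R ^ 2) (x : Fin dA → ℝ) :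
    Integrable (fun w => x ⬝ᵥ ridgeH 𝔅 μ θ w) (halfLaw 𝔅 𝔇) := by
  refine Integrable.of_bound (measurable_dotProduct_ridgeH_right 𝔅 μ θ x).aestronglyMeasurable
    (√(2 * (R ^ 2 + 4 * R ^ 2 * L / μ) * (x ⬝ᵥ x))) ?_
  filter_upwards [ae_half_noise_le (𝔇 := 𝔇) hn] with w hw
  exact Real.abs_le_sqrt (sq_dotProduct_ridgeH_le 𝔅 w hμ θ hθ hw x)

theorem integrable_sq_dotProduct_ridgeH (hμ : 0 < μ) (hn : ∀ᵐ e ∂𝔅.noiseLaw, |e| ≤ 2 * R)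
    {θ : EuclideanSpace ℝ (Fin dK)} (hθ : betaVec 𝔅 θ ⬝ᵥ betaVec 𝔅 θ ≤ R ^ 2) (x : Fin dA → ℝ) :
    Integrable (fun w => (x ⬝ᵥ ridgeH 𝔅 μ θ w) ^ 2) (halfLaw 𝔅 𝔇) := by
  refine Integrable.of_bound
    ((measurable_dotProduct_ridgeH_right 𝔅 μ θ x).pow_const 2).aestronglyMeasurable
    (2 * (R ^ 2 + 4 * R ^ 2 * L / μ) * (x ⬝ᵥ x)) ?_
  filter_upwards [ae_half_noise_le (𝔇 := 𝔇) hn] with w hw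
  rw [Real.norm_of_nonneg (sq_nonneg _)]
  exact sq_dotProduct_ridgeH_le 𝔅 w hμ θ hθ hw x

theorem abs_corrH_le (hμ : 0 < μ) (w : Half X A L) (i k : Fin dA) : |corrH 𝔅 μ w i k| ≤ 1 := by
  have h := abs_dotProduct_mulVec_le (corrH 𝔅 μ w) (u := Pi.single i 1) (x := Pi.single k 1)
    (by simp)
  rw [single_one_dotProduct, Matrix.mulVec_single_one, single_one_dotProduct, Pi.single_eq_same,
    mul_one] at h
  exact h.trans (norm_corrH_le 𝔅 w hμ)

theorem integrable_corrH (hμ : 0 < μ) (i k : Fin dA) :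
    Integrable (fun w => corrH 𝔅 μ w i k) (halfLaw 𝔅 𝔇) :=
  Integrable.of_bound (measurable_corrH 𝔅 μ i k).aestronglyMeasurable 1
    (Filter.Eventually.of_forall fun w => abs_corrH_le hμ w i k)

/-- The expectation of the correction matrix. -/
noncomputable def meanCorr (𝔅 : Bandit X A dA dK) (𝔇 : Design X A L) (μ : ℝ) :
    Matrix (Fin dA) (Fin dA) ℝ :=
  matExp (halfLaw 𝔅 𝔇) (corrH 𝔅 μ)

theorem form_eq_sum {n : ℕ} (F : Matrix (Fin n) (Fin n) ℝ) (x y : Fin n → ℝ) :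
    x ⬝ᵥ F *ᵥ y = ∑ i, ∑ k, x i * y k * F i k := by
  simp only [dotProduct, Matrix.mulVec, Finset.mul_sum]
  exact Finset.sum_congr rfl fun i _ => Finset.sum_congr rfl fun k _ => by ring

theorem integrable_form {T : Type*} [MeasurableSpace T] {P : Measure T} {n : ℕ}
    {F : T → Matrix (Fin n) (Fin n) ℝ} (hF : ∀ i j, Integrable (fun t => F t i j) P)
    (x y : Fin n → ℝ) : Integrable (fun t => x ⬝ᵥ F t *ᵥ y) P := by
  simp only [form_eq_sum]
  exact integrable_finsetSum _ fun i _ => integrable_finsetSum _ fun k _ =>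
    (hF i k).const_mul _

theorem form_matExp {T : Type*} [MeasurableSpace T] {P : Measure T} {n : ℕ}
    {F : T → Matrix (Fin n) (Fin n) ℝ} (hF : ∀ i j, Integrable (fun t => F t i j) P)
    (x y : Fin n → ℝ) : x ⬝ᵥ matExp P F *ᵥ y = ∫ t, x ⬝ᵥ F t *ᵥ y ∂P := by
  simp only [form_eq_sum]
  rw [integral_finsetSum _ fun i _ => integrable_finsetSum _ fun k _ => (hF i k).const_mul _]
  refine Finset.sum_congr rfl fun i _ => ?_
  rw [integral_finsetSum _ fun k _ => (hF i k).const_mul _]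
  refine Finset.sum_congr rfl fun k _ => ?_
  rw [integral_const_mul, matExp, Matrix.of_apply]

theorem integral_dotProduct_ridgeH (hμ : 0 < μ) (hn : ∀ᵐ e ∂𝔅.noiseLaw, |e| ≤ 2 * R)
    {θ : EuclideanSpace ℝ (Fin dK)} (hθ : betaVec 𝔅 θ ⬝ᵥ betaVec 𝔅 θ ≤ R ^ 2) (x : Fin dA → ℝ) :
    ∫ w, x ⬝ᵥ ridgeH 𝔅 μ θ w ∂(halfLaw 𝔅 𝔇) = x ⬝ᵥ meanCorr 𝔅 𝔇 μ *ᵥ betaVec 𝔅 θ := by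
  have h1 := integrable_dotProduct_ridgeH (𝔇 := 𝔇) hμ hn hθ x
  have h2 := integrable_form (integrable_corrH (𝔅 := 𝔅) (𝔇 := 𝔇) hμ) x (betaVec 𝔅 θ)
  -- After subtracting the bias term only the noise sum is left, and it integrates to 0 for fixed
  -- contexts and actions.
  rw [meanCorr, form_matExp (integrable_corrH hμ), ← sub_eq_zero, ← integral_sub h1 h2]
  have h3 := h1.sub h2
  simp only [Pi.sub_def, dotProduct_ridgeH 𝔅 _ hμ, add_sub_cancel_left] at h3 ⊢
  rw [halfLaw] at h3 ⊢
  rw [integral_prod _ h3]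
  refine integral_eq_zero_of_ae (Filter.Eventually.of_forall fun z => ?_)
  exact integral_noise_sum 𝔅 (noiseCoef 𝔅 μ (z, 0) x)

/-- Integrating the noise before the contexts brings in its variance instead of its size, so the
bound no longer depends on L. -/
theorem integral_sq_dotProduct_ridgeH_le (hμ : 0 < μ) (hn : ∀ᵐ e ∂𝔅.noiseLaw, |e| ≤ 2 * R)
    {θ : EuclideanSpace ℝ (Fin dK)} (hθ : betaVec 𝔅 θ ⬝ᵥ betaVec 𝔅 θ ≤ R ^ 2) (x : Fin dA → ℝ) :
    ∫ w, (x ⬝ᵥ ridgeH 𝔅 μ θ w) ^ 2 ∂(halfLaw 𝔅 𝔇)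
      ≤ R ^ 2 * (1 + 4 / μ) * (x ⬝ᵥ x) := by
  have h1 := integrable_sq_dotProduct_ridgeH (𝔇 := 𝔇) hμ hn hθ x
  simp only [dotProduct_ridgeH 𝔅 _ hμ] at h1 ⊢
  rw [halfLaw] at h1 ⊢
  rw [integral_prod _ h1]
  refine (integral_mono h1.integral_prod_left
    (integrable_const (R ^ 2 * (1 + 4 / μ) * (x ⬝ᵥ x))) fun z => ?_).trans (by simp)
  refine (integral_noise_sum_sq_le hn (noiseCoef 𝔅 μ (z, 0) x)
    (x ⬝ᵥ corrH 𝔅 μ (z, (0 : Fin L → ℝ)) *ᵥ betaVec 𝔅 θ)).trans ?_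
  have h3 := sq_dotProduct_corrH_le 𝔅 (z, (0 : Fin L → ℝ)) hμ _ hθ x
  have h4 := sum_sq_noiseCoef_le 𝔅 (z, (0 : Fin L → ℝ)) hμ x
  have h5 : 4 * R ^ 2 * ∑ j, noiseCoef 𝔅 μ (z, (0 : Fin L → ℝ)) x j ^ 2
      ≤ 4 * R ^ 2 * ((x ⬝ᵥ x) / μ) := by gcongr
  have h6 : R ^ 2 * (1 + 4 / μ) * (x ⬝ᵥ x) = R ^ 2 * (x ⬝ᵥ x) + 4 * R ^ 2 * ((x ⬝ᵥ x) / μ) := by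
    ring
  rw [h6]
  exact add_le_add h3 h5

end Moments

section Expectations

variable {X A : Type*} [MeasurableSpace X] [MeasurableSpace A] {dA dK L : ℕ}
  {𝔅 : Bandit X A dA dK} {𝔇 : Design X A L} {μ R : ℝ}

/-! ### Expectations of the correction matrices -/

theorem matExp_corrD (𝔅 : Bandit X A dA dK) (𝔇 : Design X A L) (μ : ℝ) (i : Fin 2) :
    matExp (trajLaw 𝔅 𝔇) (corrD 𝔅 μ i) = meanCorr 𝔅 𝔇 μ := by
  ext k l
  have h0 : MeasurePreserving (fun p : EuclideanSpace ℝ (Fin dK) × Half X A L × Half X A L => p.2.1)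
      (splitLaw 𝔅 𝔇) (halfLaw 𝔅 𝔇) :=
    (measurePreserving_fst (ν := halfLaw 𝔅 𝔇)).comp (measurePreserving_snd (μ := 𝔅.latentLaw))
  have h1 : MeasurePreserving (fun p : EuclideanSpace ℝ (Fin dK) × Half X A L × Half X A L => p.2.2)
      (splitLaw 𝔅 𝔇) (halfLaw 𝔅 𝔇) :=
    (measurePreserving_snd (μ := halfLaw 𝔅 𝔇)).comp (measurePreserving_snd (μ := 𝔅.latentLaw))
  have hm := measurable_corrH (L := L) 𝔅 μ k l
  simp only [matExp, meanCorr, Matrix.of_apply]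
  fin_cases i
  · have h2 := integral_splitTraj (𝔅 := 𝔅) (𝔇 := 𝔇) (hm.comp h0.measurable)
    simp only [Function.comp_def] at h2
    refine h2.trans ?_
    rw [← h0.map_eq, integral_map h0.measurable.aemeasurable hm.aestronglyMeasurable]
  · have h2 := integral_splitTraj (𝔅 := 𝔅) (𝔇 := 𝔇) (hm.comp h1.measurable)
    simp only [Function.comp_def] at h2
    refine h2.trans ?_
    rw [← h1.map_eq, integral_map h1.measurable.aemeasurable hm.aestronglyMeasurable]

theorem matExp_transpose {T : Type*} [MeasurableSpace T] (P : Measure T) {n : ℕ}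
    {F : T → Matrix (Fin n) (Fin n) ℝ} (hF : ∀ t, (F t)ᵀ = F t) : (matExp P F)ᵀ = matExp P F := by
  ext i j
  simp only [matExp, Matrix.transpose_apply, Matrix.of_apply]
  exact integral_congr_ae (Filter.Eventually.of_forall fun t => congrFun (congrFun (hF t) i) j)

theorem norm_matExp_le {T : Type*} [MeasurableSpace T] {P : Measure T} [IsProbabilityMeasure P]
    {n : ℕ} {F : T → Matrix (Fin n) (Fin n) ℝ} (hF : ∀ i j, Integrable (fun t => F t i j) P)
    (ht : ∀ t, (F t)ᵀ = F t) {c : ℝ} (hc : 0 ≤ c) (h0 : ∀ t x, 0 ≤ x ⬝ᵥ F t *ᵥ x)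
    (h : ∀ x, ∫ t, x ⬝ᵥ F t *ᵥ x ∂P ≤ c * (x ⬝ᵥ x)) : ‖matExp P F‖ ≤ c := by
  refine norm_le_of_form (matExp_transpose P ht) hc (fun x => ?_) fun x => ?_
  · rw [form_matExp hF]
    exact integral_nonneg fun t => h0 t x
  · rw [form_matExp hF]
    exact h x

theorem meanCorr_transpose : (meanCorr 𝔅 𝔇 μ)ᵀ = meanCorr 𝔅 𝔇 μ :=
  matExp_transpose _ (corrH_transpose 𝔅)

theorem norm_meanCorr_le (hμ : 0 < μ) : ‖meanCorr 𝔅 𝔇 μ‖ ≤ 1 := by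
  refine norm_matExp_le (integrable_corrH hμ) (corrH_transpose 𝔅) zero_le_one
    (fun w => form_corrH_nonneg 𝔅 w hμ) fun x => ?_
  refine (integral_mono (integrable_form (integrable_corrH hμ) x x) (integrable_const (x ⬝ᵥ x))
    fun w => (form_corrH_aux 𝔅 w hμ x).2).trans (by simp)

theorem lamA_eq : lamA 𝔅 𝔇 μ = lamMin (meanCorr 𝔅 𝔇 μ) := by
  rw [lamA, matExp_corrD, matExp_corrD, min_self]

theorem lamA_mul_le_form (x : Fin dA → ℝ) :
    lamA 𝔅 𝔇 μ * (x ⬝ᵥ x) ≤ x ⬝ᵥ meanCorr 𝔅 𝔇 μ *ᵥ x := by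
  rw [lamA_eq]
  exact lamMin_mul_le_form meanCorr_transpose x

/-- Without steps the correction matrix is I − μ(μI)⁻¹ = 0, which contradicts coverage. -/
theorem pos_of_lamA_pos (hd : 0 < dA) (hμ : 0 < μ) (h : 0 < lamA 𝔅 𝔇 μ) : 0 < L := by
  rcases Nat.eq_zero_or_pos L with rfl | hL
  · exfalso
    have h1 := lamA_mul_le_form (𝔅 := 𝔅) (𝔇 := 𝔇) (μ := μ) (Pi.single (⟨0, hd⟩ : Fin dA) 1)
    have h2 : ∀ w : Half X A 0, corrH 𝔅 μ w = 0 := by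
      intro w
      have h3 : designH 𝔅 μ w = μ • 1 := by simp [designH, gramH]
      have h4 : (μ • (1 : Matrix (Fin dA) (Fin dA) ℝ))⁻¹ = μ⁻¹ • 1 := by
        apply Matrix.inv_eq_left_inv
        rw [Matrix.smul_mul, Matrix.one_mul, smul_smul, inv_mul_cancel₀ hμ.ne', one_smul]
      rw [corrH, h3, h4, smul_smul, mul_inv_cancel₀ hμ.ne', one_smul, sub_self]
    have h3 : meanCorr 𝔅 𝔇 μ = 0 := by
      ext i j
      simp [meanCorr, matExp, h2]
    rw [h3, Matrix.zero_mulVec, dotProduct_zero, single_one_dotProduct, Pi.single_eq_same,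
      mul_one] at h1
    linarith
  · exact hL

theorem lamA_le_one (hd : 0 < dA) (hμ : 0 < μ) : lamA 𝔅 𝔇 μ ≤ 1 := by
  have h1 := lamA_mul_le_form (𝔅 := 𝔅) (𝔇 := 𝔇) (μ := μ) (Pi.single (⟨0, hd⟩ : Fin dA) 1)
  have h2 := (abs_le.mp (abs_dotProduct_mulVec_le (meanCorr 𝔅 𝔇 μ)
    (le_refl ((Pi.single (⟨0, hd⟩ : Fin dA) (1 : ℝ)) ⬝ᵥ Pi.single (⟨0, hd⟩ : Fin dA) 1)))).2
  have h3 := norm_meanCorr_le (𝔅 := 𝔅) (𝔇 := 𝔇) hμ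
  have h4 : (Pi.single (⟨0, hd⟩ : Fin dA) (1 : ℝ)) ⬝ᵥ Pi.single (⟨0, hd⟩ : Fin dA) 1 = 1 := by simp
  rw [h4, mul_one] at h1 h2
  linarith

/-! ### The second moment of the reward parameter -/

/-- The second moment matrix of the reward parameter. -/
noncomputable def secondMoment (𝔅 : Bandit X A dA dK) : Matrix (Fin dA) (Fin dA) ℝ :=
  matExp 𝔅.latentLaw fun θ => Matrix.vecMulVec (betaVec 𝔅 θ) (betaVec 𝔅 θ)

theorem form_vecMulVec {n : ℕ} (a b x y : Fin n → ℝ) :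
    x ⬝ᵥ Matrix.vecMulVec a b *ᵥ y = (x ⬝ᵥ a) * (b ⬝ᵥ y) := by
  rw [Matrix.vecMulVec_mulVec]
  simp [dotProduct_smul, mul_comm]

theorem sq_dotProduct_le {n : ℕ} {R : ℝ} {b : Fin n → ℝ} (hb : b ⬝ᵥ b ≤ R ^ 2) (x : Fin n → ℝ) :
    (x ⬝ᵥ b) ^ 2 ≤ R ^ 2 * (x ⬝ᵥ x) := by
  have h := pow_le_pow_left₀ (abs_nonneg _) (abs_dotProduct_le x b) 2
  rw [sq_abs, mul_pow, Real.sq_sqrt (dotProduct_self_nonneg' _),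
    Real.sq_sqrt (dotProduct_self_nonneg' _)] at h
  refine h.trans ?_
  rw [mul_comm]
  exact mul_le_mul_of_nonneg_right hb (dotProduct_self_nonneg' x)

theorem integrable_betaVec_mul (hR : 0 ≤ R)
    (hβ : ∀ᵐ θ ∂𝔅.latentLaw, betaVec 𝔅 θ ⬝ᵥ betaVec 𝔅 θ ≤ R ^ 2) (i j : Fin dA) :
    Integrable (fun θ => Matrix.vecMulVec (betaVec 𝔅 θ) (betaVec 𝔅 θ) i j) 𝔅.latentLaw := by
  simp only [Matrix.vecMulVec_apply]
  refine Integrable.of_bound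
    ((measurable_betaVec 𝔅 i).mul (measurable_betaVec 𝔅 j)).aestronglyMeasurable (R * R) ?_
  filter_upwards [hβ] with θ hθ
  have h1 : ∀ i, |betaVec 𝔅 θ i| ≤ R := by
    intro i
    have := sq_dotProduct_le hθ (Pi.single i 1)
    rw [single_one_dotProduct, single_one_dotProduct, Pi.single_eq_same, mul_one] at this
    exact abs_le_of_sq_le_sq this hR
  rw [norm_mul]
  exact mul_le_mul (h1 i) (h1 j) (norm_nonneg _) hR

theorem form_secondMoment (hR : 0 ≤ R)
    (hβ : ∀ᵐ θ ∂𝔅.latentLaw, betaVec 𝔅 θ ⬝ᵥ betaVec 𝔅 θ ≤ R ^ 2) (x y : Fin dA → ℝ) :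
    x ⬝ᵥ secondMoment 𝔅 *ᵥ y = ∫ θ, (x ⬝ᵥ betaVec 𝔅 θ) * (y ⬝ᵥ betaVec 𝔅 θ) ∂𝔅.latentLaw := by
  rw [secondMoment, form_matExp (integrable_betaVec_mul hR hβ)]
  simp only [form_vecMulVec, dotProduct_comm _ y]

theorem secondMoment_transpose : (secondMoment 𝔅)ᵀ = secondMoment 𝔅 :=
  matExp_transpose _ fun _ => Matrix.transpose_vecMulVec _ _

theorem form_secondMoment_nonneg (hR : 0 ≤ R)
    (hβ : ∀ᵐ θ ∂𝔅.latentLaw, betaVec 𝔅 θ ⬝ᵥ betaVec 𝔅 θ ≤ R ^ 2) (x : Fin dA → ℝ) :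
    0 ≤ x ⬝ᵥ secondMoment 𝔅 *ᵥ x := by
  rw [form_secondMoment hR hβ]
  exact integral_nonneg fun θ => mul_self_nonneg _

theorem norm_secondMoment_le (hR : 0 ≤ R)
    (hβ : ∀ᵐ θ ∂𝔅.latentLaw, betaVec 𝔅 θ ⬝ᵥ betaVec 𝔅 θ ≤ R ^ 2) :
    ‖secondMoment 𝔅‖ ≤ R ^ 2 := by
  refine norm_matExp_le (integrable_betaVec_mul hR hβ) (fun _ => Matrix.transpose_vecMulVec _ _)
    (sq_nonneg R) (fun θ x => ?_) fun x => ?_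
  · rw [form_vecMulVec, dotProduct_comm x]
    exact mul_self_nonneg _
  · refine (integral_mono_ae (integrable_form (integrable_betaVec_mul hR hβ) x x)
      (integrable_const (R ^ 2 * (x ⬝ᵥ x))) ?_).trans (by simp)
    filter_upwards [hβ] with θ hθ
    rw [form_vecMulVec, dotProduct_comm _ x, ← sq]
    exact sq_dotProduct_le hθ x

theorem Ustar_mul_secondMoment (hR : 0 ≤ R)
    (hβ : ∀ᵐ θ ∂𝔅.latentLaw, betaVec 𝔅 θ ⬝ᵥ betaVec 𝔅 θ ≤ R ^ 2) :
    𝔅.Ustar * (𝔅.Ustarᵀ * secondMoment 𝔅) = secondMoment 𝔅 := by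
  rw [← Matrix.mul_assoc]
  set Q := 𝔅.Ustar * 𝔅.Ustarᵀ with hQ
  have hQt : Qᵀ = Q := by rw [hQ, Matrix.transpose_mul, Matrix.transpose_transpose]
  have hQb : ∀ θ, Q *ᵥ betaVec 𝔅 θ = betaVec 𝔅 θ := fun θ => by
    rw [hQ, betaVec, Matrix.mulVec_mulVec, Matrix.mul_assoc, 𝔅.Ustar_orthonormal, Matrix.mul_one]
  refine Matrix.ext_of_mulVec_single fun j => ?_
  refine dotProduct_eq _ _ fun x => ?_
  rw [dotProduct_comm, dotProduct_comm _ x, ← Matrix.mulVec_mulVec, dotProduct_mulVec_comm hQt,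
    form_secondMoment hR hβ, form_secondMoment hR hβ]
  refine integral_congr_ae (Filter.Eventually.of_forall fun θ => ?_)
  simp only [← dotProduct_mulVec_comm hQt, hQb]

/-- `Ustar` is isometric, so ⟨Ustar a, β⟩ = ⟨a, θ⟩, and a second moment dominates the variance.
Coverage of θ thus bounds S from below on the range of `Ustar`. -/
theorem lamMin_latentCov_le (hR : 0 ≤ R)
    (hβ : ∀ᵐ θ ∂𝔅.latentLaw, betaVec 𝔅 θ ⬝ᵥ betaVec 𝔅 θ ≤ R ^ 2) (a : Fin dK → ℝ) :
    lamMin (latentCov 𝔅) * (a ⬝ᵥ a)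
      ≤ 𝔅.Ustar *ᵥ a ⬝ᵥ secondMoment 𝔅 *ᵥ (𝔅.Ustar *ᵥ a) := by
  have hsym : (latentCov 𝔅)ᵀ = latentCov 𝔅 := by
    ext i j
    simp only [latentCov, Matrix.transpose_apply, Matrix.of_apply]
    exact covariance_comm _ _
  have hUb : ∀ (a : Fin dK → ℝ) θ, 𝔅.Ustar *ᵥ a ⬝ᵥ betaVec 𝔅 θ = a ⬝ᵥ WithLp.ofLp θ := fun a θ => by
    rw [betaVec, mulVec_dotProduct_mulVec, 𝔅.Ustar_orthonormal, Matrix.one_mulVec]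
  have hmem : ∀ i, MemLp (fun θ : EuclideanSpace ℝ (Fin dK) => θ i) 2 𝔅.latentLaw := by
    intro i
    refine MemLp.of_bound (by fun_prop) R ?_
    filter_upwards [hβ] with θ hθ
    have h1 := sq_dotProduct_le hθ (𝔅.Ustar *ᵥ Pi.single i 1)
    rw [hUb, mulVec_dotProduct_self_of_orthonormal 𝔅.Ustar_orthonormal, single_one_dotProduct,
      single_one_dotProduct, Pi.single_eq_same, mul_one] at h1
    exact abs_le_of_sq_le_sq h1 hR
  refine (lamMin_mul_le_form hsym a).trans ?_
  have hmem' : ∀ i, MemLp (fun θ : EuclideanSpace ℝ (Fin dK) => a i * θ i) 2 𝔅.latentLaw :=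
    fun i => (hmem i).const_mul (a i)
  have hvar : a ⬝ᵥ latentCov 𝔅 *ᵥ a
      = Var[fun θ : EuclideanSpace ℝ (Fin dK) => ∑ i, a i * θ i; 𝔅.latentLaw] := by
    rw [variance_fun_sum hmem', form_eq_sum]
    refine Finset.sum_congr rfl fun i _ => Finset.sum_congr rfl fun j _ => ?_
    rw [covariance_const_mul_left, covariance_const_mul_right, latentCov, Matrix.of_apply]
    ring
  rw [hvar, form_secondMoment hR hβ]
  refine (variance_le_expectation_sq (by fun_prop)).trans (le_of_eq ?_)
  refine integral_congr_ae (Filter.Eventually.of_forall fun θ => ?_)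
  simp only [hUb, Pi.pow_apply, sq]
  rfl

/-! ### Expectations of the outer products -/

/-- The symmetrized outer product as a function of the latent state and the two halves. -/
noncomputable def splitM (𝔅 : Bandit X A dA dK) (μ : ℝ)
    (p : EuclideanSpace ℝ (Fin dK) × Half X A L × Half X A L) : Matrix (Fin dA) (Fin dA) ℝ :=
  (1 / 2 : ℝ) • (Matrix.vecMulVec (ridgeH 𝔅 μ p.1 p.2.1) (ridgeH 𝔅 μ p.1 p.2.2)
    + Matrix.vecMulVec (ridgeH 𝔅 μ p.1 p.2.2) (ridgeH 𝔅 μ p.1 p.2.1))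

theorem outerM_eq (𝔅 : Bandit X A dA dK) (μ : ℝ) (τ : Traj X A dK L) :
    outerM 𝔅 μ τ = splitM 𝔅 μ (splitTraj τ) := by
  rw [outerM, betaHat_zero, betaHat_one]
  rfl

theorem splitM_apply (p : EuclideanSpace ℝ (Fin dK) × Half X A L × Half X A L) (i j : Fin dA) :
    splitM 𝔅 μ p i j = 1 / 2 * (ridgeH 𝔅 μ p.1 p.2.1 i * ridgeH 𝔅 μ p.1 p.2.2 j
      + ridgeH 𝔅 μ p.1 p.2.2 i * ridgeH 𝔅 μ p.1 p.2.1 j) := rfl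

theorem splitM_transpose (p : EuclideanSpace ℝ (Fin dK) × Half X A L × Half X A L) :
    (splitM 𝔅 μ p)ᵀ = splitM 𝔅 μ p := by
  rw [splitM, Matrix.transpose_smul, Matrix.transpose_add, Matrix.transpose_vecMulVec,
    Matrix.transpose_vecMulVec, add_comm]

theorem measurable_ridgeH_fst (𝔅 : Bandit X A dA dK) (μ : ℝ) (i : Fin dA) :
    Measurable fun p : EuclideanSpace ℝ (Fin dK) × Half X A L × Half X A L =>
      ridgeH 𝔅 μ p.1 p.2.1 i := by
  have h : Measurable fun p : EuclideanSpace ℝ (Fin dK) × Half X A L × Half X A L =>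
      (p.1, p.2.1) := measurable_fst.prodMk (measurable_fst.comp measurable_snd)
  have h2 := (measurable_ridgeH (L := L) 𝔅 μ i).comp h
  simp only [Function.comp_def] at h2
  exact h2

theorem measurable_ridgeH_snd (𝔅 : Bandit X A dA dK) (μ : ℝ) (i : Fin dA) :
    Measurable fun p : EuclideanSpace ℝ (Fin dK) × Half X A L × Half X A L =>
      ridgeH 𝔅 μ p.1 p.2.2 i := by
  have h : Measurable fun p : EuclideanSpace ℝ (Fin dK) × Half X A L × Half X A L =>
      (p.1, p.2.2) := measurable_fst.prodMk (measurable_snd.comp measurable_snd)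
  have h2 := (measurable_ridgeH (L := L) 𝔅 μ i).comp h
  simp only [Function.comp_def] at h2
  exact h2

theorem measurable_splitM (𝔅 : Bandit X A dA dK) (μ : ℝ) (i j : Fin dA) :
    Measurable fun p : EuclideanSpace ℝ (Fin dK) × Half X A L × Half X A L =>
      splitM 𝔅 μ p i j := by
  simp only [splitM_apply]
  exact (((measurable_ridgeH_fst 𝔅 μ i).mul (measurable_ridgeH_snd 𝔅 μ j)).add
    ((measurable_ridgeH_snd 𝔅 μ i).mul (measurable_ridgeH_fst 𝔅 μ j))).const_mul _

theorem abs_dotProduct_ridgeH_le (hμ : 0 < μ) {θ : EuclideanSpace ℝ (Fin dK)} {w : Half X A L}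
    (hθ : betaVec 𝔅 θ ⬝ᵥ betaVec 𝔅 θ ≤ R ^ 2) (hw : ∀ j, |w.2 j| ≤ 2 * R) (i : Fin dA) :
    |ridgeH 𝔅 μ θ w i| ≤ √(2 * (R ^ 2 + 4 * R ^ 2 * L / μ)) := by
  have h := sq_dotProduct_ridgeH_le 𝔅 w hμ θ hθ hw (Pi.single i 1)
  rw [single_one_dotProduct, single_one_dotProduct, Pi.single_eq_same, mul_one] at h
  exact Real.abs_le_sqrt h

theorem ae_abs_splitM_le (hμ : 0 < μ)
    (hβ : ∀ᵐ θ ∂𝔅.latentLaw, betaVec 𝔅 θ ⬝ᵥ betaVec 𝔅 θ ≤ R ^ 2)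
    (hn : ∀ᵐ e ∂𝔅.noiseLaw, |e| ≤ 2 * R) :
    ∀ᵐ p ∂(splitLaw 𝔅 𝔇), ∀ i j, |splitM 𝔅 μ p i j| ≤ 2 * (R ^ 2 + 4 * R ^ 2 * L / μ) := by
  filter_upwards [ae_splitLaw (𝔇 := 𝔇) hβ hn] with p ⟨h1, h2, h3⟩ i j
  have ha := abs_dotProduct_ridgeH_le hμ h1 h2
  have hb := abs_dotProduct_ridgeH_le hμ h1 h3
  have hK : 0 ≤ 2 * (R ^ 2 + 4 * R ^ 2 * L / μ) := by positivity
  have h4 : ∀ u v : ℝ, |u| ≤ √(2 * (R ^ 2 + 4 * R ^ 2 * L / μ)) →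
      |v| ≤ √(2 * (R ^ 2 + 4 * R ^ 2 * L / μ)) → |u * v| ≤ 2 * (R ^ 2 + 4 * R ^ 2 * L / μ) := by
    intro u v hu hv
    rw [abs_mul, ← Real.mul_self_sqrt hK]
    exact mul_le_mul hu hv (abs_nonneg _) (Real.sqrt_nonneg _)
  have h5 := h4 _ _ (ha i) (hb j)
  have h6 := h4 _ _ (hb i) (ha j)
  rw [splitM_apply, abs_le]
  rw [abs_le] at h5 h6
  constructor <;> linarith [h5.1, h5.2, h6.1, h6.2]

theorem ae_abs_splitM_sq_le (hμ : 0 < μ)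
    (hβ : ∀ᵐ θ ∂𝔅.latentLaw, betaVec 𝔅 θ ⬝ᵥ betaVec 𝔅 θ ≤ R ^ 2)
    (hn : ∀ᵐ e ∂𝔅.noiseLaw, |e| ≤ 2 * R) :
    ∀ᵐ p ∂(splitLaw 𝔅 𝔇), ∀ i j,
      |(splitM 𝔅 μ p ^ 2) i j| ≤ dA * (2 * (R ^ 2 + 4 * R ^ 2 * L / μ)) ^ 2 := by
  filter_upwards [ae_abs_splitM_le (𝔇 := 𝔇) hμ hβ hn] with p h i j
  rw [sq, Matrix.mul_apply]
  refine (Finset.abs_sum_le_sum_abs _ _).trans ?_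
  have h1 : ∀ k ∈ Finset.univ, |splitM 𝔅 μ p i k * splitM 𝔅 μ p k j|
      ≤ (2 * (R ^ 2 + 4 * R ^ 2 * L / μ)) ^ 2 := fun k _ => by
    rw [abs_mul, sq]
    exact mul_le_mul (h i k) (h k j) (abs_nonneg _) (by positivity)
  simpa using Finset.sum_le_sum h1

theorem measurable_splitM_sq (𝔅 : Bandit X A dA dK) (μ : ℝ) (i j : Fin dA) :
    Measurable fun p : EuclideanSpace ℝ (Fin dK) × Half X A L × Half X A L =>
      (splitM 𝔅 μ p ^ 2) i j := by
  simp only [sq, Matrix.mul_apply]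
  exact Finset.measurable_fun_sum _ fun k _ =>
    (measurable_splitM 𝔅 μ i k).mul (measurable_splitM 𝔅 μ k j)

/-- For fixed θ the halves are independent, so the integral factors into two coordinates of Dβ;
integrating over θ gives D S D. -/
theorem integral_ridgeH_mul (hμ : 0 < μ) (hR : 0 ≤ R)
    (hβ : ∀ᵐ θ ∂𝔅.latentLaw, betaVec 𝔅 θ ⬝ᵥ betaVec 𝔅 θ ≤ R ^ 2)
    (hn : ∀ᵐ e ∂𝔅.noiseLaw, |e| ≤ 2 * R) (i j : Fin dA) :
    Integrable (fun p => ridgeH 𝔅 μ p.1 p.2.1 i * ridgeH 𝔅 μ p.1 p.2.2 j) (splitLaw 𝔅 𝔇) ∧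
    ∫ p, ridgeH 𝔅 μ p.1 p.2.1 i * ridgeH 𝔅 μ p.1 p.2.2 j ∂(splitLaw 𝔅 𝔇)
      = (meanCorr 𝔅 𝔇 μ * secondMoment 𝔅 * meanCorr 𝔅 𝔇 μ) i j := by
  have hint : Integrable (fun p => ridgeH 𝔅 μ p.1 p.2.1 i * ridgeH 𝔅 μ p.1 p.2.2 j)
      (splitLaw 𝔅 𝔇) := by
    refine Integrable.of_bound ((measurable_ridgeH_fst 𝔅 μ i).mul
      (measurable_ridgeH_snd 𝔅 μ j)).aestronglyMeasurable
      (√(2 * (R ^ 2 + 4 * R ^ 2 * L / μ)) * √(2 * (R ^ 2 + 4 * R ^ 2 * L / μ))) ?_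
    filter_upwards [ae_splitLaw (𝔇 := 𝔇) hβ hn] with p ⟨h1, h2, h3⟩
    rw [norm_mul]
    exact mul_le_mul (abs_dotProduct_ridgeH_le hμ h1 h2 i) (abs_dotProduct_ridgeH_le hμ h1 h3 j)
      (norm_nonneg _) (Real.sqrt_nonneg _)
  refine ⟨hint, ?_⟩
  rw [splitLaw] at hint ⊢
  rw [integral_prod _ hint]
  have h1 : ∀ θ, ∫ q, ridgeH 𝔅 μ θ q.1 i * ridgeH 𝔅 μ θ q.2 j ∂((halfLaw 𝔅 𝔇).prod (halfLaw 𝔅 𝔇))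
      = (∫ w, ridgeH 𝔅 μ θ w i ∂(halfLaw 𝔅 𝔇)) * ∫ w, ridgeH 𝔅 μ θ w j ∂(halfLaw 𝔅 𝔇) :=
    fun θ => integral_prod_mul (fun w => ridgeH 𝔅 μ θ w i) (fun w => ridgeH 𝔅 μ θ w j)
  have h2 : (meanCorr 𝔅 𝔇 μ * secondMoment 𝔅 * meanCorr 𝔅 𝔇 μ) i j
      = Pi.single i 1 ⬝ᵥ (meanCorr 𝔅 𝔇 μ * secondMoment 𝔅 * meanCorr 𝔅 𝔇 μ) *ᵥ Pi.single j 1 := by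
    rw [single_one_dotProduct, Matrix.mulVec_single_one]
    rfl
  have h3 : ∀ x, Pi.single i 1 ⬝ᵥ (meanCorr 𝔅 𝔇 μ * secondMoment 𝔅 * meanCorr 𝔅 𝔇 μ) *ᵥ x
      = meanCorr 𝔅 𝔇 μ *ᵥ Pi.single i 1 ⬝ᵥ secondMoment 𝔅 *ᵥ (meanCorr 𝔅 𝔇 μ *ᵥ x) := fun x => by
    rw [← Matrix.mulVec_mulVec, ← Matrix.mulVec_mulVec, dotProduct_mulVec_comm meanCorr_transpose]
  rw [h2, h3, form_secondMoment hR hβ]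
  refine integral_congr_ae ?_
  filter_upwards [hβ] with θ hθ
  have h4 := integral_dotProduct_ridgeH (𝔇 := 𝔇) hμ hn hθ
  have h5 := h4 (Pi.single i 1)
  have h6 := h4 (Pi.single j 1)
  simp only [dotProduct_mulVec_comm meanCorr_transpose] at h5 h6
  rw [h1, ← h5, ← h6]
  simp only [single_one_dotProduct]

theorem matExp_outerM (hμ : 0 < μ) (hR : 0 ≤ R)
    (hβ : ∀ᵐ θ ∂𝔅.latentLaw, betaVec 𝔅 θ ⬝ᵥ betaVec 𝔅 θ ≤ R ^ 2)
    (hn : ∀ᵐ e ∂𝔅.noiseLaw, |e| ≤ 2 * R) :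
    matExp (trajLaw 𝔅 𝔇) (outerM 𝔅 μ)
      = meanCorr 𝔅 𝔇 μ * secondMoment 𝔅 * meanCorr 𝔅 𝔇 μ := by
  have hsym : (meanCorr 𝔅 𝔇 μ * secondMoment 𝔅 * meanCorr 𝔅 𝔇 μ)ᵀ
      = meanCorr 𝔅 𝔇 μ * secondMoment 𝔅 * meanCorr 𝔅 𝔇 μ := by
    rw [Matrix.transpose_mul, Matrix.transpose_mul, meanCorr_transpose, secondMoment_transpose,
      Matrix.mul_assoc]
  ext i j
  simp only [matExp, Matrix.of_apply, outerM_eq]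
  rw [integral_splitTraj (measurable_splitM 𝔅 μ i j)]
  simp only [splitM_apply]
  obtain ⟨h1, h2⟩ := integral_ridgeH_mul (𝔇 := 𝔇) hμ hR hβ hn i j
  obtain ⟨h3, h4⟩ := integral_ridgeH_mul (𝔇 := 𝔇) hμ hR hβ hn j i
  simp only [mul_comm (ridgeH 𝔅 μ _ _ j) (ridgeH 𝔅 μ _ _ i)] at h3 h4
  rw [integral_const_mul, integral_add h1 h3, h2, h4, ← Matrix.transpose_apply (_ * _ * _) i j,
    hsym]
  ring

end Expectations

section SecondMoments

variable {X A : Type*} [MeasurableSpace X] [MeasurableSpace A] {dA dK L : ℕ}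
  {𝔅 : Bandit X A dA dK} {𝔇 : Design X A L} {μ R : ℝ}

/-! ### The second moment of the outer products -/

theorem matExp_splitTraj {F : EuclideanSpace ℝ (Fin dK) × Half X A L × Half X A L →
    Matrix (Fin dA) (Fin dA) ℝ} (hF : ∀ i j, Measurable fun p => F p i j) :
    matExp (trajLaw 𝔅 𝔇) (fun τ => F (splitTraj τ)) = matExp (splitLaw 𝔅 𝔇) F := by
  ext i j
  exact integral_splitTraj (hF i j)

theorem integral_sq_mul_sq_le (hμ : 0 < μ)
    (hβ : ∀ᵐ θ ∂𝔅.latentLaw, betaVec 𝔅 θ ⬝ᵥ betaVec 𝔅 θ ≤ R ^ 2)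
    (hn : ∀ᵐ e ∂𝔅.noiseLaw, |e| ≤ 2 * R) (x y : Fin dA → ℝ) :
    Integrable (fun p => (x ⬝ᵥ ridgeH 𝔅 μ p.1 p.2.1) ^ 2 * (y ⬝ᵥ ridgeH 𝔅 μ p.1 p.2.2) ^ 2)
      (splitLaw 𝔅 𝔇) ∧
    ∫ p, (x ⬝ᵥ ridgeH 𝔅 μ p.1 p.2.1) ^ 2 * (y ⬝ᵥ ridgeH 𝔅 μ p.1 p.2.2) ^ 2 ∂(splitLaw 𝔅 𝔇)
      ≤ (R ^ 2 * (1 + 4 / μ)) ^ 2 * (x ⬝ᵥ x) * (y ⬝ᵥ y) := by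
  have hx := dotProduct_self_nonneg' x
  have hy := dotProduct_self_nonneg' y
  have m1 : Measurable fun p : EuclideanSpace ℝ (Fin dK) × Half X A L × Half X A L =>
      x ⬝ᵥ ridgeH 𝔅 μ p.1 p.2.1 :=
    Finset.measurable_fun_sum _ fun i _ => measurable_const.mul (measurable_ridgeH_fst 𝔅 μ i)
  have m2 : Measurable fun p : EuclideanSpace ℝ (Fin dK) × Half X A L × Half X A L =>
      y ⬝ᵥ ridgeH 𝔅 μ p.1 p.2.2 :=
    Finset.measurable_fun_sum _ fun i _ => measurable_const.mul (measurable_ridgeH_snd 𝔅 μ i)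
  have hint : Integrable
      (fun p => (x ⬝ᵥ ridgeH 𝔅 μ p.1 p.2.1) ^ 2 * (y ⬝ᵥ ridgeH 𝔅 μ p.1 p.2.2) ^ 2)
      (splitLaw 𝔅 𝔇) := by
    refine Integrable.of_bound ((m1.pow_const 2).mul (m2.pow_const 2)).aestronglyMeasurable
      (2 * (R ^ 2 + 4 * R ^ 2 * L / μ) * (x ⬝ᵥ x) * (2 * (R ^ 2 + 4 * R ^ 2 * L / μ) * (y ⬝ᵥ y))) ?_
    filter_upwards [ae_splitLaw (𝔇 := 𝔇) hβ hn] with p ⟨h1, h2, h3⟩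
    rw [Real.norm_of_nonneg (by positivity)]
    exact mul_le_mul (sq_dotProduct_ridgeH_le 𝔅 _ hμ _ h1 h2 x)
      (sq_dotProduct_ridgeH_le 𝔅 _ hμ _ h1 h3 y) (sq_nonneg _) (by positivity)
  refine ⟨hint, ?_⟩
  rw [splitLaw] at hint ⊢
  rw [integral_prod _ hint]
  have h1 : ∀ θ, ∫ q, (x ⬝ᵥ ridgeH 𝔅 μ θ q.1) ^ 2 * (y ⬝ᵥ ridgeH 𝔅 μ θ q.2) ^ 2
      ∂((halfLaw 𝔅 𝔇).prod (halfLaw 𝔅 𝔇))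
      = (∫ w, (x ⬝ᵥ ridgeH 𝔅 μ θ w) ^ 2 ∂(halfLaw 𝔅 𝔇))
        * ∫ w, (y ⬝ᵥ ridgeH 𝔅 μ θ w) ^ 2 ∂(halfLaw 𝔅 𝔇) :=
    fun θ => integral_prod_mul (fun w => (x ⬝ᵥ ridgeH 𝔅 μ θ w) ^ 2)
      (fun w => (y ⬝ᵥ ridgeH 𝔅 μ θ w) ^ 2)
  refine (integral_mono_ae hint.integral_prod_left
    (integrable_const ((R ^ 2 * (1 + 4 / μ)) ^ 2 * (x ⬝ᵥ x) * (y ⬝ᵥ y))) ?_).trans (by simp)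
  filter_upwards [hβ] with θ hθ
  rw [h1]
  refine (mul_le_mul (integral_sq_dotProduct_ridgeH_le hμ hn hθ x)
    (integral_sq_dotProduct_ridgeH_le hμ hn hθ y) (integral_nonneg fun w => sq_nonneg _)
    (by positivity)).trans (le_of_eq (by ring))

/-- The inequality (u + v)² ≤ 2(u² + v²) in each coordinate of Mx. Every resulting term is a product
of one function of each half, so its expectation factors given θ. -/
theorem form_sq_splitM_le (p : EuclideanSpace ℝ (Fin dK) × Half X A L × Half X A L)
    (x : Fin dA → ℝ) :
    x ⬝ᵥ (splitM 𝔅 μ p ^ 2) *ᵥ x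
      ≤ 1 / 2 * ∑ i, ((Pi.single i 1 ⬝ᵥ ridgeH 𝔅 μ p.1 p.2.1) ^ 2
            * (x ⬝ᵥ ridgeH 𝔅 μ p.1 p.2.2) ^ 2
          + (x ⬝ᵥ ridgeH 𝔅 μ p.1 p.2.1) ^ 2
            * (Pi.single i 1 ⬝ᵥ ridgeH 𝔅 μ p.1 p.2.2) ^ 2) := by
  rw [sq, ← Matrix.mulVec_mulVec, dotProduct_mulVec_comm (splitM_transpose p), dotProduct,
    Finset.mul_sum]
  refine Finset.sum_le_sum fun i _ => ?_
  set a := ridgeH 𝔅 μ p.1 p.2.1 with ha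
  set b := ridgeH 𝔅 μ p.1 p.2.2 with hb
  have h : (splitM 𝔅 μ p *ᵥ x) i = 1 / 2 * (a i * (x ⬝ᵥ b) + b i * (x ⬝ᵥ a)) := by
    rw [splitM, Matrix.smul_mulVec, Matrix.add_mulVec, Matrix.vecMulVec_mulVec,
      Matrix.vecMulVec_mulVec, dotProduct_comm x, dotProduct_comm x]
    simp [ha, hb, mul_comm]
  rw [h, single_one_dotProduct, single_one_dotProduct]
  nlinarith [sq_nonneg (a i * (x ⬝ᵥ b) - b i * (x ⬝ᵥ a))]

theorem form_sq_splitM_nonneg (p : EuclideanSpace ℝ (Fin dK) × Half X A L × Half X A L)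
    (x : Fin dA → ℝ) : 0 ≤ x ⬝ᵥ (splitM 𝔅 μ p ^ 2) *ᵥ x := by
  rw [sq, ← Matrix.mulVec_mulVec, dotProduct_mulVec_comm (splitM_transpose p)]
  exact dotProduct_self_nonneg' _

/-- Each of the d_A coordinates contributes at most (R²(1 + 4/μ))² |x|². This is the factor d_A
under the root in the rate. -/
theorem norm_matExp_outerM_sq_le (hμ : 0 < μ)
    (hβ : ∀ᵐ θ ∂𝔅.latentLaw, betaVec 𝔅 θ ⬝ᵥ betaVec 𝔅 θ ≤ R ^ 2)
    (hn : ∀ᵐ e ∂𝔅.noiseLaw, |e| ≤ 2 * R) :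
    ‖matExp (trajLaw 𝔅 𝔇) fun τ => outerM 𝔅 μ τ ^ 2‖ ≤ dA * (R ^ 2 * (1 + 4 / μ)) ^ 2 := by
  simp only [outerM_eq]
  rw [matExp_splitTraj (measurable_splitM_sq 𝔅 μ)]
  have hint : ∀ i j, Integrable (fun p => (splitM 𝔅 μ p ^ 2) i j) (splitLaw 𝔅 𝔇) := fun i j => by
    refine Integrable.of_bound (measurable_splitM_sq 𝔅 μ i j).aestronglyMeasurable
      (dA * (2 * (R ^ 2 + 4 * R ^ 2 * L / μ)) ^ 2) ?_
    filter_upwards [ae_abs_splitM_sq_le (𝔇 := 𝔇) hμ hβ hn] with p h using h i j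
  refine norm_matExp_le hint
    (fun p => by rw [Matrix.transpose_pow, splitM_transpose]) (by positivity)
    form_sq_splitM_nonneg fun x => ?_
  have h1 := fun i => integral_sq_mul_sq_le (𝔇 := 𝔇) hμ hβ hn (Pi.single i 1) x
  have h2 := fun i => integral_sq_mul_sq_le (𝔇 := 𝔇) hμ hβ hn x (Pi.single i 1)
  have h12 : ∀ i ∈ (Finset.univ : Finset (Fin dA)), Integrable (fun p =>
      (Pi.single i 1 ⬝ᵥ ridgeH 𝔅 μ p.1 p.2.1) ^ 2 * (x ⬝ᵥ ridgeH 𝔅 μ p.1 p.2.2) ^ 2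
        + (x ⬝ᵥ ridgeH 𝔅 μ p.1 p.2.1) ^ 2 * (Pi.single i 1 ⬝ᵥ ridgeH 𝔅 μ p.1 p.2.2) ^ 2)
      (splitLaw 𝔅 𝔇) := fun i _ => (h1 i).1.add (h2 i).1
  have h3 : Integrable (fun p => 1 / 2 * ∑ i : Fin dA,
      ((Pi.single i 1 ⬝ᵥ ridgeH 𝔅 μ p.1 p.2.1) ^ 2 * (x ⬝ᵥ ridgeH 𝔅 μ p.1 p.2.2) ^ 2
        + (x ⬝ᵥ ridgeH 𝔅 μ p.1 p.2.1) ^ 2 * (Pi.single i 1 ⬝ᵥ ridgeH 𝔅 μ p.1 p.2.2) ^ 2))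
      (splitLaw 𝔅 𝔇) :=
    (integrable_finsetSum _ h12).const_mul _
  refine (integral_mono (integrable_form hint x x) h3 fun p => form_sq_splitM_le p x).trans ?_
  rw [integral_const_mul, integral_finsetSum _ h12]
  have h4 : ∀ i ∈ (Finset.univ : Finset (Fin dA)),
      ∫ p, ((Pi.single i 1 ⬝ᵥ ridgeH 𝔅 μ p.1 p.2.1) ^ 2 * (x ⬝ᵥ ridgeH 𝔅 μ p.1 p.2.2) ^ 2
        + (x ⬝ᵥ ridgeH 𝔅 μ p.1 p.2.1) ^ 2 * (Pi.single i 1 ⬝ᵥ ridgeH 𝔅 μ p.1 p.2.2) ^ 2)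
        ∂(splitLaw 𝔅 𝔇) ≤ 2 * ((R ^ 2 * (1 + 4 / μ)) ^ 2 * (x ⬝ᵥ x)) := fun i _ => by
    rw [integral_add (h1 i).1 (h2 i).1]
    have e1 := (h1 i).2
    have e2 := (h2 i).2
    rw [single_one_dotProduct, Pi.single_eq_same, mul_one] at e1 e2
    linarith
  have h5 := Finset.sum_le_sum h4
  rw [Finset.sum_const, Finset.card_univ, Fintype.card_fin, nsmul_eq_mul] at h5
  linarith

end SecondMoments

/-! ### Averages over a dataset -/

section Averages

theorem avg_transpose {X A : Type*} {dA dK L N : ℕ}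
    {F : Traj X A dK L → Matrix (Fin dA) (Fin dA) ℝ} (hF : ∀ τ, (F τ)ᵀ = F τ)
    (ω : Fin N → Traj X A dK L) : (avg F ω)ᵀ = avg F ω := by
  simp only [avg, Matrix.transpose_smul, Matrix.transpose_sum, hF]

theorem norm_avg_le {X A : Type*} {dA dK L N : ℕ}
    {F : Traj X A dK L → Matrix (Fin dA) (Fin dA) ℝ} (hF : ∀ τ, ‖F τ‖ ≤ 1)
    (ω : Fin N → Traj X A dK L) : ‖avg F ω‖ ≤ 1 := by
  rw [avg, norm_smul, Real.norm_of_nonneg (by positivity)]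
  have h1 : ‖∑ n, F (ω n)‖ ≤ N := by
    refine (norm_sum_le _ _).trans ?_
    simpa using Finset.sum_le_sum fun n (_ : n ∈ Finset.univ) => hF (ω n)
  calc 1 / (N : ℝ) * ‖∑ n, F (ω n)‖ ≤ 1 / N * N := by gcongr
    -- For N = 0 the left side is 0.
    _ ≤ 1 := by rw [one_div]; exact inv_mul_le_one

variable {X A : Type*} [MeasurableSpace X] [MeasurableSpace A] {dA dK L N : ℕ}
  {𝔅 : Bandit X A dA dK} {𝔇 : Design X A L} {μ R : ℝ}

theorem corrD_eq (𝔅 : Bandit X A dA dK) (μ : ℝ) (i : Fin 2) (τ : Traj X A dK L) :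
    ∃ w : Half X A L, corrD 𝔅 μ i τ = corrH 𝔅 μ w := by
  fin_cases i
  exacts [⟨(splitTraj τ).2.1, rfl⟩, ⟨(splitTraj τ).2.2, rfl⟩]

theorem barD_transpose (i : Fin 2) (ω : Fin N → Traj X A dK L) :
    (barD 𝔅 μ i ω)ᵀ = barD 𝔅 μ i ω :=
  avg_transpose (fun τ => by
    obtain ⟨w, hw⟩ := corrD_eq 𝔅 μ i τ
    rw [hw, corrH_transpose]) ω

theorem norm_barD_le (hμ : 0 < μ) (i : Fin 2) (ω : Fin N → Traj X A dK L) :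
    ‖barD 𝔅 μ i ω‖ ≤ 1 :=
  norm_avg_le (fun τ => by
    obtain ⟨w, hw⟩ := corrD_eq 𝔅 μ i τ
    rw [hw]
    exact norm_corrH_le 𝔅 w hμ) ω

theorem barM_transpose (ω : Fin N → Traj X A dK L) : (barM 𝔅 μ ω)ᵀ = barM 𝔅 μ ω :=
  avg_transpose (fun τ => by rw [outerM_eq, splitM_transpose]) ω

/-- A union bound over the three concentration events; on their intersection the claim is
deterministic for all `Uhat` and both gaps at once. Only monotonicity and subadditivity of the
measure are used, so the radii need not be measurable. -/
theorem measure_validity_failure_le (hd : 1 ≤ dK) (hdn : dK < dA) (hμ : 0 < μ) (hR : 0 ≤ R)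
    {δ : ℝ} (hδ : 0 ≤ δ) (hb : Bounded 𝔅 𝔇 R) (hA : 0 < lamA 𝔅 𝔇 μ)
    {dM dD : (Fin N → Traj X A dK L) → ℝ}
    (hM : dataLaw 𝔅 𝔇 N {ω | ¬ ‖barM 𝔅 μ ω - matExp (trajLaw 𝔅 𝔇) (outerM 𝔅 μ)‖ ≤ dM ω}
      ≤ ENNReal.ofReal (δ / 3))
    (hD : ∀ i, dataLaw 𝔅 𝔇 N
      {ω | ¬ ‖barD 𝔅 μ i ω - matExp (trajLaw 𝔅 𝔇) (corrD 𝔅 μ i)‖ ≤ dD ω}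
      ≤ ENNReal.ofReal (δ / 3)) :
    dataLaw 𝔅 𝔇 N {ω | ¬ ∀ Uhat : Matrix (Fin dA) (Fin dK) ℝ,
      IsTopEigenbasis (corrected 𝔅 μ ω) Uhat →
      ∀ g, (g = eigGap dK (barM 𝔅 μ ω) ∨ g = eigGap dK (corrected 𝔅 μ ω)) →
        OffDefined 𝔅 μ g (dD ω) ω →
        ‖Uhat * Uhatᵀ - 𝔅.Ustar * 𝔅.Ustarᵀ‖
          ≤ deltaOff dK g (normB 𝔅 μ ω) R (dM ω) (dD ω)} ≤ ENNReal.ofReal δ := by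
  have hβ := hb.betaVec_le
  have hn := hb.noise_le (pos_of_lamA_pos (by omega) hμ hA)
  have hsum : ENNReal.ofReal δ
      = ENNReal.ofReal (δ / 3) + (ENNReal.ofReal (δ / 3) + ENNReal.ofReal (δ / 3)) := by
    rw [← ENNReal.ofReal_add (by positivity) (by positivity),
      ← ENNReal.ofReal_add (by positivity) (by positivity)]
    congr 1
    ring
  rw [hsum]
  refine le_trans (measure_mono ?_) ((measure_union_le _ _).trans
    (add_le_add hM ((measure_union_le _ _).trans (add_le_add (hD 0) (hD 1)))))
  intro ω hω
  by_contra hgood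
  simp only [Set.mem_union, Set.mem_ofPred_eq, not_or, not_not] at hgood
  obtain ⟨gM, g0, g1⟩ := hgood
  refine hω fun Uhat hU g hg hdef => ?_
  rw [matExp_corrD] at g0 g1
  rw [matExp_outerM hμ hR hβ hn] at gM
  exact norm_projection_sub_le_deltaOff hd hdn (barM_transpose ω) meanCorr_transpose
    (barD_transpose 0 ω) (norm_barD_le hμ 0 ω) (hdef.1 0) (hdef.1 1) (le_max_left _ _)
    (le_max_right _ _) g0 g1 hdef.2.2 (norm_meanCorr_le hμ) (norm_secondMoment_le hR hβ)
    secondMoment_transpose (form_secondMoment_nonneg hR hβ) 𝔅.Ustar_orthonormal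
    (Ustar_mul_secondMoment hR hβ) gM hU hg hdef.2.1

end Averages

/-! ### A law of large numbers for matrices -/

theorem norm_le_of_abs_entries_le {n : ℕ} {A : Matrix (Fin n) (Fin n) ℝ} {c : ℝ} (hc : 0 ≤ c)
    (h : ∀ i j, |A i j| ≤ c) : ‖A‖ ≤ n * c := by
  refine norm_le_of_mulVec (by positivity) fun x => ?_
  have hx := dotProduct_self_nonneg' x
  have h1 : ∀ i ∈ (Finset.univ : Finset (Fin n)),
      (A *ᵥ x) i * (A *ᵥ x) i ≤ n * c ^ 2 * (x ⬝ᵥ x) := fun i _ => by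
    have h2 := Finset.sum_mul_sq_le_sq_mul_sq Finset.univ (fun j => A i j) x
    have h3 : ∑ j, A i j ^ 2 ≤ n * c ^ 2 := by
      have h4 : ∀ j ∈ (Finset.univ : Finset (Fin n)), A i j ^ 2 ≤ c ^ 2 := fun j _ =>
        sq_le_sq' (abs_le.mp (h i j)).1 (abs_le.mp (h i j)).2
      simpa using Finset.sum_le_sum h4
    have h5 : x ⬝ᵥ x = ∑ j, x j ^ 2 := Finset.sum_congr rfl fun j _ => (sq _).symm
    rw [← sq, h5]
    exact h2.trans (mul_le_mul_of_nonneg_right h3 (h5 ▸ hx))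
  refine (Finset.sum_le_sum h1).trans (le_of_eq ?_)
  rw [Finset.sum_const, Finset.card_univ, Fintype.card_fin, nsmul_eq_mul]
  ring

/-- Chebyshev's inequality. A polynomial tail is enough, since it affects only the sample size from
which the rate holds. -/
theorem measure_abs_average_sub_le {T : Type*} [MeasurableSpace T] {P : Measure T}
    [IsProbabilityMeasure P] {f : T → ℝ} (hf : Measurable f) {K : ℝ} (hK : ∀ᵐ t ∂P, |f t| ≤ K)
    {η : ℝ} (hη : 0 < η) {N : ℕ} (hN : 0 < N) :
    (Measure.pi fun _ : Fin N => P) {ω | η ≤ |1 / (N : ℝ) * ∑ n, f (ω n) - ∫ t, f t ∂P|}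
      ≤ ENNReal.ofReal (K ^ 2 / (N * η ^ 2)) := by
  have hN0 : (0 : ℝ) < N := by exact_mod_cast hN
  have hfm : MemLp f 2 P := MemLp.of_bound hf.aestronglyMeasurable K hK
  have hfn : ∀ n : Fin N, MemLp (fun ω : Fin N → T => f (ω n)) 2 (Measure.pi fun _ => P) :=
    fun n => hfm.comp_measurePreserving (measurePreserving_eval (fun _ : Fin N => P) n)
  have hsum : MemLp (fun ω : Fin N → T => 1 / (N : ℝ) * ∑ n, f (ω n)) 2 (Measure.pi fun _ => P) :=
    (memLp_finsetSum _ fun n _ => hfn n).const_mul _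
  have hmean : ∫ ω : Fin N → T, 1 / (N : ℝ) * ∑ n, f (ω n) ∂(Measure.pi fun _ => P)
      = ∫ t, f t ∂P := by
    rw [integral_const_mul, integral_finsetSum _ fun n _ => (hfn n).integrable one_le_two]
    have h1 : ∀ n ∈ (Finset.univ : Finset (Fin N)),
        ∫ ω : Fin N → T, f (ω n) ∂(Measure.pi fun _ => P) = ∫ t, f t ∂P := fun n _ =>
      integral_comp_eval (μ := fun _ : Fin N => P) hf.aestronglyMeasurable
    rw [Finset.sum_congr rfl h1]
    simp [hN0.ne']
  have hvar : Var[fun ω : Fin N → T => 1 / (N : ℝ) * ∑ n, f (ω n); Measure.pi fun _ => P]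
      ≤ K ^ 2 / N := by
    rw [variance_const_mul]
    have h2 : (fun ω : Fin N → T => ∑ n, f (ω n)) = ∑ n, fun ω : Fin N → T => f (ω n) := by
      ext ω
      simp
    have h3 : Var[f; P] ≤ K ^ 2 := by
      refine (variance_le_sq_of_bounded (a := -K) (b := K) ?_ hf.aemeasurable).trans
        (le_of_eq (by ring))
      filter_upwards [hK] with t ht using abs_le.mp ht
    rw [h2, variance_sum_pi (X := fun _ => f) fun _ => hfm, Finset.sum_const, Finset.card_univ,
      Fintype.card_fin, nsmul_eq_mul]
    calc (1 / (N : ℝ)) ^ 2 * (N * Var[f; P]) = Var[f; P] / N := by field_simp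
      _ ≤ K ^ 2 / N := by gcongr
  have h := meas_ge_le_variance_div_sq hsum hη
  rw [hmean] at h
  refine h.trans (ENNReal.ofReal_le_ofReal ?_)
  calc _ ≤ K ^ 2 / N / η ^ 2 := by gcongr
    _ = K ^ 2 / (N * η ^ 2) := by rw [div_div]

theorem measure_norm_average_sub_le {T : Type*} [MeasurableSpace T] {P : Measure T}
    [IsProbabilityMeasure P] {d : ℕ} (hd : 0 < d) {F : T → Matrix (Fin d) (Fin d) ℝ}
    (hF : ∀ i j, Measurable fun t => F t i j) {K : ℝ} (hK : ∀ᵐ t ∂P, ∀ i j, |F t i j| ≤ K)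
    {η : ℝ} (hη : 0 < η) {N : ℕ} (hN : 0 < N) :
    (Measure.pi fun _ : Fin N => P)
      {ω | ¬ ‖(1 / (N : ℝ)) • ∑ n, F (ω n) - matExp P F‖ ≤ η}
      ≤ ENNReal.ofReal (d ^ 4 * K ^ 2 / (N * η ^ 2)) := by
  have hd0 : (0 : ℝ) < d := by exact_mod_cast hd
  have hN0 : (0 : ℝ) < N := by exact_mod_cast hN
  -- If every entry deviates by less than η/d, then the operator norm of the deviation is at most d
  -- · η/d.
  have hsub : {ω : Fin N → T | ¬ ‖(1 / (N : ℝ)) • ∑ n, F (ω n) - matExp P F‖ ≤ η}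
      ⊆ ⋃ p : Fin d × Fin d,
        {ω | η / d ≤ |1 / (N : ℝ) * ∑ n, F (ω n) p.1 p.2 - ∫ t, F t p.1 p.2 ∂P|} := by
    intro ω hω
    by_contra hne
    simp only [Set.mem_iUnion, not_exists, Set.mem_ofPred_eq, not_le, Prod.forall] at hne
    refine hω (le_trans (norm_le_of_abs_entries_le (c := η / d) (by positivity) fun i j => ?_)
      (le_of_eq (by field_simp)))
    refine le_trans (le_of_eq ?_) (hne i j).le
    rw [Matrix.sub_apply, Matrix.smul_apply, Matrix.sum_apply, smul_eq_mul]
    rfl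
  refine (measure_mono hsub).trans ((measure_iUnion_fintype_le _ _).trans ?_)
  refine (Finset.sum_le_sum fun p _ => measure_abs_average_sub_le (hF p.1 p.2)
    (hK.mono fun t ht => ht p.1 p.2) (div_pos hη hd0) hN).trans (le_of_eq ?_)
  rw [Finset.sum_const, Finset.card_univ, Fintype.card_prod, Fintype.card_fin, nsmul_eq_mul,
    ← ENNReal.ofReal_natCast, ← ENNReal.ofReal_mul (by positivity)]
  congr 1
  push_cast
  field_simp

/-- The quantifiers matter: the threshold on N depends on d, K, η and ε, and serves all laws P and
statistics F. -/
theorem eventually_measure_norm_average_sub_le (d : ℕ) (hd : 0 < d) (K : ℝ) {η ε : ℝ}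
    (hη : 0 < η) (hε : 0 < ε) :
    ∀ᶠ N : ℕ in Filter.atTop, ∀ (T : Type*) [MeasurableSpace T] (P : Measure T)
      [IsProbabilityMeasure P] (F : T → Matrix (Fin d) (Fin d) ℝ),
      (∀ i j, Measurable fun t => F t i j) → (∀ᵐ t ∂P, ∀ i j, |F t i j| ≤ K) →
      (Measure.pi fun _ : Fin N => P)
        {ω | ¬ ‖(1 / (N : ℝ)) • ∑ n, F (ω n) - matExp P F‖ ≤ η} ≤ ENNReal.ofReal ε := by
  have hlim : Filter.Tendsto (fun N : ℕ => d ^ 4 * K ^ 2 / η ^ 2 / (N : ℝ)) Filter.atTop (nhds 0) :=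
    tendsto_const_div_atTop_nhds_zero_nat _
  filter_upwards [hlim.eventually_le_const hε, Filter.eventually_gt_atTop 0]
    with N h1 h2 T _ P _ F hF hK
  refine (measure_norm_average_sub_le hd hF hK hη h2).trans (ENNReal.ofReal_le_ofReal ?_)
  rwa [mul_comm (N : ℝ), ← div_div]

/-! ### Deterministic consequences of concentration -/

section Rate

variable {n d : ℕ} {M S D D₀ D₁ : Matrix (Fin n) (Fin n) ℝ} {U : Matrix (Fin n) (Fin d) ℝ}

/-- Provides the test space on which the reflection 2UUᵀ − I is negative, as needed for
`lam_le_of_form`. -/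
theorem exists_complement_columns (U : Matrix (Fin n) (Fin d) ℝ) :
    ∃ W : Matrix (Fin n) (Fin (n - d)) ℝ, Wᵀ * W = 1 ∧ ∀ y, Uᵀ *ᵥ (W *ᵥ y) = 0 := by
  have hform : ∀ x, x ⬝ᵥ (U * Uᵀ) *ᵥ x = Uᵀ *ᵥ x ⬝ᵥ Uᵀ *ᵥ x := fun x => by
    rw [mulVec_dotProduct_mulVec, Matrix.transpose_transpose]
  obtain ⟨O, e, hO, hA, -⟩ := exists_spectral (A := U * Uᵀ)
    (by rw [Matrix.transpose_mul, Matrix.transpose_transpose])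
  have hcard := card_le_of_form_le hO (e := e) (b := 0) U fun x hx => by
    rw [← hA, hform, hx, dotProduct_zero, zero_mul]
  have hcard' : n - d ≤ (Finset.univ.filter fun i => ¬ 0 < e i).card := by
    have := Finset.card_filter_add_card_filter_not (s := (Finset.univ : Finset (Fin n)))
      (fun i => 0 < e i)
    rw [Finset.card_univ, Fintype.card_fin] at this
    omega
  obtain ⟨f, hf, hfs⟩ := exists_columns _ hcard'
  refine ⟨O.submatrix id f, submatrix_columns_orthonormal hO hf, fun y => ?_⟩
  rw [← dotProduct_self_eq_zero]
  refine le_antisymm ?_ (dotProduct_self_nonneg' _)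
  rw [← hform, hA, form_diagonal]
  refine Finset.sum_nonpos fun i _ => ?_
  by_cases h0 : (Oᵀ *ᵥ (O.submatrix id f *ᵥ y)) i = 0
  · rw [h0, mul_zero, mul_zero]
  · obtain ⟨j, rfl⟩ := orthogonal_mulVec_columns hO f y h0
    exact mul_nonpos_of_nonpos_of_nonneg (not_lt.mp (Finset.mem_filter.mp (hfs j)).2)
      (mul_self_nonneg _)

/-- The reflection J fixes the range of S, so JS = S. With p = |Uᵀx|² the form is at least (s − c)p
+ c(|x|² − p) − F|x|², positive whenever c is farther than F from both 0 and s. -/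
theorem form_reflection (hU : Uᵀ * U = 1) (hSt : Sᵀ = S) (hSU : U * (Uᵀ * S) = S) {s c F : ℝ}
    (hS : ∀ a, s * (a ⬝ᵥ a) ≤ U *ᵥ a ⬝ᵥ S *ᵥ (U *ᵥ a)) {A : Matrix (Fin n) (Fin n) ℝ}
    (hA : ‖A - S‖ ≤ F) (hc : F < c) (hcs : F < s - c) {x : Fin n → ℝ} (hx : x ≠ 0) :
    0 < x ⬝ᵥ ((2 : ℝ) • (U * Uᵀ) - 1) *ᵥ (A *ᵥ x - c • x) := by
  set J : Matrix (Fin n) (Fin n) ℝ := (2 : ℝ) • (U * Uᵀ) - 1 with hJ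
  have hJt : Jᵀ = J := by
    rw [hJ, Matrix.transpose_sub, Matrix.transpose_smul, Matrix.transpose_mul,
      Matrix.transpose_transpose, Matrix.transpose_one]
  have hJx : ∀ x, J *ᵥ x = (2 : ℝ) • (U *ᵥ (Uᵀ *ᵥ x)) - x := fun x => by
    rw [hJ, Matrix.sub_mulVec, Matrix.smul_mulVec, Matrix.one_mulVec, Matrix.mulVec_mulVec]
  have hxU : x ⬝ᵥ U *ᵥ (Uᵀ *ᵥ x) = Uᵀ *ᵥ x ⬝ᵥ Uᵀ *ᵥ x := by
    rw [Matrix.dotProduct_mulVec, ← Matrix.mulVec_transpose]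
  have hJJ : J *ᵥ x ⬝ᵥ J *ᵥ x = x ⬝ᵥ x := by
    rw [hJx]
    simp only [dotProduct_sub, sub_dotProduct, dotProduct_smul, smul_dotProduct, smul_eq_mul,
      mulVec_dotProduct_self_of_orthonormal hU, hxU, dotProduct_comm (U *ᵥ (Uᵀ *ᵥ x)) x]
    ring
  have hJS : J *ᵥ (S *ᵥ x) = S *ᵥ x := by
    rw [hJx, Matrix.mulVec_mulVec x Uᵀ, Matrix.mulVec_mulVec x U, hSU, two_smul,
      add_sub_cancel_right]
  have hSU' : S *ᵥ (U *ᵥ (Uᵀ *ᵥ x)) = S *ᵥ x := by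
    have h := congrArg Matrix.transpose hSU
    rw [Matrix.transpose_mul, Matrix.transpose_mul, Matrix.transpose_transpose, hSt,
      Matrix.mul_assoc] at h
    rw [Matrix.mulVec_mulVec, Matrix.mulVec_mulVec, Matrix.mul_assoc, h]
  have hform : U *ᵥ (Uᵀ *ᵥ x) ⬝ᵥ S *ᵥ (U *ᵥ (Uᵀ *ᵥ x)) = x ⬝ᵥ S *ᵥ x := by
    rw [hSU', dotProduct_mulVec_comm hSt, hSU', ← dotProduct_mulVec_comm hSt]
  have h1 : x ⬝ᵥ J *ᵥ (A *ᵥ x - c • x)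
      = x ⬝ᵥ S *ᵥ x - c * (x ⬝ᵥ J *ᵥ x) + J *ᵥ x ⬝ᵥ (A - S) *ᵥ x := by
    rw [← dotProduct_mulVec_comm hJt, Matrix.sub_mulVec A S, Matrix.mulVec_sub J,
      Matrix.mulVec_sub J, hJS, Matrix.mulVec_smul, dotProduct_sub,
      dotProduct_sub, dotProduct_smul, smul_eq_mul]
    ring
  have h2 := (abs_le.mp (abs_dotProduct_mulVec_le (A - S) hJJ.le)).1
  have h3 := hS (Uᵀ *ᵥ x)
  rw [hform] at h3
  have h4 : x ⬝ᵥ J *ᵥ x = 2 * (Uᵀ *ᵥ x ⬝ᵥ Uᵀ *ᵥ x) - x ⬝ᵥ x := by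
    rw [hJx, dotProduct_sub, dotProduct_smul, hxU, smul_eq_mul]
  have h5 := dotProduct_self_pos hx
  have h6 := dotProduct_self_nonneg' (Uᵀ *ᵥ x)
  have h7 := dotProduct_self_nonneg' (x - U *ᵥ (Uᵀ *ᵥ x))
  rw [residual_dotProduct_self hU] at h7
  have h8 := mul_le_mul_of_nonneg_right hA h5.le
  rw [h1, h4]
  set p := Uᵀ *ᵥ x ⬝ᵥ Uᵀ *ᵥ x
  have h9 : 0 < (s - c - F) * p + (c - F) * (x ⬝ᵥ x - p) := by
    rcases h6.eq_or_lt with h0 | h0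
    · rw [← h0, mul_zero, zero_add, sub_zero]
      exact mul_pos (by linarith) h5
    · exact add_pos_of_pos_of_nonneg (mul_pos (by linarith) h0) (mul_nonneg (by linarith) h7)
  linarith

/-- As F < s/4, both levels 3s/4 and s/4 are admissible in `form_reflection`. One bounds λ_d(A) from
below, the other λ_{d+1}(A) from above. -/
theorem half_le_eigGap (hd : 1 ≤ d) (hdn : d < n) (hU : Uᵀ * U = 1) (hSt : Sᵀ = S)
    (hSU : U * (Uᵀ * S) = S) {s F : ℝ} (hS : ∀ a, s * (a ⬝ᵥ a) ≤ U *ᵥ a ⬝ᵥ S *ᵥ (U *ᵥ a))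
    {A : Matrix (Fin n) (Fin n) ℝ} (hA : ‖A - S‖ ≤ F) (hF : F < s / 4) :
    s / 2 ≤ eigGap d A := by
  have hF0 : 0 ≤ F := (norm_nonneg _).trans hA
  set J : Matrix (Fin n) (Fin n) ℝ := (2 : ℝ) • (U * Uᵀ) - 1 with hJ
  have hJt : Jᵀ = J := by
    rw [hJ, Matrix.transpose_sub, Matrix.transpose_smul, Matrix.transpose_mul,
      Matrix.transpose_transpose, Matrix.transpose_one]
  have hJx : ∀ x, J *ᵥ x = (2 : ℝ) • (U *ᵥ (Uᵀ *ᵥ x)) - x := fun x => by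
    rw [hJ, Matrix.sub_mulVec, Matrix.smul_mulVec, Matrix.one_mulVec, Matrix.mulVec_mulVec]
  have h1 : 3 * s / 4 ≤ lam d A := by
    refine le_lam_of_form A J (3 * s / 4) hd hJt
      (fun x hx => form_reflection hU hSt hSU hS hA (by linarith) (by linarith) hx) U
      (fun y hy => ?_) fun y => ?_
    · rw [← dotProduct_self_eq_zero, ← mulVec_dotProduct_self_of_orthonormal hU, hy,
        dotProduct_zero]
    · rw [hJx, Matrix.mulVec_mulVec y Uᵀ, hU, Matrix.one_mulVec, two_smul, add_sub_cancel_right]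
      exact dotProduct_self_nonneg' _
  have h2 : lam (d + 1) A ≤ s / 4 := by
    obtain ⟨W, hW, hUW⟩ := exists_complement_columns U
    refine lam_le_of_form A J (s / 4) (by omega) (Nat.add_sub_cancel' hdn.le) hJt
      (fun x hx => form_reflection hU hSt hSU hS hA (by linarith) (by linarith) hx) W
      (fun y hy => ?_) fun y => ?_
    · rw [← dotProduct_self_eq_zero, ← mulVec_dotProduct_self_of_orthonormal hW, hy,
        dotProduct_zero]
    · rw [hJx, hUW, Matrix.mulVec_zero, smul_zero, zero_sub, dotProduct_neg, neg_nonpos]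
      exact dotProduct_self_nonneg' _
  rw [eigGap]
  linarith

end Rate

/-! ### Size of the error bound when the statistics are close to their means -/

section Rate

theorem errorSum_le {B R dM dD : ℝ} (hB : 0 < B) (hd : 0 ≤ dD) (hM : 0 ≤ dM)
    (hx : B * dD ≤ 1 / 2) :
    errorSum B R dM dD ≤ 8 * B ^ 3 * (R ^ 2 + dM) * dD + 4 * B ^ 2 * dM := by
  have h0 : 0 ≤ B * dD := by positivity
  have h1 : 0 < 1 - B * dD := by linarith
  have h2 : (2 - B * dD) / (1 - B * dD) ^ 2 ≤ 8 := by
    rw [div_le_iff₀ (by positivity)]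
    nlinarith
  have h3 : (B / (1 - B * dD)) ^ 2 ≤ 4 * B ^ 2 := by
    have h4 : B / (1 - B * dD) ≤ 2 * B := by
      rw [div_le_iff₀ h1]
      nlinarith
    calc (B / (1 - B * dD)) ^ 2 ≤ (2 * B) ^ 2 := by gcongr
      _ = 4 * B ^ 2 := by ring
  rw [errorSum, mul_div_assoc]
  calc B ^ 3 * ((2 - B * dD) / (1 - B * dD) ^ 2) * (R ^ 2 + dM) * dD + (B / (1 - B * dD)) ^ 2 * dM
      ≤ B ^ 3 * 8 * (R ^ 2 + dM) * dD + 4 * B ^ 2 * dM := by gcongr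
    _ = _ := by ring

theorem isUnit_of_form_of_norm_sub_le {n : ℕ} {D E : Matrix (Fin n) (Fin n) ℝ} {c η : ℝ}
    (hc : 0 < c) (hD : ∀ x, c * (x ⬝ᵥ x) ≤ x ⬝ᵥ D *ᵥ x) (hE : ‖E - D‖ ≤ η) (hη : η ≤ c / 2) :
    IsUnit E ∧ ‖E⁻¹‖ ≤ 2 / c := by
  have h := isUnit_of_form (A := E) (c := c / 2) (by positivity) fun x => by
    have h1 := (abs_le.mp (abs_dotProduct_mulVec_le (E - D) (le_refl (x ⬝ᵥ x)))).1
    rw [Matrix.sub_mulVec, dotProduct_sub] at h1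
    have h2 := mul_le_mul_of_nonneg_right (hE.trans hη) (dotProduct_self_nonneg' x)
    linarith [hD x]
  rwa [one_div_div] at h

/-- Close to their expectations, the statistics yield a well-defined and small error bound. -/
theorem deltaOff_le_of_close {n d : ℕ} {M S D D₀ D₁ : Matrix (Fin n) (Fin n) ℝ}
    {U : Matrix (Fin n) (Fin d) ℝ} {R c s η dM dD : ℝ} (hd : 1 ≤ d) (hdn : d < n)
    (hU : Uᵀ * U = 1) (hSt : Sᵀ = S) (hSU : U * (Uᵀ * S) = S)
    (hS : ∀ a, s * (a ⬝ᵥ a) ≤ U *ᵥ a ⬝ᵥ S *ᵥ (U *ᵥ a)) (hSn : ‖S‖ ≤ R ^ 2)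
    (hDn : ‖D‖ ≤ 1) (hc : 0 < c) (hD : ∀ x, c * (x ⬝ᵥ x) ≤ x ⬝ᵥ D *ᵥ x) (hD₀n : ‖D₀‖ ≤ 1)
    (hD₀ : ‖D₀ - D‖ ≤ η) (hD₁ : ‖D₁ - D‖ ≤ η) (hM : ‖M - D * S * D‖ ≤ η) (hηc : η ≤ c / 4)
    (hηs : 8 * (2 / c) ^ 3 * (R ^ 2 + η) * η + 4 * (2 / c) ^ 2 * η < s / 4) (hdD : 0 ≤ dD)
    (hdDc : dD ≤ c / 4) (hdM : 0 ≤ dM) (hdMR : dM ≤ R ^ 2) :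
    IsUnit D₀ ∧ IsUnit D₁ ∧ 0 < eigGap d (D₀⁻¹ * M * D₁⁻¹) ∧ max ‖D₀⁻¹‖ ‖D₁⁻¹‖ * dD < 1 ∧
      deltaOff d (eigGap d (D₀⁻¹ * M * D₁⁻¹)) (max ‖D₀⁻¹‖ ‖D₁⁻¹‖) R dM dD
        ≤ 4 * √(2 * d) / s * (8 * (2 / c) ^ 3 * (2 * R ^ 2) * dD + 4 * (2 / c) ^ 2 * dM) := by
  have hη : 0 ≤ η := (norm_nonneg _).trans hM
  obtain ⟨u0, n0⟩ := isUnit_of_form_of_norm_sub_le hc hD hD₀ (by linarith)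
  obtain ⟨u1, n1⟩ := isUnit_of_form_of_norm_sub_le hc hD hD₁ (by linarith)
  have hB1 := one_le_of_norm_inv_le (by omega) hD₀n u0 (le_max_left ‖D₀⁻¹‖ ‖D₁⁻¹‖)
  have hBc : max ‖D₀⁻¹‖ ‖D₁⁻¹‖ ≤ 2 / c := max_le n0 n1
  have hb0 := le_max_left ‖D₀⁻¹‖ ‖D₁⁻¹‖
  have hb1 := le_max_right ‖D₀⁻¹‖ ‖D₁⁻¹‖
  set B := max ‖D₀⁻¹‖ ‖D₁⁻¹‖
  have hB0 : 0 < B := by linarith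
  have hsmall : ∀ y, 0 ≤ y → y ≤ c / 4 → B * y ≤ 1 / 2 := fun y hy hyc =>
    calc B * y ≤ 2 / c * (c / 4) := mul_le_mul hBc hyc hy (by positivity)
      _ = 1 / 2 := by field_simp; norm_num
  have hxη := hsmall η hη hηc
  have hx := hsmall dD hdD hdDc
  -- `errorSum` plays two roles: at the tolerance η it controls the actual error and opens the gap;
  -- at dM, dD it is the quantity to be bounded. The radii need not dominate the actual deviations
  -- here.
  have hF := norm_corrected_sub_le (R := R) u0 u1 hB0 hb0 hb1 hD₀ hD₁ (by linarith) hDn hSn hM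
  have hF2 : errorSum B R η η ≤ 8 * (2 / c) ^ 3 * (R ^ 2 + η) * η + 4 * (2 / c) ^ 2 * η :=
    (errorSum_le hB0 hη hη hxη).trans (by gcongr)
  have hgap := half_le_eigGap hd hdn hU hSt hSU hS (hF.trans hF2) hηs
  have hs : 0 < s := by
    have : 0 ≤ 8 * (2 / c) ^ 3 * (R ^ 2 + η) * η + 4 * (2 / c) ^ 2 * η := by positivity
    linarith
  refine ⟨u0, u1, by linarith, by linarith, ?_⟩
  have h1 : errorSum B R dM dD ≤ 8 * (2 / c) ^ 3 * (2 * R ^ 2) * dD + 4 * (2 / c) ^ 2 * dM := by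
    refine (errorSum_le hB0 hdD hdM hx).trans ?_
    have : R ^ 2 + dM ≤ 2 * R ^ 2 := by linarith
    gcongr
  have h2 : 2 * √(2 * d) / eigGap d (D₀⁻¹ * M * D₁⁻¹) ≤ 4 * √(2 * d) / s :=
    calc 2 * √(2 * d) / eigGap d (D₀⁻¹ * M * D₁⁻¹) ≤ 2 * √(2 * d) / (s / 2) := by gcongr
      _ = 4 * √(2 * d) / s := by field_simp; norm_num
  change 2 * √(2 * d) / eigGap d (D₀⁻¹ * M * D₁⁻¹) * errorSum B R dM dD ≤ _
  calc _ ≤ 2 * √(2 * d) / eigGap d (D₀⁻¹ * M * D₁⁻¹)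
        * (8 * (2 / c) ^ 3 * (2 * R ^ 2) * dD + 4 * (2 / c) ^ 2 * dM) := by
        refine mul_le_mul_of_nonneg_left h1 (div_nonneg (by positivity) (by linarith))
    _ ≤ _ := mul_le_mul_of_nonneg_right h2 (by positivity)

/-- Constants: √2 ≤ 3/2 gives 6 = 4 · 3/2, and 384 = 8 · 8 · 2 · 3, 48 = 4 · 4 · 3. As c ≤ 1, the
factor c⁻² is absorbed into c⁻³, and R² cancels. -/
theorem rate_le {R T c k q r dM dD : ℝ} (hR : 0 < R) (hT : 0 < T) (hc : 0 < c) (hc1 : c ≤ 1)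
    (hk : 0 ≤ k) (hq : 0 ≤ q) (hr : 0 ≤ r) (hD : dD ≤ 3 * r) (hM : dM ≤ 3 * k * R ^ 2 * r) :
    4 * (√2 * q) / (R ^ 2 * T)
        * (8 * (2 / c) ^ 3 * (2 * R ^ 2) * dD + 4 * (2 / c) ^ 2 * dM)
      ≤ 6 * (384 + 48 * k) * (1 / (T * c ^ 3)) * (q * r) := by
  have h2 : √2 ≤ 3 / 2 := by
    rw [Real.sqrt_le_left (by norm_num)]
    norm_num
  have h3 : (2 / c) ^ 2 ≤ 4 / c ^ 3 := by
    rw [div_pow, div_le_div_iff₀ (by positivity) (by positivity)]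
    have : c ^ 3 ≤ c ^ 2 := pow_le_pow_of_le_one hc.le hc1 (by norm_num)
    linarith
  calc 4 * (√2 * q) / (R ^ 2 * T)
        * (8 * (2 / c) ^ 3 * (2 * R ^ 2) * dD + 4 * (2 / c) ^ 2 * dM)
      ≤ 4 * (√2 * q) / (R ^ 2 * T)
        * (8 * (2 / c) ^ 3 * (2 * R ^ 2) * (3 * r) + 4 * (2 / c) ^ 2 * (3 * k * R ^ 2 * r)) := by
        gcongr
    _ ≤ 4 * (3 / 2 * q) / (R ^ 2 * T)
        * (8 * (2 / c) ^ 3 * (2 * R ^ 2) * (3 * r) + 4 * (4 / c ^ 3) * (3 * k * R ^ 2 * r)) := by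
        gcongr
    _ = 6 * (384 + 48 * k) * (1 / (T * c ^ 3)) * (q * r) := by
        field_simp
        ring

/-- With v = (2l/N)^{1/4} the left side consists of terms in v³ and v⁴, whereas √(l/N) = v²/√2. -/
theorem eventually_lower_order_le (b : ℝ) {l R : ℝ} (hl : 0 ≤ l) (hR : 0 < R) :
    ∀ᶠ N : ℕ in Filter.atTop,
      b * (2 * l / N) ^ (3 / 4 : ℝ) + 2 * b * (l / (3 * N)) ≤ R ^ 2 * √(l / N) := by
  have h1 : Filter.Tendsto (fun N : ℕ => (2 * l / (N : ℝ)) ^ (1 / 4 : ℝ)) Filter.atTop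
      (nhds 0) := by
    have h2 := (tendsto_const_div_atTop_nhds_zero_nat (2 * l)).rpow_const
      (p := (1 / 4 : ℝ)) (Or.inr (by norm_num))
    rwa [Real.zero_rpow (by norm_num)] at h2
  have h2 : Filter.Tendsto (fun v : ℝ => b * v + b / 3 * v ^ 2) (nhds 0) (nhds 0) := by
    have : Continuous fun v : ℝ => b * v + b / 3 * v ^ 2 := by fun_prop
    simpa using this.tendsto 0
  filter_upwards [(h2.comp h1).eventually_le_const (show 0 < R ^ 2 / 2 by positivity)] with N hN
  simp only [Function.comp_apply] at hN
  set w := 2 * l / (N : ℝ) with hw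
  have hw0 : 0 ≤ w := by positivity
  set v := w ^ (1 / 4 : ℝ) with hv
  have hv0 : 0 ≤ v := by positivity
  have e3 : w ^ (3 / 4 : ℝ) = v ^ 3 := by
    rw [hv, ← Real.rpow_natCast, ← Real.rpow_mul hw0]
    norm_num
  have e4 : w = v ^ 4 := by
    rw [hv, ← Real.rpow_natCast, ← Real.rpow_mul hw0]
    norm_num
  have e5 : l / (3 * N) = v ^ 4 / 6 := by
    rw [← e4, hw]
    ring
  have e6 : v ^ 2 / 2 ≤ √(l / N) := by
    refine Real.le_sqrt_of_sq_le ?_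
    have : l / N = v ^ 4 / 2 := by rw [← e4, hw]; ring
    rw [this]
    nlinarith [pow_nonneg hv0 4]
  rw [e3, e5]
  calc b * v ^ 3 + 2 * b * (v ^ 4 / 6) = (b * v + b / 3 * v ^ 2) * v ^ 2 := by ring
    _ ≤ R ^ 2 / 2 * v ^ 2 := by gcongr
    _ = R ^ 2 * (v ^ 2 / 2) := by ring
    _ ≤ R ^ 2 * √(l / N) := by gcongr

theorem log_four_mul_div_le {n : ℕ} (hn : 2 ≤ n) {δ : ℝ} (hδ : 0 < δ) (hδ1 : δ < 1) :
    Real.log (4 * n / δ) ≤ 4 * Real.log (n / δ) := by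
  have hn' : (2 : ℝ) ≤ n := by exact_mod_cast hn
  have h2 : (2 : ℝ) ≤ n / δ := by
    rw [le_div_iff₀ hδ]
    nlinarith
  have h4 : 4 * (n : ℝ) / δ ≤ (n / δ) ^ 4 := by
    have h5 : (4 : ℝ) ≤ (n / δ) ^ 3 := by
      have := pow_le_pow_left₀ (by norm_num) h2 3
      linarith
    have : 4 * (n / δ) ≤ (n / δ) ^ 3 * (n / δ) := by gcongr
    calc 4 * (n : ℝ) / δ = 4 * (n / δ) := by ring
      _ ≤ _ := this
      _ = _ := by ring
  calc Real.log (4 * n / δ) ≤ Real.log ((n / δ) ^ 4) := Real.log_le_log (by positivity) h4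
    _ = 4 * Real.log (n / δ) := by rw [Real.log_pow]; norm_num

/-- The expression decreases in c and tends to 0 with η, so an η chosen for the lower bounds a and s
works for all larger values. -/
theorem exists_tolerance {a s R : ℝ} (ha : 0 < a) (hs : 0 < s) :
    ∃ η, 0 < η ∧ ∀ c s', a ≤ c → s ≤ s' → η ≤ c / 4 ∧
      8 * (2 / c) ^ 3 * (R ^ 2 + η) * η + 4 * (2 / c) ^ 2 * η < s' / 4 := by
  have hcont : Filter.Tendsto
      (fun η : ℝ => 8 * (2 / a) ^ 3 * (R ^ 2 + η) * η + 4 * (2 / a) ^ 2 * η)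
      (nhdsWithin 0 (Set.Ioi 0)) (nhds 0) := by
    have : Continuous fun η : ℝ => 8 * (2 / a) ^ 3 * (R ^ 2 + η) * η + 4 * (2 / a) ^ 2 * η := by
      fun_prop
    have h := this.tendsto 0
    simp only [mul_zero, add_zero] at h
    exact h.mono_left nhdsWithin_le_nhds
  have h1 := hcont.eventually_lt_const (show 0 < s / 4 by positivity)
  have h2 : ∀ᶠ η : ℝ in nhdsWithin 0 (Set.Ioi 0), η ∈ Set.Ioc 0 (a / 4) :=
    Ioc_mem_nhdsGT (by positivity)
  obtain ⟨η, h3, h4, h5⟩ := (h1.and h2).exists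
  refine ⟨η, h4, fun c s' hc hs' => ⟨by linarith, lt_of_le_of_lt ?_ (h3.trans_le (by linarith))⟩⟩
  have hη : 0 ≤ η := le_of_lt h4
  have hc0 : 0 < c := by linarith
  gcongr

end Rate

/-! ### The rate for the bandit statistics -/

section Concentration

variable {X A : Type*} [MeasurableSpace X] [MeasurableSpace A] {dA dK L N : ℕ}
  {𝔅 : Bandit X A dA dK} {𝔇 : Design X A L} {μ R : ℝ}

theorem measurable_corrD (𝔅 : Bandit X A dA dK) (𝔇 : Design X A L) (μ : ℝ) (i : Fin 2)
    (k l : Fin dA) : Measurable fun τ : Traj X A dK L => corrD 𝔅 μ i τ k l := by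
  have hs := (measurePreserving_splitTraj 𝔅 𝔇).measurable
  have hm := measurable_corrH (L := L) 𝔅 μ k l
  fin_cases i
  · have h := hm.comp (measurable_fst.comp (measurable_snd.comp hs))
    simp only [Function.comp_def] at h
    exact h
  · have h := hm.comp (measurable_snd.comp (measurable_snd.comp hs))
    simp only [Function.comp_def] at h
    exact h

theorem measurable_comp_splitTraj (𝔅 : Bandit X A dA dK) (𝔇 : Design X A L)
    {f : EuclideanSpace ℝ (Fin dK) × Half X A L × Half X A L → ℝ} (hf : Measurable f) :
    Measurable fun τ : Traj X A dK L => f (splitTraj τ) :=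
  hf.comp (measurePreserving_splitTraj 𝔅 𝔇).measurable

theorem norm_avg_sq_le (hμ : 0 < μ)
    (hβ : ∀ᵐ θ ∂𝔅.latentLaw, betaVec 𝔅 θ ⬝ᵥ betaVec 𝔅 θ ≤ R ^ 2)
    (hn : ∀ᵐ e ∂𝔅.noiseLaw, |e| ≤ 2 * R) (hd : 1 ≤ dA) {ω : Fin N → Traj X A dK L}
    (h : ‖avg (fun τ => outerM 𝔅 μ τ ^ 2) ω
      - matExp (trajLaw 𝔅 𝔇) (fun τ => outerM 𝔅 μ τ ^ 2)‖ ≤ R ^ 4) :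
    ‖avg (fun τ => outerM 𝔅 μ τ ^ 2) ω‖ ≤ 2 * dA * (R ^ 2 * (1 + 4 / μ)) ^ 2 := by
  have h1 := norm_matExp_outerM_sq_le (𝔇 := 𝔇) hμ hβ hn
  have h2 := norm_le_norm_add_norm_sub' (avg (fun τ => outerM 𝔅 μ τ ^ 2) ω)
    (matExp (trajLaw 𝔅 𝔇) (fun τ => outerM 𝔅 μ τ ^ 2))
  have hd' : (1 : ℝ) ≤ dA := by exact_mod_cast hd
  have h3 : R ^ 4 ≤ dA * (R ^ 2 * (1 + 4 / μ)) ^ 2 := by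
    have h4 : 1 ≤ (1 + 4 / μ) ^ 2 := one_le_pow₀ (by linarith [show 0 < 4 / μ by positivity])
    calc R ^ 4 = 1 * (R ^ 4 * 1) := by ring
      _ ≤ dA * (R ^ 4 * (1 + 4 / μ) ^ 2) := by gcongr
      _ = _ := by ring
  linarith

/-- The square root term accounts for 2 of the factor 3, the lower-order terms for the remaining 1.
-/
theorem radiusM_le {δ l : ℝ} (hμ : 0 < μ) (hl : 0 ≤ l) (hlδ : l = Real.log (4 * dA / δ))
    (hd : 1 ≤ dA) {ω : Fin N → Traj X A dK L}
    (h : ‖avg (fun τ => outerM 𝔅 μ τ ^ 2) ω‖ ≤ 2 * dA * (R ^ 2 * (1 + 4 / μ)) ^ 2)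
    (hlow : 2 * R ^ 2 * (2 + ((2 * L : ℕ) : ℝ) / (2 * μ)) * (2 * l / N) ^ (3 / 4 : ℝ)
      + 2 * (2 * R ^ 2 * (2 + ((2 * L : ℕ) : ℝ) / (2 * μ))) * (l / (3 * N))
      ≤ R ^ 2 * √(l / N)) :
    radiusM 𝔅 μ R δ ω ≤ 3 * (1 + 4 / μ) * R ^ 2 * (√dA * √(l / N)) := by
  have hd' : (1 : ℝ) ≤ √dA := by rw [Real.one_le_sqrt]; exact_mod_cast hd
  have hμ4 : 0 < 4 / μ := by positivity
  have h1 : √(2 * ‖avg (fun τ => outerM 𝔅 μ τ ^ 2) ω‖ * (l / N))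
      ≤ 2 * (R ^ 2 * (1 + 4 / μ)) * (√dA * √(l / N)) := by
    rw [← Real.sqrt_mul (by positivity), Real.sqrt_le_left (by positivity), mul_pow,
      Real.sq_sqrt (by positivity)]
    calc 2 * ‖avg (fun τ => outerM 𝔅 μ τ ^ 2) ω‖ * (l / N)
        ≤ 2 * (2 * dA * (R ^ 2 * (1 + 4 / μ)) ^ 2) * (l / N) := by gcongr
      _ = _ := by ring
  have h2 : R ^ 2 * √(l / N) ≤ (1 + 4 / μ) * R ^ 2 * (√dA * √(l / N)) :=
    calc R ^ 2 * √(l / N) = 1 * R ^ 2 * (1 * √(l / N)) := by ring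
      _ ≤ _ := by gcongr; linarith
  rw [radiusM, ← hlδ]
  linarith

theorem radiusM_nonneg {δ : ℝ} (hμ : 0 < μ) (hl : 0 ≤ Real.log (4 * dA / δ))
    (ω : Fin N → Traj X A dK L) : 0 ≤ radiusM 𝔅 μ R δ ω := by
  rw [radiusM]
  positivity

theorem measure_good_compl_le {Ω : Type*} [MeasurableSpace Ω] {P : Measure Ω} {δ : ℝ}
    (hδ : 0 ≤ δ) {p₁ p₂ p₃ p₄ q : Ω → Prop} (h₁ : P {ω | ¬ p₁ ω} ≤ ENNReal.ofReal (δ / 4))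
    (h₂ : P {ω | ¬ p₂ ω} ≤ ENNReal.ofReal (δ / 4)) (h₃ : P {ω | ¬ p₃ ω} ≤ ENNReal.ofReal (δ / 4))
    (h₄ : P {ω | ¬ p₄ ω} ≤ ENNReal.ofReal (δ / 4))
    (h : ∀ ω, p₁ ω → p₂ ω → p₃ ω → p₄ ω → q ω) : P {ω | ¬ q ω} ≤ ENNReal.ofReal δ := by
  have hsum : ENNReal.ofReal δ = ENNReal.ofReal (δ / 4) + (ENNReal.ofReal (δ / 4)
      + (ENNReal.ofReal (δ / 4) + ENNReal.ofReal (δ / 4))) := by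
    rw [← ENNReal.ofReal_add (by positivity) (by positivity),
      ← ENNReal.ofReal_add (by positivity) (by positivity),
      ← ENNReal.ofReal_add (by positivity) (by positivity)]
    congr 1
    ring
  rw [hsum]
  refine le_trans (measure_mono ?_) ((measure_union_le _ _).trans (add_le_add h₁
    ((measure_union_le _ _).trans (add_le_add h₂
      ((measure_union_le _ _).trans (add_le_add h₃ h₄))))))
  intro ω hω
  by_contra hgood
  simp only [Set.mem_union, Set.mem_ofPred_eq, not_or, not_not] at hgood
  exact hω (h ω hgood.1 hgood.2.1 hgood.2.2.1 hgood.2.2.2)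

theorem rate_of_close {a t δ η : ℝ} (hd : 1 ≤ dK) (hdn : dK < dA) (hμ : 0 < μ) (hR : 0 < R)
    (ha : 0 < a) (ht : 0 < t) (hδ : 0 < δ) (hδ1 : δ < 1) (hb : Bounded 𝔅 𝔇 R)
    (hA : a ≤ lamA 𝔅 𝔇 μ) (hT : t ≤ lamTheta 𝔅 R)
    (hη : ∀ c s', a ≤ c → R ^ 2 * t ≤ s' → η ≤ c / 4 ∧
      8 * (2 / c) ^ 3 * (R ^ 2 + η) * η + 4 * (2 / c) ^ 2 * η < s' / 4)
    (hlow : 2 * R ^ 2 * (2 + ((2 * L : ℕ) : ℝ) / (2 * μ))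
        * (2 * Real.log (4 * dA / δ) / N) ^ (3 / 4 : ℝ)
      + 2 * (2 * R ^ 2 * (2 + ((2 * L : ℕ) : ℝ) / (2 * μ))) * (Real.log (4 * dA / δ) / (3 * N))
      ≤ R ^ 2 * √(Real.log (4 * dA / δ) / N))
    (hND : 3 * (√dA * √(Real.log (4 * dA / δ) / N)) ≤ a / 4)
    (hNM : 3 * (1 + 4 / μ) * (√dA * √(Real.log (4 * dA / δ) / N)) ≤ 1)
    {ω : Fin N → Traj X A dK L}
    (h0 : ‖barD 𝔅 μ 0 ω - matExp (trajLaw 𝔅 𝔇) (corrD 𝔅 μ 0)‖ ≤ η)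
    (h1 : ‖barD 𝔅 μ 1 ω - matExp (trajLaw 𝔅 𝔇) (corrD 𝔅 μ 1)‖ ≤ η)
    (hM : ‖barM 𝔅 μ ω - matExp (trajLaw 𝔅 𝔇) (outerM 𝔅 μ)‖ ≤ η)
    (hM2 : ‖avg (fun τ => outerM 𝔅 μ τ ^ 2) ω
      - matExp (trajLaw 𝔅 𝔇) (fun τ => outerM 𝔅 μ τ ^ 2)‖ ≤ R ^ 4) :
    OffDefined 𝔅 μ (eigGap dK (corrected 𝔅 μ ω)) (radiusD dA N δ) ω ∧
      deltaOff dK (eigGap dK (corrected 𝔅 μ ω)) (normB 𝔅 μ ω) R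
          (radiusM 𝔅 μ R δ ω) (radiusD dA N δ)
        ≤ 12 * (384 + 48 * (1 + 4 / μ)) * (1 / (lamTheta 𝔅 R * lamA 𝔅 𝔇 μ ^ 3))
          * √(dK * dA * Real.log (dA / δ) / N) := by
  have hA0 : 0 < lamA 𝔅 𝔇 μ := ha.trans_le hA
  have hT0 : 0 < lamTheta 𝔅 R := ht.trans_le hT
  have hβ := hb.betaVec_le
  have hn := hb.noise_le (pos_of_lamA_pos (by omega) hμ hA0)
  have hA1 : lamA 𝔅 𝔇 μ ≤ 1 := lamA_le_one (by omega) hμ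
  have hs : lamMin (latentCov 𝔅) = R ^ 2 * lamTheta 𝔅 R := by
    rw [lamTheta]
    field_simp
  have hlog := log_four_mul_div_le (n := dA) (by omega) hδ hδ1
  have hl0 : 0 ≤ Real.log (4 * dA / δ) := by
    refine Real.log_nonneg ?_
    have : (1 : ℝ) ≤ dA := by exact_mod_cast (by omega : 1 ≤ dA)
    rw [le_div_iff₀ hδ]
    linarith
  obtain ⟨hη1, hη2⟩ := hη (lamA 𝔅 𝔇 μ) (R ^ 2 * lamTheta 𝔅 R) hA (by gcongr)
  have hdA : (1 : ℝ) ≤ √dA := by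
    rw [Real.one_le_sqrt]
    exact_mod_cast (by omega : 1 ≤ dA)
  have hMr := radiusM_le (δ := δ) hμ hl0 rfl (by omega)
    (norm_avg_sq_le (𝔇 := 𝔇) hμ hβ hn (by omega) hM2) hlow
  have hDr : radiusD dA N δ ≤ 3 * (√dA * √(Real.log (4 * dA / δ) / N)) := by
    have h8 : √8 ≤ (3 : ℝ) := by
      rw [Real.sqrt_le_left (by norm_num)]
      norm_num
    rw [radiusD, mul_div_assoc, Real.sqrt_mul (by norm_num)]
    calc √8 * √(Real.log (4 * dA / δ) / N) = √8 * (1 * √(Real.log (4 * dA / δ) / N)) := by ring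
      _ ≤ _ := by gcongr
  have hMR : radiusM 𝔅 μ R δ ω ≤ R ^ 2 := by
    refine hMr.trans ?_
    calc 3 * (1 + 4 / μ) * R ^ 2 * (√dA * √(Real.log (4 * dA / δ) / N))
        = R ^ 2 * (3 * (1 + 4 / μ) * (√dA * √(Real.log (4 * dA / δ) / N))) := by ring
      _ ≤ R ^ 2 * 1 := by gcongr
      _ = R ^ 2 := mul_one _
  rw [matExp_corrD] at h0 h1
  rw [matExp_outerM hμ hR.le hβ hn] at hM
  obtain ⟨u0, u1, hgap, hBx, hle⟩ := deltaOff_le_of_close (dD := radiusD dA N δ)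
    (dM := radiusM 𝔅 μ R δ ω) hd hdn 𝔅.Ustar_orthonormal
    secondMoment_transpose (Ustar_mul_secondMoment hR.le hβ)
    (fun a => by rw [← hs]; exact lamMin_latentCov_le hR.le hβ a) (norm_secondMoment_le hR.le hβ)
    (norm_meanCorr_le hμ) hA0 lamA_mul_le_form (norm_barD_le hμ 0 ω) h0 h1 hM hη1 hη2
    (Real.sqrt_nonneg _) (by linarith) (radiusM_nonneg hμ hl0 ω) hMR
  refine ⟨⟨fun i => by fin_cases i; exacts [u0, u1], hgap, hBx⟩, hle.trans ?_⟩
  have hμ4 : 0 < 4 / μ := by positivity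
  rw [Real.sqrt_mul (by norm_num)]
  refine (rate_le hR hT0 hA0 hA1 (by linarith) (Real.sqrt_nonneg _) (by positivity) hDr hMr).trans ?_
  -- Replacing log(4 d_A/δ) by 4 log(d_A/δ) costs a factor √4 = 2, which turns the constant 6 into
  -- 12.
  have hfin : √dK * (√dA * √(Real.log (4 * dA / δ) / N))
      ≤ 2 * √(dK * dA * Real.log (dA / δ) / N) := by
    rw [← Real.sqrt_mul (by positivity), ← Real.sqrt_mul (by positivity),
      show (2 : ℝ) = √4 by rw [show (4 : ℝ) = 2 ^ 2 by norm_num, Real.sqrt_sq (by norm_num)],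
      ← Real.sqrt_mul (by norm_num)]
    refine Real.sqrt_le_sqrt ?_
    calc (dK : ℝ) * (dA * (Real.log (4 * dA / δ) / N))
        ≤ dK * (dA * (4 * Real.log (dA / δ) / N)) := by gcongr
      _ = _ := by ring
  calc _ ≤ 6 * (384 + 48 * (1 + 4 / μ)) * (1 / (lamTheta 𝔅 R * lamA 𝔅 𝔇 μ ^ 3))
        * (2 * √(dK * dA * Real.log (dA / δ) / N)) := by gcongr
    _ = _ := by ring

theorem abs_corrD_le (hμ : 0 < μ) (i : Fin 2) (τ : Traj X A dK L) (k l : Fin dA) :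
    |corrD 𝔅 μ i τ k l| ≤ 1 := by
  obtain ⟨w, hw⟩ := corrD_eq 𝔅 μ i τ
  rw [hw]
  exact abs_corrH_le hμ w k l

end Concentration

theorem exists_sample_size {μ : ℝ} (hμ : 0 < μ) (dA dK L : ℕ) {R a t δ : ℝ} (hd : 1 ≤ dK)
    (hdn : dK < dA) (hR : 0 < R) (ha : 0 < a) (ht : 0 < t) (hδ : 0 < δ) (hδ1 : δ < 1) :
    ∃ N₀ : ℕ, ∀ (X A : Type*) [MeasurableSpace X] [MeasurableSpace A]
      (𝔅 : Bandit X A dA dK) (𝔇 : Design X A L),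
      Bounded 𝔅 𝔇 R → a ≤ lamA 𝔅 𝔇 μ → t ≤ lamTheta 𝔅 R →
      ∀ N : ℕ, N₀ ≤ N →
      dataLaw 𝔅 𝔇 N {ω | ¬ (
          OffDefined 𝔅 μ (eigGap dK (corrected 𝔅 μ ω)) (radiusD dA N δ) ω ∧
          deltaOff dK (eigGap dK (corrected 𝔅 μ ω)) (normB 𝔅 μ ω) R
              (radiusM 𝔅 μ R δ ω) (radiusD dA N δ)
            ≤ 12 * (384 + 48 * (1 + 4 / μ)) * (1 / (lamTheta 𝔅 R * lamA 𝔅 𝔇 μ ^ 3))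
              * √(dK * dA * Real.log (dA / δ) / N))} ≤ ENNReal.ofReal δ := by
  obtain ⟨η, hη0, hη⟩ := exists_tolerance (R := R) ha (show 0 < R ^ 2 * t by positivity)
  have hl0 : 0 ≤ Real.log (4 * dA / δ) := by
    refine Real.log_nonneg ?_
    have : (1 : ℝ) ≤ dA := by exact_mod_cast (by omega : 1 ≤ dA)
    rw [le_div_iff₀ hδ]
    linarith
  have hδ4 : 0 < δ / 4 := by positivity
  have hlim : ∀ c : ℝ, Filter.Tendsto
      (fun N : ℕ => c * (√dA * √(Real.log (4 * dA / δ) / N))) Filter.atTop (nhds 0) := by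
    intro c
    have h1 := ((tendsto_const_div_atTop_nhds_zero_nat (Real.log (4 * dA / δ))).sqrt.const_mul
      √(dA : ℝ)).const_mul c
    simpa using h1
  have hev := ((eventually_lower_order_le (2 * R ^ 2 * (2 + ((2 * L : ℕ) : ℝ) / (2 * μ))) hl0
    hR).and ((hlim 3).eventually_le_const (show 0 < a / 4 by positivity))).and
    ((hlim (3 * (1 + 4 / μ))).eventually_le_const one_pos)
  have hevD := eventually_measure_norm_average_sub_le dA (by omega) 1 hη0 hδ4
  -- These entry bounds grow with L, which is harmless because they only move N₀.
  have hevM := eventually_measure_norm_average_sub_le dA (by omega)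
    (2 * (R ^ 2 + 4 * R ^ 2 * L / μ)) hη0 hδ4
  have hevM2 := eventually_measure_norm_average_sub_le dA (by omega)
    (dA * (2 * (R ^ 2 + 4 * R ^ 2 * L / μ)) ^ 2) (show 0 < R ^ 4 by positivity) hδ4
  obtain ⟨N₀, hN₀⟩ := Filter.eventually_atTop.mp (((hev.and hevD).and hevM).and hevM2)
  refine ⟨N₀, fun X A _ _ 𝔅 𝔇 hb hA hT N hN => ?_⟩
  obtain ⟨⟨⟨⟨⟨hlow, hND⟩, hNM⟩, hD⟩, hM⟩, hM2⟩ := hN₀ N hN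
  have hβ := hb.betaVec_le
  have hn := hb.noise_le (pos_of_lamA_pos (by omega) hμ (ha.trans_le hA))
  have hsplit := (measurePreserving_splitTraj 𝔅 𝔇).quasiMeasurePreserving
  have e0 : ∀ i, dataLaw 𝔅 𝔇 N
      {ω | ¬ ‖barD 𝔅 μ i ω - matExp (trajLaw 𝔅 𝔇) (corrD 𝔅 μ i)‖ ≤ η}
      ≤ ENNReal.ofReal (δ / 4) := fun i =>
    hD (Traj X A dK L) (trajLaw 𝔅 𝔇) (corrD 𝔅 μ i) (measurable_corrD 𝔅 𝔇 μ i)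
      (Filter.Eventually.of_forall fun τ => abs_corrD_le hμ i τ)
  have e1 : dataLaw 𝔅 𝔇 N
      {ω | ¬ ‖barM 𝔅 μ ω - matExp (trajLaw 𝔅 𝔇) (outerM 𝔅 μ)‖ ≤ η}
      ≤ ENNReal.ofReal (δ / 4) := by
    refine hM (Traj X A dK L) (trajLaw 𝔅 𝔇) (outerM 𝔅 μ) (fun i j => ?_) ?_
    · simp only [outerM_eq]
      exact measurable_comp_splitTraj 𝔅 𝔇 (measurable_splitM 𝔅 μ i j)
    · simp only [outerM_eq]
      exact hsplit.ae (ae_abs_splitM_le hμ hβ hn)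
  -- The empirical second moment only has to be of the right order, so its tolerance R⁴ is fixed
  -- rather than small.
  have e2 : dataLaw 𝔅 𝔇 N
      {ω | ¬ ‖avg (fun τ => outerM 𝔅 μ τ ^ 2) ω
        - matExp (trajLaw 𝔅 𝔇) (fun τ => outerM 𝔅 μ τ ^ 2)‖ ≤ R ^ 4}
      ≤ ENNReal.ofReal (δ / 4) := by
    refine hM2 (Traj X A dK L) (trajLaw 𝔅 𝔇) (fun τ => outerM 𝔅 μ τ ^ 2) (fun i j => ?_) ?_
    · simp only [outerM_eq]
      exact measurable_comp_splitTraj 𝔅 𝔇 (measurable_splitM_sq 𝔅 μ i j)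
    · simp only [outerM_eq]
      exact hsplit.ae (ae_abs_splitM_sq_le hμ hβ hn)
  exact measure_good_compl_le hδ.le (e0 0) (e0 1) e1 e2 fun ω h0 h1 h2 h3 =>
    rate_of_close hd hdn hμ hR ha ht hδ hδ1 hb hA hT hη hlow hND hNM h0 h1 h2 h3

end LatentBandit

open LatentBandit in
theorem theorem2 :
    -- Validity: for any (possibly data-dependent) radii `dM`, `dD`, and for the eigengap of the
    -- averaged outer product matrix as well as for that of the corrected matrix.
    (∀ (X A : Type*) [MeasurableSpace X] [MeasurableSpace A] (dA dK L N : ℕ)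
      (𝔅 : Bandit X A dA dK) (𝔇 : Design X A L) (μ R δ : ℝ)
      (dM dD : (Fin N → Traj X A dK L) → ℝ),
      1 ≤ dK → dK < dA → 0 < μ → 0 < R → 0 < δ → δ < 1 →
      Bounded 𝔅 𝔇 R → 0 < lamA 𝔅 𝔇 μ → 0 < lamTheta 𝔅 R →
      dataLaw 𝔅 𝔇 N {ω | ¬ ‖barM 𝔅 μ ω - matExp (trajLaw 𝔅 𝔇) (outerM 𝔅 μ)‖ ≤ dM ω}
        ≤ ENNReal.ofReal (δ / 3) →
      (∀ i, dataLaw 𝔅 𝔇 N {ω | ¬ ‖barD 𝔅 μ i ω - matExp (trajLaw 𝔅 𝔇) (corrD 𝔅 μ i)‖ ≤ dD ω}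
        ≤ ENNReal.ofReal (δ / 3)) →
      dataLaw 𝔅 𝔇 N {ω | ¬ ∀ Uhat : Matrix (Fin dA) (Fin dK) ℝ,
          IsTopEigenbasis (corrected 𝔅 μ ω) Uhat →
          ∀ g, (g = eigGap dK (barM 𝔅 μ ω) ∨ g = eigGap dK (corrected 𝔅 μ ω)) →
            OffDefined 𝔅 μ g (dD ω) ω →
            ‖Uhat * Uhatᵀ - 𝔅.Ustar * 𝔅.Ustarᵀ‖
              ≤ deltaOff dK g (normB 𝔅 μ ω) R (dM ω) (dD ω)}
        ≤ ENNReal.ofReal δ) ∧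
    -- Rate: with the concentration radii, and the eigengap of the corrected matrix.
    (∀ μ : ℝ, 0 < μ → ∃ C : ℝ, 0 < C ∧
      ∀ (dA dK L : ℕ) (R a t δ : ℝ), 1 ≤ dK → dK < dA → 0 < R → 0 < a → 0 < t → 0 < δ → δ < 1 →
      ∃ N₀ : ℕ, ∀ (X A : Type*) [MeasurableSpace X] [MeasurableSpace A]
        (𝔅 : Bandit X A dA dK) (𝔇 : Design X A L),
        Bounded 𝔅 𝔇 R → a ≤ lamA 𝔅 𝔇 μ → t ≤ lamTheta 𝔅 R →
        ∀ N : ℕ, N₀ ≤ N →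
        dataLaw 𝔅 𝔇 N {ω | ¬ (
            OffDefined 𝔅 μ (eigGap dK (corrected 𝔅 μ ω)) (radiusD dA N δ) ω ∧
            deltaOff dK (eigGap dK (corrected 𝔅 μ ω)) (normB 𝔅 μ ω) R
                (radiusM 𝔅 μ R δ ω) (radiusD dA N δ)
              ≤ C * (1 / (lamTheta 𝔅 R * lamA 𝔅 𝔇 μ ^ 3))
                * √(dK * dA * Real.log (dA / δ) / N))}
          ≤ ENNReal.ofReal δ) := by
  constructor
  · intro X A _ _ dA dK L N 𝔅 𝔇 μ R δ dM dD hd hdn hμ hR hδ _ hb hA _ hM hD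
    exact measure_validity_failure_le hd hdn hμ hR.le hδ.le hb hA hM hD
  · intro μ hμ
    refine ⟨12 * (384 + 48 * (1 + 4 / μ)), by positivity, ?_⟩
    intro dA dK L R a t δ hd hdn hR ha ht hδ hδ1
    exact exists_sample_size hμ dA dK L hd hdn hR ha ht hδ hδ1
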